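/- Let $\Pi=(\pi_{i,j})$ be an irreducible stochastic $M\times M$ matrix with stationary distribution $\phi$, let $(X(n))_{n\ge 0}$ be a Markov chain on $\{1,\dots,M\}$ with transition matrix $\Pi$ and arbitrary initial law, and let $f:\{1,\dots,M\}\to\mathbb{R}$ satisfy $f(i)\neq 0$ for every $i$ and $\sum_i\phi_i f(i)<0$ (the increments $f(X(n))$ have negative stationary mean). Put $S(n)=\sum_{k=1}^n f(X(k))$. For $n\ge 0$ let $\hat\Pi(n)$ be the empirical transition matrix $$\hat\pi(n)_{i,j}=\frac{\#\{1\le k\le n:\ X(k-1)=i,\ X(k)=j\}}{\#\{1\le k\le n:\ X(k-1)=i\}},\qquad 0/0:=0,$$ let $D_\theta=\mathrm{diag}(e^{\theta f(1)},\dots,e^{\theta f(M)})$, let $\rho$ denote the spectral radius, and set $\hat\lambda(n,\theta)=\log\rho(\hat\Pi(n)D_\theta)\in[-\infty,\infty)$ and $$\theta^*(n)=\sup\{\theta\in\mathbb{R}:\hat\lambda(n,\theta)\le 0\}\in[0,\infty].$$ Then the limit $\lambda(\theta)=\lim_{n\to\infty}\frac1n\log E[e^{\theta S(n)}]$ exists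 and is finite for every $\theta\in\mathbb{R}$; put $\theta^*=\sup\{\theta\in\mathbb{R}:\lambda(\theta)\le 0\}\in[0,\infty]$ (Loynes' exponent). There is a function $J:[0,\infty]\to[0,\infty]$, lower semicontinuous and with compact level sets $\{J\le c\}$, $c<\infty$ (a good rate function), such that for every Borel set $B\subseteq[0,\infty]$ $$-\inf_{x\in B^\circ}J(x)\le\liminf_{n\to\infty}\frac1n\log P(\theta^*(n)\in B)\le\limsup_{n\to\infty}\frac1n\log P(\theta^*(n)\in B)\le-\inf_{x\in\bar B}J(x),$$ and the estimator is consistent: $J(x)=0$ if and only if $x=\theta^*$. -/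

import Mathlib

open MeasureTheory Filter Topology
open scoped ENNReal Matrix

/-- `X` is a Markov chain on `{1, …, M}` with transition matrix `Q` under `P` (with an arbitrary
initial law): `Q` is a stochastic matrix and, for all `n` and all states `x 0, …, x (n + 1)`,
`P(X 0 = x 0, …, X (n+1) = x (n+1)) = P(X 0 = x 0, …, X n = x n) * Q (x n) (x (n+1))`. -/
structure IsMarkovChain {M : ℕ} {Ω : Type*} [MeasurableSpace Ω] (P : Measure Ω)
    (Q : Matrix (Fin M) (Fin M) ℝ) (X : ℕ → Ω → Fin M) : Prop where
  stochastic : Q ∈ Matrix.rowStochastic ℝ (Fin M)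
  measurable : ∀ n, Measurable (X n)
  markov : ∀ (n : ℕ) (x : ℕ → Fin M),
    P {ω | ∀ k ≤ n + 1, X k ω = x k} =
      P {ω | ∀ k ≤ n, X k ω = x k} * ENNReal.ofReal (Q (x n) (x (n + 1)))

/-- `lam` is the scaled cumulant generating function of the partial sums
`S n = Y 1 + ⋯ + Y n`: for every `θ`, `n⁻¹ log E[exp (θ S n)]` converges to `lam θ`. -/
def IsScaledCGF {Ω : Type*} [MeasurableSpace Ω] (P : Measure Ω) (Y : ℕ → Ω → ℝ)
    (lam : ℝ → ℝ) : Prop :=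
  ∀ θ : ℝ, Tendsto
    (fun n : ℕ => (n : ℝ)⁻¹ * Real.log (∫ ω, Real.exp (θ * ∑ k ∈ Finset.Icc 1 n, Y k ω) ∂P))
    atTop (𝓝 (lam θ))

/-- The supremum in `[0, ∞]` of a set of reals. It is applied below only to sets that contain `0`
(`lam 0 = 0`, and an empirical transition matrix has spectral radius at most `1`), so truncating
the negative elements to `0` does not change the supremum. -/
noncomputable def supInENNReal (S : Set ℝ) : ℝ≥0∞ :=
  ⨆ θ ∈ S, ENNReal.ofReal θ

/-- Loynes' exponent `sup {θ : lam θ ≤ 0}`. -/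
noncomputable def loynesExponent (lam : ℝ → ℝ) : ℝ≥0∞ :=
  supInENNReal {θ : ℝ | lam θ ≤ 0}

/-- The empirical transition matrix of the path `x 0, …, x n`: the number of transitions from `i`
to `j` divided by the number of transitions out of `i`, with `0 / 0 = 0`. -/
noncomputable def empiricalTransition {M : ℕ} (n : ℕ) (x : ℕ → Fin M) :
    Matrix (Fin M) (Fin M) ℝ :=
  Matrix.of fun i j =>
    (∑ k ∈ Finset.Icc 1 n, if x (k - 1) = i ∧ x k = j then (1 : ℝ) else 0) /
      (∑ k ∈ Finset.Icc 1 n, if x (k - 1) = i then (1 : ℝ) else 0)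

/-- The tilted matrix `A D_θ`, with `D_θ = diag (exp (θ f 1), …, exp (θ f M))`. -/
noncomputable def tilted {M : ℕ} (A : Matrix (Fin M) (Fin M) ℝ) (f : Fin M → ℝ) (θ : ℝ) :
    Matrix (Fin M) (Fin M) ℝ :=
  A * Matrix.diagonal fun i => Real.exp (θ * f i)

/-- `log ρ(A)` in `[-∞, ∞]`, where `ρ(A)` is the spectral radius (largest modulus of a complex
eigenvalue) of the real matrix `A`; `log 0 = -∞`. -/
noncomputable def logSpectralRadius {M : ℕ} (A : Matrix (Fin M) (Fin M) ℝ) : EReal :=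
  ENNReal.log (spectralRadius ℂ (A.map (fun a : ℝ => (a : ℂ))))

/-- The estimate of Loynes' exponent from the path `x 0, …, x n`: the supremum of the `θ` at which
the estimated scaled cumulant generating function `log ρ(Π̂(n) D_θ)` is at most `0`. -/
noncomputable def loynesEstimate {M : ℕ} (f : Fin M → ℝ) (n : ℕ) (x : ℕ → Fin M) : ℝ≥0∞ :=
  supInENNReal {θ : ℝ | logSpectralRadius (tilted (empiricalTransition n x) f θ) ≤ 0}

/-- `J` is a good rate function: lower semicontinuous with compact level sets. -/
structure IsGoodRateFunction {E : Type*} [TopologicalSpace E] (J : E → ℝ≥0∞) : Prop where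
  lowerSemicontinuous : LowerSemicontinuous J
  isCompact_level : ∀ c : ℝ≥0∞, c ≠ ∞ → IsCompact {x | J x ≤ c}

/-- `n⁻¹ log P(Z n ∈ B)`, in `[-∞, ∞]`. -/
noncomputable def logProbRate {Ω E : Type*} [MeasurableSpace Ω] (P : Measure Ω)
    (Z : ℕ → Ω → E) (B : Set E) (n : ℕ) : EReal :=
  (((n : ℝ)⁻¹ : ℝ) : EReal) * ENNReal.log (P {ω | Z n ω ∈ B})

/-- The sequence `Z` satisfies the large deviation principle (at speed `n`) with rate
function `J`. -/
def SatisfiesLDP {Ω E : Type*} [MeasurableSpace Ω] [TopologicalSpace E] [MeasurableSpace E]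
    (P : Measure Ω) (Z : ℕ → Ω → E) (J : E → ℝ≥0∞) : Prop :=
  ∀ B : Set E, MeasurableSet B →
    -((⨅ x ∈ interior B, J x : ℝ≥0∞) : EReal) ≤ liminf (logProbRate P Z B) atTop ∧
    limsup (logProbRate P Z B) atTop ≤ -((⨅ x ∈ closure B, J x : ℝ≥0∞) : EReal)

/-!
The estimate depends on the path only through its *empirical flow* `n⁻¹ N`, where `N i j` is the
number of steps from `i` to `j`: the empirical transition matrix is obtained from `N` by
normalising the rows (`rowNorm`), so the estimate is `exponent f (rowNorm N)`. Limits of empirical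
flows are *flows* (`IsFlow`): probabilities on the edges of `Q` with equal marginals. The empirical
flow satisfies a large deviation principle whose rate is the relative entropy `flowEntropy Q F` of
the rows of `F` with respect to `Q`. The upper bound (`eventually_flowMass_le`) holds because a path
with step counts `N` has probability at most `exp (-flowEntropy Q N)` and there are polynomially
many step counts; the lower bound (`eventually_le_flowMass`) is a change of measure to the chain
`rowNorm F`.

If the exponent were continuous, the contraction principle would finish the proof. It is
continuous at *full* flows, which charge every edge of `Q` (`IsDriftChain.tendsto_exponent`), but
not at flows with vanishing rows, or at reducible ones. The rate function is therefore defined by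
full flows only: `rateFunction Q f x` is the limit, as the neighbourhood `U` of `x` shrinks, of the
least entropy of a full flow with exponent in `U`. The lower bound of the principle is then
immediate, and the upper bound needs that exponents near an arbitrary flow `ν` are not cheaper than
those of full flows:

* if exponents at least `θ'` occur arbitrarily close to `ν`, then there are full flows with exponent
  at least `θ`, for any `θ < θ'`, whose entropy is close to that of `ν`
  (`IsDriftChain.exists_full_of_admissible`);
* if all full flows with entropy close to that of `ν` have exponent at least `θ'`, then near `ν` all
  exponents are at least `θ < θ'` (`IsDriftChain.eventually_admissible_of_forall_full`).

Both rest on the description of the condition `ρ(A D_θ) ≤ 1` by *subinvariant vectors* `u > 0`,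
`A D_θ u ≤ τ u` for all `τ > 1` (`logSpectralRadius_le_zero_iff`). A subinvariant vector at `θ'`
yields one at `θ < θ'`, with strict inequality except where `θ' f` is the increment of a potential
(`SubInv.interpolate`), and strict inequality spreads backwards along edges and survives
perturbation. The negative drift enters through `IsDriftChain.not_potential` and its consequence
`IsDriftChain.exists_extension_strict`, which deal with flows along which `f` is the increment of a
potential.

Since a mixture of a full flow with the stationary one has no larger entropy, the exponents of full
flows of entropy at most `c` form an interval around the exponent of `Q`
(`IsDriftChain.exists_full_of_mem_uIcc`), so that closed sets may be treated on the two sides of it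
separately (`IsDriftChain.eventually_exponent_notMem`). Only the stationary flow has entropy zero,
which gives consistency; and the scaled cumulant generating function is the logarithm of the Perron
root of `Q D_θ`, so that Loynes' exponent is the exponent of `Q` (`IsMarkovChain.exists_scaledCGF`).
-/

/-! ### Subinvariant vectors of nonnegative matrices -/

section SubInvariant

variable {ι : Type*} [Fintype ι]

/-- `u` is a positive vector with `A u ≤ τ u` entrywise. -/
structure SubInv (A : Matrix ι ι ℝ) (τ : ℝ) (u : ι → ℝ) : Prop where
  pos : ∀ i, 0 < u i
  le : ∀ i, ∑ j, A i j * u j ≤ τ * u i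

/-- `j` can be reached from `i` along the positive entries of `A`. -/
def Reach (A : Matrix ι ι ℝ) : ι → ι → Prop :=
  Relation.ReflTransGen fun i j => 0 < A i j

lemma SubInv.mono {A : Matrix ι ι ℝ} {τ τ' : ℝ} {u : ι → ℝ} (hu : SubInv A τ u) (h : τ ≤ τ') :
    SubInv A τ' u :=
  ⟨hu.pos, fun i => (hu.le i).trans (mul_le_mul_of_nonneg_right h (hu.pos i).le)⟩

/-- Replacing `u` by `u + A u` moves strict inequality one step backwards along an edge. -/
lemma SubInv.add_apply {A : Matrix ι ι ℝ} {τ : ℝ} {u : ι → ℝ} (hA : ∀ i j, 0 ≤ A i j)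
    (hu : SubInv A τ u) :
    SubInv A τ (fun i => u i + ∑ j, A i j * u j) ∧
      ∀ i j, 0 < A i j → ∑ k, A j k * u k < τ * u j →
        ∑ k, A i k * (u k + ∑ l, A k l * u l) < τ * (u i + ∑ l, A i l * u l) := by
  have key : ∀ i, ∑ k, A i k * (∑ l, A k l * u l) ≤ τ * ∑ l, A i l * u l := by
    intro i
    rw [Finset.mul_sum]
    refine Finset.sum_le_sum fun k _ => ?_
    calc A i k * (∑ l, A k l * u l) ≤ A i k * (τ * u k) :=
          mul_le_mul_of_nonneg_left (hu.le k) (hA i k)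
      _ = τ * (A i k * u k) := by ring
  refine ⟨⟨fun i => add_pos_of_pos_of_nonneg (hu.pos i)
    (Finset.sum_nonneg fun j _ => mul_nonneg (hA i j) (hu.pos j).le), fun i => ?_⟩, ?_⟩
  · simp only [mul_add, Finset.sum_add_distrib]
    exact add_le_add (hu.le i) (key i)
  · intro i j hij hj
    simp only [mul_add, Finset.sum_add_distrib]
    refine add_lt_add_of_le_of_lt (hu.le i) ?_
    rw [Finset.mul_sum]
    refine Finset.sum_lt_sum (fun k _ => ?_) ⟨j, Finset.mem_univ _, ?_⟩
    · calc A i k * (∑ l, A k l * u l) ≤ A i k * (τ * u k) :=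
            mul_le_mul_of_nonneg_left (hu.le k) (hA i k)
        _ = τ * (A i k * u k) := by ring
    · calc A i j * (∑ l, A j l * u l) < A i j * (τ * u j) := mul_lt_mul_of_pos_left hj hij
        _ = τ * (A i j * u j) := by ring

lemma SubInv.exists_strict_at {A : Matrix ι ι ℝ} {τ : ℝ} {u : ι → ℝ} (hA : ∀ i j, 0 ≤ A i j)
    (hu : SubInv A τ u) {i j : ι} (hij : Reach A i j) (hj : ∑ k, A j k * u k < τ * u j) :
    ∃ v, SubInv A τ v ∧ ∑ k, A i k * v k < τ * v i := by
  induction hij using Relation.ReflTransGen.head_induction_on with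
  | refl => exact ⟨u, hu, hj⟩
  | head h _ ih =>
    obtain ⟨v, hv, hvs⟩ := ih
    exact ⟨_, (hv.add_apply hA).1, (hv.add_apply hA).2 _ _ h hvs⟩

/-- A subinvariant vector can be modified so that it is strictly subinvariant at every state from
which a state with strict inequality can be reached. -/
lemma SubInv.exists_strict {A : Matrix ι ι ℝ} {τ : ℝ} {u : ι → ℝ} (hA : ∀ i j, 0 ≤ A i j)
    (hu : SubInv A τ u) :
    ∃ v, SubInv A τ v ∧ ∀ i, (∃ j, Reach A i j ∧ ∑ k, A j k * u k < τ * u j) →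
      ∑ k, A i k * v k < τ * v i := by
  classical
  have h : ∀ i, ∃ v, SubInv A τ v ∧ ((∃ j, Reach A i j ∧ ∑ k, A j k * u k < τ * u j) →
      ∑ k, A i k * v k < τ * v i) := by
    intro i
    by_cases hi : ∃ j, Reach A i j ∧ ∑ k, A j k * u k < τ * u j
    · obtain ⟨j, hij, hj⟩ := hi
      obtain ⟨v, hv, hvs⟩ := hu.exists_strict_at hA hij hj
      exact ⟨v, hv, fun _ => hvs⟩
    · exact ⟨u, hu, fun h => absurd h hi⟩
  choose V hV hVs using h
  have hswap : ∀ i, ∑ k, A i k * (∑ a, V a k) = ∑ a, ∑ k, A i k * V a k := by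
    intro i
    simp only [Finset.mul_sum]
    exact Finset.sum_comm
  refine ⟨fun i => ∑ a, V a i, ⟨fun i => Finset.sum_pos (fun a _ => (hV a).pos i) ⟨i, by simp⟩,
    fun i => ?_⟩, fun i hi => ?_⟩
  · rw [hswap, Finset.mul_sum]
    exact Finset.sum_le_sum fun a _ => (hV a).le i
  · simp only
    rw [hswap, Finset.mul_sum]
    exact Finset.sum_lt_sum (fun a _ => (hV a).le i) ⟨i, by simp, hVs i hi⟩

/-- Harnack inequality: along the edges of `A`, subinvariant vectors grow by a bounded factor. -/
lemma SubInv.le_mul_of_reach {A : Matrix ι ι ℝ} (hA : ∀ i j, 0 ≤ A i j) {i j : ι}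
    (hij : Reach A i j) (τ : ℝ) : ∃ K : ℝ, 0 < K ∧ ∀ u, SubInv A τ u → u j ≤ K * u i := by
  induction hij with
  | refl => exact ⟨1, one_pos, fun u _ => by simp⟩
  | @tail b c _ h ih =>
    obtain ⟨K, hK, hKu⟩ := ih
    refine ⟨(|τ| + 1) / A b c * K, by positivity, fun u hu => ?_⟩
    have h1 : A b c * u c ≤ τ * u b :=
      (Finset.single_le_sum (fun j _ => mul_nonneg (hA b j) (hu.pos j).le)
        (Finset.mem_univ c)).trans (hu.le b)
    have h2 : τ * u b ≤ (|τ| + 1) * u b :=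
      mul_le_mul_of_nonneg_right (by linarith [le_abs_self τ]) (hu.pos b).le
    have h3 : (|τ| + 1) * u b ≤ (|τ| + 1) * (K * u i) :=
      mul_le_mul_of_nonneg_left (hKu u hu) (by positivity)
    rw [div_mul_eq_mul_div, div_mul_eq_mul_div, le_div_iff₀ h]
    linarith

/-- If every edge of `A` lies on a cycle, then subinvariance at all levels `τ > τ₀` implies
subinvariance at level `τ₀`: normalised in each class, the vectors stay in a compact set. -/
lemma exists_subInv_of_forall_gt {A : Matrix ι ι ℝ} {τ₀ : ℝ} (hA : ∀ i j, 0 ≤ A i j)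
    (hrec : ∀ i j, 0 < A i j → Reach A j i) (h : ∀ τ > τ₀, ∃ u, SubInv A τ u) :
    ∃ u, SubInv A τ₀ u := by
  classical
  have hsymm : ∀ i j, Reach A i j → Reach A j i := by
    intro i j hij
    induction hij with
    | refl => exact Relation.ReflTransGen.refl
    | tail _ h ih => exact (hrec _ _ h).trans ih
  let S : Setoid ι := ⟨Reach A, ⟨fun _ => Relation.ReflTransGen.refl, fun h => hsymm _ _ h,
    fun h h' => h.trans h'⟩⟩
  let rep : ι → ι := fun i => (Quotient.mk S i).out
  have hrep : ∀ i, Reach A (rep i) i := fun i => Quotient.exact (Quotient.out_eq (Quotient.mk S i))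
  have hrepeq : ∀ i j, 0 < A i j → rep i = rep j := fun i j hij =>
    congrArg Quotient.out (Quotient.sound (s := S) (Relation.ReflTransGen.single hij))
  choose K hK hKu using fun i => SubInv.le_mul_of_reach hA (hrep i) (τ₀ + 1)
  choose L hL hLu using fun i => SubInv.le_mul_of_reach hA (hsymm _ _ (hrep i)) (τ₀ + 1)
  have hseq : ∀ n : ℕ, ∃ v : ι → ℝ, v ∈ Set.pi Set.univ (fun i => Set.Icc (1 / L i) (K i)) ∧
      ∀ i, ∑ j, A i j * v j ≤ (τ₀ + 1 / ((n : ℝ) + 1)) * v i := by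
    intro n
    have hn : (0 : ℝ) < 1 / ((n : ℝ) + 1) := Nat.one_div_pos_of_nat
    have hn1 : (1 : ℝ) / ((n : ℝ) + 1) ≤ 1 := by
      rw [div_le_one (by positivity)]
      have : (0 : ℝ) ≤ n := n.cast_nonneg
      linarith
    obtain ⟨u, hu⟩ := h (τ₀ + 1 / ((n : ℝ) + 1)) (by linarith)
    have hu1 : SubInv A (τ₀ + 1) u := hu.mono (by linarith)
    refine ⟨fun i => u i / u (rep i), fun i _ => ⟨?_, ?_⟩, fun i => ?_⟩
    · have := hLu i u hu1
      rw [div_le_div_iff₀ (hL i) (hu.pos _)]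
      linarith
    · rw [div_le_iff₀ (hu.pos _)]
      exact hKu i u hu1
    · have : ∑ j, A i j * (u j / u (rep j)) = (∑ j, A i j * u j) / u (rep i) := by
        rw [Finset.sum_div]
        refine Finset.sum_congr rfl fun j _ => ?_
        rcases (hA i j).eq_or_lt with h0 | h0
        · simp [← h0]
        · rw [hrepeq i j h0, mul_div_assoc]
      rw [this, ← mul_div_assoc]
      exact div_le_div_of_nonneg_right (hu.le i) (hu.pos _).le
  choose v hvmem hv using hseq
  obtain ⟨w, hw, σ, hσ, hlim⟩ := (isCompact_univ_pi fun i =>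
    (isCompact_Icc : IsCompact (Set.Icc (1 / L i) (K i)))).tendsto_subseq hvmem
  refine ⟨w, fun i => (one_div_pos.2 (hL i)).trans_le (hw i trivial).1, fun i => ?_⟩
  have hcoord : ∀ j, Tendsto (fun n => v (σ n) j) atTop (𝓝 (w j)) := fun j =>
    (tendsto_pi_nhds.1 hlim) j
  have h1 : Tendsto (fun n => ∑ j, A i j * v (σ n) j) atTop (𝓝 (∑ j, A i j * w j)) :=
    tendsto_finsetSum _ fun j _ => (hcoord j).const_mul _
  have h2 : Tendsto (fun n => (τ₀ + 1 / (((σ n : ℕ) : ℝ) + 1)) * v (σ n) i) atTop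
      (𝓝 ((τ₀ + 0) * w i)) :=
    (((tendsto_one_div_add_atTop_nhds_zero_nat (𝕜 := ℝ)).comp hσ.tendsto_atTop).const_add
      τ₀).mul (hcoord i)
  rw [add_zero] at h2
  exact le_of_tendsto_of_tendsto' h1 h2 fun n => hv (σ n) i

/-- **Perron's theorem**: an irreducible nonnegative matrix has a positive eigenvector, and its
eigenvalue is positive. -/
lemma exists_perron [Nonempty ι] {A : Matrix ι ι ℝ} (hA : ∀ i j, 0 ≤ A i j)
    (hirr : ∀ i j, Reach A i j) (hrow : ∀ i, ∃ j, 0 < A i j) :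
    ∃ (ρ : ℝ) (r : ι → ℝ), 0 < ρ ∧ (∀ i, 0 < r i) ∧ ∀ i, ∑ j, A i j * r j = ρ * r i := by
  have hpos : ∀ (u : ι → ℝ), (∀ i, 0 < u i) → ∀ i, 0 < ∑ j, A i j * u j := by
    intro u hu i
    obtain ⟨j, hj⟩ := hrow i
    exact Finset.sum_pos' (fun k _ => mul_nonneg (hA i k) (hu k).le)
      ⟨j, Finset.mem_univ _, mul_pos hj (hu j)⟩
  let S : Set ℝ := {τ | ∃ u, SubInv A τ u}
  have hSpos : ∀ τ ∈ S, 0 < τ := by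
    rintro τ ⟨u, hu⟩
    obtain ⟨i⟩ := ‹Nonempty ι›
    exact pos_of_mul_pos_left ((hpos u hu.pos i).trans_le (hu.le i)) (hu.pos i).le
  have hSbdd : BddBelow S := ⟨0, fun τ hτ => (hSpos τ hτ).le⟩
  have hSne : S.Nonempty := by
    refine ⟨∑ i, ∑ j, A i j, fun _ => 1, fun _ => one_pos, fun i => ?_⟩
    simp only [mul_one]
    exact Finset.single_le_sum (f := fun i => ∑ j, A i j)
      (fun i _ => Finset.sum_nonneg fun j _ => hA i j) (Finset.mem_univ i)
  have hmin : ∀ τ > sInf S, ∃ u, SubInv A τ u := by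
    intro τ hτ
    obtain ⟨τ', ⟨u, hu⟩, hlt⟩ := (csInf_lt_iff hSbdd hSne).1 hτ
    exact ⟨u, hu.mono hlt.le⟩
  obtain ⟨u, hu⟩ := exists_subInv_of_forall_gt hA (fun i j _ => hirr j i) hmin
  refine ⟨sInf S, u, hSpos _ ⟨u, hu⟩, hu.pos, fun i => ?_⟩
  by_contra hne
  -- A strict inequality somewhere could be spread to all states, and then `sInf S` lowered.
  have hlt : ∑ j, A i j * u j < sInf S * u i := lt_of_le_of_ne (hu.le i) hne
  obtain ⟨v, hv, hvs⟩ := hu.exists_strict hA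
  have hvs' : ∀ k, (∑ j, A k j * v j) / v k < sInf S := fun k => by
    rw [div_lt_iff₀ (hv.pos k)]
    exact hvs k ⟨i, hirr k i, hlt⟩
  obtain ⟨k, hk⟩ := Finite.exists_max fun k => (∑ j, A k j * v j) / v k
  have hmem : (∑ j, A k j * v j) / v k ∈ S :=
    ⟨v, hv.pos, fun l => (div_le_iff₀ (hv.pos l)).1 (hk l)⟩
  exact (hvs' k).not_ge (csInf_le hSbdd hmem)

/-- The Perron root is the least level of subinvariance. -/
lemma perron_le_of_subInv [Nonempty ι] {A : Matrix ι ι ℝ} (hA : ∀ i j, 0 ≤ A i j) {ρ : ℝ}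
    {r : ι → ℝ} (hr : ∀ i, 0 < r i) (heq : ∀ i, ∑ j, A i j * r j = ρ * r i) {τ : ℝ}
    {u : ι → ℝ} (hu : SubInv A τ u) : ρ ≤ τ := by
  obtain ⟨i, hi⟩ := Finite.exists_min fun i => u i / r i
  have h1 : ∀ j, u i / r i * r j ≤ u j := fun j => (le_div_iff₀ (hr j)).1 (hi j)
  have h2 : u i / r i * (ρ * r i) ≤ τ * u i := by
    rw [← heq i, Finset.mul_sum]
    refine le_trans (Finset.sum_le_sum fun j _ => ?_) (hu.le i)
    calc u i / r i * (A i j * r j) = A i j * (u i / r i * r j) := by ring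
      _ ≤ A i j * u j := mul_le_mul_of_nonneg_left (h1 j) (hA i j)
  have h3 : u i / r i * (ρ * r i) = ρ * u i := by
    field_simp [(hr i).ne']
  rw [h3] at h2
  exact le_of_mul_le_mul_right h2 (hu.pos i)

end SubInvariant

/-! ### Spectral radius and subinvariance -/

section SpectralRadius

variable {M : ℕ}

/-- A subinvariant vector bounds the eigenvalues, by the maximum principle for `‖v i‖ / u i`. -/
lemma norm_le_of_mem_spectrum {A : Matrix (Fin M) (Fin M) ℝ} (hA : ∀ i j, 0 ≤ A i j) {τ : ℝ}
    {u : Fin M → ℝ} (hu : SubInv A τ u) {k : ℂ}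
    (hk : k ∈ spectrum ℂ (A.map (fun a : ℝ => (a : ℂ)))) : ‖k‖ ≤ τ := by
  rw [← Matrix.spectrum_toLin', ← Module.End.hasEigenvalue_iff_mem_spectrum] at hk
  obtain ⟨v, hv⟩ := hk.exists_hasEigenvector
  have hv0 := hv.2
  have hve : ∀ i, ∑ j, (A i j : ℂ) * v j = k * v i := fun i => by
    have := congrFun hv.apply_eq_smul i
    simpa [Matrix.toLin'_apply, Matrix.mulVec, dotProduct] using this
  obtain ⟨a, ha⟩ := Function.ne_iff.1 hv0
  have : Nonempty (Fin M) := ⟨a⟩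
  obtain ⟨i, hi⟩ := Finite.exists_max fun i => ‖v i‖ / u i
  have hvi : 0 < ‖v i‖ := by
    have h1 : 0 < ‖v a‖ / u a := div_pos (norm_pos_iff.2 ha) (hu.pos a)
    have := h1.trans_le (hi a)
    exact (div_pos_iff_of_pos_right (hu.pos i)).1 this
  have h1 : ∀ j, ‖v j‖ ≤ ‖v i‖ / u i * u j := fun j => (div_le_iff₀ (hu.pos j)).1 (hi j)
  have h2 : ‖k‖ * ‖v i‖ ≤ τ * ‖v i‖ := by
    rw [← norm_mul, ← hve i]
    calc ‖∑ j, (A i j : ℂ) * v j‖ ≤ ∑ j, A i j * ‖v j‖ := by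
          refine (norm_sum_le _ _).trans (Finset.sum_le_sum fun j _ => ?_)
          rw [norm_mul, Complex.norm_real, Real.norm_of_nonneg (hA i j)]
      _ ≤ ∑ j, A i j * (‖v i‖ / u i * u j) :=
          Finset.sum_le_sum fun j _ => mul_le_mul_of_nonneg_left (h1 j) (hA i j)
      _ = ‖v i‖ / u i * ∑ j, A i j * u j := by
          rw [Finset.mul_sum]
          exact Finset.sum_congr rfl fun j _ => by ring
      _ ≤ ‖v i‖ / u i * (τ * u i) :=
          mul_le_mul_of_nonneg_left (hu.le i) (div_nonneg hvi.le (hu.pos i).le)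
      _ = τ * ‖v i‖ := by field_simp [(hu.pos i).ne']
  exact le_of_mul_le_mul_right h2 hvi

section Gelfand

attribute [local instance] Matrix.linftyOpNormedRing Matrix.linftyOpNormedAlgebra

/-- By Gelfand's formula. -/
lemma exists_pow_norm_le_of_spectralRadius_le_one {B : Matrix (Fin M) (Fin M) ℂ}
    (hB : spectralRadius ℂ B ≤ 1) {τ : ℝ} (hτ : 1 < τ) :
    ∃ n : ℕ, 1 ≤ n ∧ ‖B ^ n‖ ≤ τ ^ n := by
  have hlt : spectralRadius ℂ B < ENNReal.ofReal τ :=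
    hB.trans_lt (by simpa using (ENNReal.ofReal_lt_ofReal_iff (by linarith)).2 hτ)
  have h := spectrum.pow_norm_pow_one_div_tendsto_nhds_spectralRadius B
  have h' := ((h.eventually (gt_mem_nhds hlt)).and (eventually_ge_atTop 1)).exists
  obtain ⟨n, hn, hn1⟩ := h'
  refine ⟨n, hn1, ?_⟩
  have h3 : ‖B ^ n‖ ^ (1 / n : ℝ) < τ := (ENNReal.ofReal_lt_ofReal_iff (by linarith)).1 hn
  have h4 := pow_le_pow_left₀ (Real.rpow_nonneg (norm_nonneg _) _) h3.le n
  rwa [← Real.rpow_natCast (_ ^ (1 / n : ℝ)), ← Real.rpow_mul (norm_nonneg _),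
    one_div_mul_cancel (by positivity), Real.rpow_one] at h4

end Gelfand

lemma exists_pow_sum_le_of_spectralRadius_le_one {A : Matrix (Fin M) (Fin M) ℝ}
    (h : spectralRadius ℂ (A.map (fun a : ℝ => (a : ℂ))) ≤ 1) {τ : ℝ} (hτ : 1 < τ) :
    ∃ n : ℕ, 1 ≤ n ∧ ∀ i, ∑ j, (A ^ n) i j ≤ τ ^ n := by
  obtain ⟨n, hn1, hn⟩ := exists_pow_norm_le_of_spectralRadius_le_one h hτ
  refine ⟨n, hn1, fun i => ?_⟩
  have hmap : A.map (fun a : ℝ => (a : ℂ)) ^ n = (A ^ n).map (fun a : ℝ => (a : ℂ)) := by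
    have := (Matrix.map_pow A (Complex.ofRealHom) n)
    exact this.symm
  rw [hmap, Matrix.linfty_opNorm_def] at hn
  refine le_trans ?_ hn
  have h1 : (∑ j, ‖(A ^ n).map (fun a : ℝ => (a : ℂ)) i j‖₊) ≤
      Finset.univ.sup fun i => ∑ j, ‖(A ^ n).map (fun a : ℝ => (a : ℂ)) i j‖₊ :=
    Finset.le_sup (f := fun i => ∑ j, ‖(A ^ n).map (fun a : ℝ => (a : ℂ)) i j‖₊)
      (Finset.mem_univ i)
  refine le_trans ?_ (NNReal.coe_le_coe.2 h1)
  push_cast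
  refine Finset.sum_le_sum fun j _ => ?_
  simp only [Matrix.map_apply, Complex.norm_real]
  exact Real.le_norm_self _

/-- The spectral radius of a nonnegative matrix is at most `1` iff there are subinvariant vectors
at every level `τ > 1`. -/
lemma logSpectralRadius_le_zero_iff {A : Matrix (Fin M) (Fin M) ℝ} (hA : ∀ i j, 0 ≤ A i j) :
    logSpectralRadius A ≤ 0 ↔ ∀ τ > 1, ∃ u, SubInv A τ u := by
  have hlog : logSpectralRadius A ≤ 0 ↔
      spectralRadius ℂ (A.map (fun a : ℝ => (a : ℂ))) ≤ 1 := by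
    unfold logSpectralRadius
    rw [← ENNReal.log_one, ENNReal.log_le_log_iff]
  rw [hlog]
  constructor
  · intro h τ hτ
    obtain ⟨n, hn1, hn⟩ := exists_pow_sum_le_of_spectralRadius_le_one h hτ
    have hτ0 : 0 < τ := by linarith
    have hnn : ∀ k i j, 0 ≤ (A ^ k) i j := fun k => Matrix.pow_apply_nonneg hA k
    -- the truncated resolvent `∑_{k < n} τ⁻ᵏ Aᵏ 1`
    let s : ℕ → Fin M → ℝ := fun k i => τ⁻¹ ^ k * ∑ j, (A ^ k) i j
    have hs0 : ∀ k i, 0 ≤ s k i := fun k i =>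
      mul_nonneg (by positivity) (Finset.sum_nonneg fun j _ => hnn k i j)
    have hsz : ∀ i, s 0 i = 1 := fun i => by simp [s, Matrix.one_apply]
    have hsn : ∀ i, s n i ≤ 1 := fun i => by
      have h1 : s n i ≤ τ⁻¹ ^ n * τ ^ n := mul_le_mul_of_nonneg_left (hn i) (by positivity)
      rwa [← mul_pow, inv_mul_cancel₀ hτ0.ne', one_pow] at h1
    have hstep : ∀ k i, ∑ j, A i j * s k j = τ * s (k + 1) i := fun k i => by
      have h1 : ∑ j, (A ^ (k + 1)) i j = ∑ l, A i l * ∑ j, (A ^ k) l j := by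
        simp only [pow_succ', Matrix.mul_apply, Finset.mul_sum]
        exact Finset.sum_comm
      change ∑ l, A i l * (τ⁻¹ ^ k * ∑ j, (A ^ k) l j) = τ * (τ⁻¹ ^ (k + 1) * _)
      rw [h1, pow_succ, Finset.mul_sum, Finset.mul_sum]
      refine Finset.sum_congr rfl fun l _ => ?_
      field_simp
    refine ⟨fun i => ∑ k ∈ Finset.range n, s k i, fun i => ?_, fun i => ?_⟩
    · have h1 : s 0 i ≤ ∑ k ∈ Finset.range n, s k i :=
        Finset.single_le_sum (f := fun k => s k i) (fun k _ => hs0 k i) (Finset.mem_range.2 hn1)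
      rw [hsz] at h1
      linarith
    · have h1 : ∑ j, A i j * ∑ k ∈ Finset.range n, s k j =
          τ * ∑ k ∈ Finset.range n, s (k + 1) i := by
        simp only [Finset.mul_sum]
        rw [Finset.sum_comm]
        refine Finset.sum_congr rfl fun k _ => ?_
        rw [← hstep k i]
      rw [h1]
      refine mul_le_mul_of_nonneg_left ?_ hτ0.le
      have h2 := Finset.sum_range_succ (fun k => s k i) n
      rw [Finset.sum_range_succ' (fun k => s k i) n, hsz] at h2
      linarith [hsn i]
  · intro h
    have : ∀ τ : ℝ, 1 < τ → spectralRadius ℂ (A.map (fun a : ℝ => (a : ℂ))) ≤ ENNReal.ofReal τ := by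
      intro τ hτ
      obtain ⟨u, hu⟩ := h τ hτ
      refine iSup₂_le fun k hk => ?_
      rw [← ENNReal.ofReal_coe_nnreal, coe_nnnorm]
      exact ENNReal.ofReal_le_ofReal (norm_le_of_mem_spectrum hA hu hk)
    have hlim : Tendsto (fun τ : ℝ => ENNReal.ofReal τ) (𝓝[>] 1) (𝓝 1) := by
      have := (ENNReal.continuous_ofReal.tendsto (1 : ℝ)).mono_left
        (nhdsWithin_le_nhds (s := Set.Ioi (1 : ℝ)))
      simpa using this
    exact ge_of_tendsto hlim (eventually_nhdsWithin_of_forall this)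

end SpectralRadius

/-! ### The exponent of a nonnegative matrix -/

section Exponent

variable {M : ℕ} {f : Fin M → ℝ}

lemma tilted_entry (A : Matrix (Fin M) (Fin M) ℝ) (f : Fin M → ℝ) (θ : ℝ) (i j : Fin M) :
    tilted A f θ i j = A i j * Real.exp (θ * f j) := by
  simp [tilted]

lemma tilted_nonneg {A : Matrix (Fin M) (Fin M) ℝ} (hA : ∀ i j, 0 ≤ A i j) (θ : ℝ) (i j : Fin M) :
    0 ≤ tilted A f θ i j := by
  rw [tilted_entry]
  exact mul_nonneg (hA i j) (Real.exp_pos _).le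

lemma reach_tilted_iff {A : Matrix (Fin M) (Fin M) ℝ} (θ : ℝ) :
    Reach (tilted A f θ) = Reach A := by
  unfold Reach
  congr 1
  ext i j
  rw [tilted_entry]
  exact mul_pos_iff_of_pos_right (Real.exp_pos _)

/-- The spectral radius of `A D_θ` is at most `1`, expressed through subinvariant vectors. -/
def Admissible (f : Fin M → ℝ) (A : Matrix (Fin M) (Fin M) ℝ) (θ : ℝ) : Prop :=
  ∀ τ > 1, ∃ u, SubInv (tilted A f θ) τ u

/-- The supremum of the `θ` at which `A D_θ` has spectral radius at most `1`. -/
noncomputable def exponent (f : Fin M → ℝ) (A : Matrix (Fin M) (Fin M) ℝ) : ℝ≥0∞ :=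
  supInENNReal {θ : ℝ | logSpectralRadius (tilted A f θ) ≤ 0}

lemma Admissible.of_subInv {A : Matrix (Fin M) (Fin M) ℝ} {θ : ℝ} {u : Fin M → ℝ}
    (hu : SubInv (tilted A f θ) 1 u) : Admissible f A θ := fun _ hτ => ⟨u, hu.mono hτ.le⟩

lemma Admissible.le_exponent {A : Matrix (Fin M) (Fin M) ℝ} (hA : ∀ i j, 0 ≤ A i j) {θ : ℝ}
    (h : Admissible f A θ) : ENNReal.ofReal θ ≤ exponent f A :=
  le_iSup₂ (f := fun θ (_ : θ ∈ {θ : ℝ | logSpectralRadius (tilted A f θ) ≤ 0}) =>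
    ENNReal.ofReal θ) θ ((logSpectralRadius_le_zero_iff (tilted_nonneg hA θ)).2 h)

/-- Bernoulli's inequality `y ^ r ≤ 1 + r (y - 1)`, with its equality case. -/
lemma rpow_le_bernoulli {y r : ℝ} (hy : 0 < y) (hr0 : 0 < r) (hr1 : r < 1) :
    y ^ r ≤ 1 + r * (y - 1) ∧ (y ≠ 1 → y ^ r < 1 + r * (y - 1)) := by
  have h : y ≠ 1 → y ^ r < 1 + r * (y - 1) := fun hne => by
    have := rpow_one_add_lt_one_add_mul_self (s := y - 1) (by linarith) (sub_ne_zero.2 hne) hr0 hr1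
    simpa using this
  refine ⟨?_, h⟩
  rcases eq_or_ne y 1 with rfl | hne
  · simp
  · exact (h hne).le

/-- Subinvariant vectors interpolate between `θ = 0`, where the constant vector is subinvariant,
and `θ'`. The inequality becomes strict in every row `i` with an
edge to some `j` such that `exp (θ' f j) u j ≠ u i`. -/
lemma SubInv.interpolate {A : Matrix (Fin M) (Fin M) ℝ} (hA : ∀ i j, 0 ≤ A i j)
    (hrow : ∀ i, ∑ j, A i j ≤ 1) {θ θ' τ : ℝ} (hθ : 0 < θ) (hθ' : θ < θ') (hτ : 1 ≤ τ)
    {u : Fin M → ℝ} (hu : SubInv (tilted A f θ') τ u) :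
    SubInv (tilted A f θ) τ (fun i => u i ^ (θ / θ')) ∧
      ∀ i j, 0 < A i j → Real.exp (θ' * f j) * u j ≠ u i →
        ∑ k, tilted A f θ i k * u k ^ (θ / θ') < τ * u i ^ (θ / θ') := by
  have hθ'0 : 0 < θ' := hθ.trans hθ'
  set r := θ / θ' with hr
  have hr0 : 0 < r := div_pos hθ hθ'0
  have hr1 : r < 1 := (div_lt_one hθ'0).2 hθ'
  let y : Fin M → Fin M → ℝ := fun i j => Real.exp (θ' * f j) * u j / u i
  have hy : ∀ i j, 0 < y i j := fun i j =>
    div_pos (mul_pos (Real.exp_pos _) (hu.pos j)) (hu.pos i)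
  have hterm : ∀ i j, tilted A f θ i j * u j ^ r = u i ^ r * (A i j * y i j ^ r) := by
    intro i j
    have h1 : y i j ^ r * u i ^ r = Real.exp (θ * f j) * u j ^ r := by
      rw [← Real.mul_rpow (hy i j).le (hu.pos i).le, div_mul_cancel₀ _ (hu.pos i).ne',
        Real.mul_rpow (Real.exp_pos _).le (hu.pos j).le, ← Real.exp_mul]
      congr 2
      rw [hr]
      field_simp
    rw [tilted_entry, mul_assoc, ← h1]
    ring
  have hsum : ∀ i, ∑ j, A i j * (1 + r * (y i j - 1)) ≤ τ := by
    intro i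
    have h1 : ∑ j, A i j * y i j ≤ τ := by
      have h2 : ∑ j, A i j * y i j = (∑ j, tilted A f θ' i j * u j) / u i := by
        rw [Finset.sum_div]
        refine Finset.sum_congr rfl fun j _ => ?_
        rw [tilted_entry]
        simp only [y]
        ring
      rw [h2, div_le_iff₀ (hu.pos i)]
      exact hu.le i
    have h3 : ∑ j, A i j * (1 + r * (y i j - 1)) =
        (1 - r) * ∑ j, A i j + r * ∑ j, A i j * y i j := by
      rw [Finset.mul_sum, Finset.mul_sum, ← Finset.sum_add_distrib]
      exact Finset.sum_congr rfl fun j _ => by ring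
    rw [h3]
    nlinarith [hrow i]
  refine ⟨⟨fun i => Real.rpow_pos_of_pos (hu.pos i) _, fun i => ?_⟩, fun i j hij hne => ?_⟩
  · simp only [hterm, ← Finset.mul_sum]
    rw [mul_comm τ]
    refine mul_le_mul_of_nonneg_left ?_ (Real.rpow_pos_of_pos (hu.pos i) _).le
    exact (Finset.sum_le_sum fun j _ => mul_le_mul_of_nonneg_left
      (rpow_le_bernoulli (hy i j) hr0 hr1).1 (hA i j)).trans (hsum i)
  · simp only [hterm, ← Finset.mul_sum]
    rw [mul_comm τ]
    refine mul_lt_mul_of_pos_left ?_ (Real.rpow_pos_of_pos (hu.pos i) _)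
    refine lt_of_lt_of_le (Finset.sum_lt_sum (fun j _ => mul_le_mul_of_nonneg_left
      (rpow_le_bernoulli (hy i j) hr0 hr1).1 (hA i j)) ⟨j, Finset.mem_univ _, ?_⟩) (hsum i)
    refine mul_lt_mul_of_pos_left ((rpow_le_bernoulli (hy i j) hr0 hr1).2 fun h => hne ?_) hij
    exact (div_eq_one_iff_eq (hu.pos i).ne').1 h

/-- The admissible `θ ≥ 0` form an interval that contains `0`. -/
lemma Admissible.mono {A : Matrix (Fin M) (Fin M) ℝ} (hA : ∀ i j, 0 ≤ A i j)
    (hrow : ∀ i, ∑ j, A i j ≤ 1) {θ θ' : ℝ} (hθ : 0 ≤ θ) (hθ' : θ ≤ θ') (h : Admissible f A θ') :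
    Admissible f A θ := by
  rcases hθ'.eq_or_lt with rfl | hlt
  · exact h
  rcases hθ.eq_or_lt with rfl | h0
  · refine Admissible.of_subInv (u := fun _ => 1) ⟨fun _ => one_pos, fun i => ?_⟩
    simpa [tilted_entry] using hrow i
  · intro τ hτ
    obtain ⟨u, hu⟩ := h τ hτ
    exact ⟨_, (hu.interpolate hA hrow h0 hlt (le_of_lt hτ)).1⟩

lemma Admissible.of_lt_exponent {A : Matrix (Fin M) (Fin M) ℝ} (hA : ∀ i j, 0 ≤ A i j)
    (hrow : ∀ i, ∑ j, A i j ≤ 1) {θ : ℝ} (hθ : 0 ≤ θ) (h : ENNReal.ofReal θ < exponent f A) :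
    Admissible f A θ := by
  obtain ⟨θ', hθ'⟩ := lt_iSup_iff.1 h
  obtain ⟨hmem, hlt⟩ := lt_iSup_iff.1 hθ'
  have hle : θ < θ' := by
    by_contra hcon
    exact (ENNReal.ofReal_le_ofReal (not_lt.1 hcon)).not_gt hlt
  exact Admissible.mono hA hrow hθ hle.le
    ((logSpectralRadius_le_zero_iff (tilted_nonneg hA θ')).1 hmem)

end Exponent

/-! ### Flows on the edges of a chain -/

section Flow

variable {ι : Type*} [Fintype ι]

/-- The matrix `F` with its nonzero rows normalised to sum `1`. -/
noncomputable def rowNorm (F : Matrix ι ι ℝ) : Matrix ι ι ℝ :=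
  Matrix.of fun i j => F i j / ∑ k, F i k

lemma rowNorm_apply (F : Matrix ι ι ℝ) (i j : ι) : rowNorm F i j = F i j / ∑ k, F i k := rfl

lemma rowNorm_nonneg {F : Matrix ι ι ℝ} (hF : ∀ i j, 0 ≤ F i j) (i j : ι) : 0 ≤ rowNorm F i j :=
  div_nonneg (hF i j) (Finset.sum_nonneg fun k _ => hF i k)

lemma sum_rowNorm_le_one {F : Matrix ι ι ℝ} (i : ι) : ∑ j, rowNorm F i j ≤ 1 := by
  simp only [rowNorm_apply, ← Finset.sum_div]
  exact div_self_le_one _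

lemma le_row_sum {F : Matrix ι ι ℝ} (hF : ∀ i j, 0 ≤ F i j) (i j : ι) : F i j ≤ ∑ k, F i k :=
  Finset.single_le_sum (f := fun k => F i k) (fun k _ => hF i k) (Finset.mem_univ j)

lemma rowNorm_mul_sum {F : Matrix ι ι ℝ} (hF : ∀ i j, 0 ≤ F i j) (i j : ι) :
    rowNorm F i j * ∑ k, F i k = F i j := by
  rw [rowNorm_apply]
  by_cases h : ∑ k, F i k = 0
  · have := le_row_sum hF i j
    rw [h] at this ⊢
    simp [le_antisymm this (hF i j)]
  · exact div_mul_cancel₀ _ h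

lemma rowNorm_pos_iff {F : Matrix ι ι ℝ} (hF : ∀ i j, 0 ≤ F i j) (i j : ι) :
    0 < rowNorm F i j ↔ 0 < F i j := by
  constructor
  · intro h
    refine (hF i j).lt_of_ne fun h0 => ?_
    rw [rowNorm_apply, ← h0, zero_div] at h
    exact h.false
  · exact fun h => div_pos h (h.trans_le (le_row_sum hF i j))

lemma reach_rowNorm {F : Matrix ι ι ℝ} (hF : ∀ i j, 0 ≤ F i j) : Reach (rowNorm F) = Reach F := by
  unfold Reach
  congr 1
  ext i j
  exact rowNorm_pos_iff hF i j

lemma rowNorm_smul {F : Matrix ι ι ℝ} {c : ℝ} (hc : c ≠ 0) : rowNorm (c • F) = rowNorm F := by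
  ext i j
  simp only [rowNorm_apply, Matrix.smul_apply, smul_eq_mul, ← Finset.mul_sum]
  exact mul_div_mul_left _ _ hc

/-- A flow along the edges of `Q`: a probability on the pairs `(i, j)` with `Q i j > 0` whose two
marginals agree. -/
structure IsFlow (Q F : Matrix ι ι ℝ) : Prop where
  nonneg : ∀ i j, 0 ≤ F i j
  supp : ∀ i j, 0 < F i j → 0 < Q i j
  total : ∑ i, ∑ j, F i j = 1
  balanced : ∀ i, ∑ j, F i j = ∑ j, F j i

lemma sum_balanced {F : Matrix ι ι ℝ} (hF : ∀ i, ∑ j, F i j = ∑ j, F j i) (h : ι → ℝ) :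
    ∑ i, ∑ j, F i j * (h i - h j) = 0 := by
  simp only [mul_sub, Finset.sum_sub_distrib]
  rw [sub_eq_zero, Finset.sum_comm (f := fun i j => F i j * h j)]
  simp only [← Finset.sum_mul, hF]

/-- Recurrence: every edge that carries a balanced flow lies on a cycle of such edges. -/
lemma reach_of_balanced {F : Matrix ι ι ℝ} (hF0 : ∀ i j, 0 ≤ F i j)
    (hF : ∀ i, ∑ j, F i j = ∑ j, F j i) {i j : ι} (hij : 0 < F i j) : Reach F j i := by
  classical
  by_contra hcon
  let h : ι → ℝ := fun k => if Reach F j k then 1 else 0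
  have hle : ∀ k l, F k l * (h k - h l) ≤ 0 := by
    intro k l
    rcases (hF0 k l).eq_or_lt with h0 | h0
    · simp [← h0]
    · refine mul_nonpos_of_nonneg_of_nonpos h0.le ?_
      by_cases hk : Reach F j k
      · have hl : Reach F j l := hk.tail h0
        simp [h, hk, hl]
      · simp only [h, hk, if_false]
        split_ifs <;> norm_num
  have hlt : ∑ k, ∑ l, F k l * (h k - h l) < ∑ k : ι, ∑ l : ι, (0 : ℝ) := by
    refine Finset.sum_lt_sum (fun k _ => Finset.sum_le_sum fun l _ => hle k l)
      ⟨i, Finset.mem_univ _, Finset.sum_lt_sum (fun l _ => hle i l) ⟨j, Finset.mem_univ _, ?_⟩⟩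
    have hj : Reach F j j := Relation.ReflTransGen.refl
    simp [h, hcon, hj, hij]
  rw [sum_balanced hF] at hlt
  simp at hlt

lemma IsFlow.mix {Q F G : Matrix ι ι ℝ} (hF : IsFlow Q F) (hG : IsFlow Q G) {s : ℝ} (h0 : 0 ≤ s)
    (h1 : s ≤ 1) : IsFlow Q ((1 - s) • F + s • G) where
  nonneg i j := by
    have := hF.nonneg i j
    have := hG.nonneg i j
    simp only [Matrix.add_apply, Matrix.smul_apply, smul_eq_mul]
    have : 0 ≤ 1 - s := by linarith
    positivity
  supp i j h := by
    simp only [Matrix.add_apply, Matrix.smul_apply, smul_eq_mul] at h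
    rcases (hF.nonneg i j).eq_or_lt with hf | hf
    · rcases (hG.nonneg i j).eq_or_lt with hg | hg
      · simp [← hf, ← hg] at h
      · exact hG.supp i j hg
    · exact hF.supp i j hf
  total := by
    simp only [Matrix.add_apply, Matrix.smul_apply, smul_eq_mul, Finset.sum_add_distrib,
      ← Finset.mul_sum, hF.total, hG.total]
    ring
  balanced i := by
    simp only [Matrix.add_apply, Matrix.smul_apply, smul_eq_mul, Finset.sum_add_distrib,
      ← Finset.mul_sum, hF.balanced i, hG.balanced i]

/-- The flow of the stationary chain with transition matrix `A` and stationary law `p`. -/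
def chainFlow (p : ι → ℝ) (A : Matrix ι ι ℝ) : Matrix ι ι ℝ := Matrix.of fun i j => p i * A i j

lemma chainFlow_apply {κ : Type*} (p : κ → ℝ) (A : Matrix κ κ ℝ) (i j : κ) :
    chainFlow p A i j = p i * A i j := rfl

lemma sum_chainFlow {p : ι → ℝ} {A : Matrix ι ι ℝ} (hrow : ∀ i, ∑ j, A i j = 1) (i : ι) :
    ∑ j, chainFlow p A i j = p i := by
  simp only [chainFlow_apply, ← Finset.mul_sum, hrow, mul_one]

lemma isFlow_chainFlow {Q A : Matrix ι ι ℝ} (hA : ∀ i j, 0 ≤ A i j)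
    (hrow : ∀ i, ∑ j, A i j = 1) (hsupp : ∀ i j, 0 < A i j → 0 < Q i j) {p : ι → ℝ}
    (hp : ∀ i, 0 ≤ p i) (hp1 : ∑ i, p i = 1) (hstat : ∀ j, ∑ i, p i * A i j = p j) :
    IsFlow Q (chainFlow p A) where
  nonneg i j := mul_nonneg (hp i) (hA i j)
  supp i j h := hsupp i j (pos_of_mul_pos_right h (hp i))
  total := by simp only [sum_chainFlow hrow, hp1]
  balanced i := by
    rw [sum_chainFlow hrow]
    exact (hstat i).symm

/-- Every stochastic matrix has a stationary law. -/
lemma exists_stationary [DecidableEq ι] [Nonempty ι] {A : Matrix ι ι ℝ} (hA : ∀ i j, 0 ≤ A i j)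
    (hrow : ∀ i, ∑ j, A i j = 1) :
    ∃ p : ι → ℝ, (∀ i, 0 ≤ p i) ∧ ∑ i, p i = 1 ∧ ∀ j, ∑ i, p i * A i j = p j := by
  have hdet : (A - 1).det = 0 := by
    refine Matrix.exists_mulVec_eq_zero_iff.1 ⟨fun _ => 1, ?_, ?_⟩
    · exact fun h => one_ne_zero (congrFun h (Classical.arbitrary ι))
    · ext i
      simp [hrow i, Matrix.mulVec, dotProduct, Matrix.one_apply]
  obtain ⟨v, hv0, hv⟩ := Matrix.exists_vecMul_eq_zero_iff.2 hdet
  have hv' : ∀ j, ∑ i, v i * A i j = v j := fun j => by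
    have := congrFun hv j
    rw [Matrix.vecMul_sub, Matrix.vecMul_one] at this
    simpa [Matrix.vecMul, dotProduct, sub_eq_zero] using this
  -- `|v|` is again stationary, because it has the same total mass as `|v| A ≥ |v|`.
  have hle : ∀ j ∈ Finset.univ, |v j| ≤ ∑ i, |v i| * A i j := fun j _ => by
    rw [← hv' j]
    refine (Finset.abs_sum_le_sum_abs _ _).trans (Finset.sum_le_sum fun i _ => ?_)
    rw [abs_mul, abs_of_nonneg (hA i j)]
  have hsum : ∑ j, |v j| = ∑ j, ∑ i, |v i| * A i j := by
    rw [Finset.sum_comm]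
    simp only [← Finset.mul_sum, hrow, mul_one]
  have heq := (Finset.sum_eq_sum_iff_of_le hle).1 hsum
  obtain ⟨a, ha⟩ := Function.ne_iff.1 hv0
  have hpos : 0 < ∑ i, |v i| :=
    Finset.sum_pos' (fun i _ => abs_nonneg _) ⟨a, Finset.mem_univ _, abs_pos.2 ha⟩
  refine ⟨fun i => |v i| / ∑ k, |v k|, fun i => div_nonneg (abs_nonneg _) hpos.le, ?_, fun j => ?_⟩
  · rw [← Finset.sum_div, div_self hpos.ne']
  · have : ∑ i, |v i| / (∑ k, |v k|) * A i j = (∑ i, |v i| * A i j) / ∑ k, |v k| := by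
      rw [Finset.sum_div]
      exact Finset.sum_congr rfl fun i _ => by ring
    rw [this, ← heq j (Finset.mem_univ j)]

lemma stationary_eq_zero_of_reach {A : Matrix ι ι ℝ} (hA : ∀ i j, 0 ≤ A i j) {p : ι → ℝ}
    (hp : ∀ i, 0 ≤ p i) (hstat : ∀ j, ∑ i, p i * A i j = p j) {k i : ι} (h : Reach A k i)
    (hi : p i = 0) : p k = 0 := by
  induction h using Relation.ReflTransGen.head_induction_on with
  | refl => exact hi
  | @head a c hac _ ih =>
    have h1 := hstat c
    rw [ih, Finset.sum_eq_zero_iff_of_nonneg fun i _ => mul_nonneg (hp i) (hA i c)] at h1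
    exact (mul_eq_zero.1 (h1 a (Finset.mem_univ a))).resolve_right hac.ne'

lemma stationary_pos {A : Matrix ι ι ℝ} (hA : ∀ i j, 0 ≤ A i j) {p : ι → ℝ}
    (hp : ∀ i, 0 ≤ p i) (hp1 : ∑ i, p i = 1) (hstat : ∀ j, ∑ i, p i * A i j = p j) {i : ι}
    (hreach : ∀ k, Reach A k i) : 0 < p i := by
  refine (hp i).lt_of_ne fun h => ?_
  have : ∑ k, p k = 0 := Finset.sum_eq_zero fun k _ =>
    stationary_eq_zero_of_reach hA hp hstat (hreach k) h.symm
  rw [hp1] at this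
  exact one_ne_zero this

lemma stationary_unique {A : Matrix ι ι ℝ} (hA : ∀ i j, 0 ≤ A i j) (hirr : ∀ i j, Reach A i j)
    {p q : ι → ℝ} (hp1 : ∑ i, p i = 1)
    (hpstat : ∀ j, ∑ i, p i * A i j = p j) (hq : ∀ i, 0 ≤ q i) (hq1 : ∑ i, q i = 1)
    (hqstat : ∀ j, ∑ i, q i * A i j = q j) : p = q := by
  have hne : Nonempty ι := by
    by_contra h
    rw [not_nonempty_iff] at h
    simp at hp1
  have hqpos : ∀ i, 0 < q i := fun i => stationary_pos hA hq hq1 hqstat fun k => hirr k i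
  obtain ⟨i, hi⟩ := Finite.exists_min fun i => p i / q i
  set c := p i / q i with hc
  have hz : ∀ k, p k - c * q k = 0 := by
    intro k
    refine stationary_eq_zero_of_reach (p := fun k => p k - c * q k) hA (fun k => ?_) (fun j => ?_)
      (hirr k i) ?_
    · have := (le_div_iff₀ (hqpos k)).1 (hi k)
      linarith
    · simp only [sub_mul, Finset.sum_sub_distrib, mul_assoc, ← Finset.mul_sum, hpstat, hqstat]
    · simp only [hc]
      rw [div_mul_cancel₀ _ (hqpos i).ne', sub_self]
  have hc1 : c = 1 := by
    have : ∑ k, (p k - c * q k) = 0 := Finset.sum_eq_zero fun k _ => hz k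
    rw [Finset.sum_sub_distrib, ← Finset.mul_sum, hp1, hq1] at this
    linarith
  ext k
  have := hz k
  rw [hc1] at this
  linarith

end Flow

/-! ### The entropy of a flow -/

section Rate

variable {ι : Type*} [Fintype ι]

/-- The entropy of the flow `F` relative to the chain `Q`,
`∑ i, j, F i j log (F i j / (F i Q i j))` with `F i` the row sums of `F`. Terms with
`F i j = 0` vanish, and the edges of `F` are meant to be edges of `Q`. -/
noncomputable def flowEntropy (Q F : Matrix ι ι ℝ) : ℝ :=
  ∑ i, ∑ j, F i j * (Real.log (F i j) - Real.log (∑ k, F i k) - Real.log (Q i j))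

lemma continuous_flowEntropy (Q : Matrix ι ι ℝ) : Continuous (flowEntropy Q) := by
  have h : flowEntropy Q = fun F : Matrix ι ι ℝ =>
      ∑ i, ((∑ j, F i j * Real.log (F i j)) - (∑ j, F i j) * Real.log (∑ j, F i j) -
        ∑ j, F i j * Real.log (Q i j)) := by
    ext F
    refine Finset.sum_congr rfl fun i _ => ?_
    rw [Finset.sum_mul, ← Finset.sum_sub_distrib, ← Finset.sum_sub_distrib]
    exact Finset.sum_congr rfl fun j _ => by ring
  rw [h]
  have hij : ∀ i j, Continuous fun F : Matrix ι ι ℝ => F i j := fun i j =>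
    continuous_id.matrix_elem i j
  refine continuous_finsetSum _ fun i _ => ?_
  refine Continuous.sub (Continuous.sub ?_ ?_) ?_
  · exact continuous_finsetSum _ fun j _ => Real.continuous_mul_log.comp (hij i j)
  · exact Real.continuous_mul_log.comp (continuous_finsetSum _ fun j _ => hij i j)
  · exact continuous_finsetSum _ fun j _ => (hij i j).mul continuous_const

lemma flowEntropy_smul (Q : Matrix ι ι ℝ) {F : Matrix ι ι ℝ} (hF : ∀ i j, 0 ≤ F i j) {c : ℝ}
    (hc : 0 < c) : flowEntropy Q (c • F) = c * flowEntropy Q F := by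
  unfold flowEntropy
  simp only [Finset.mul_sum]
  refine Finset.sum_congr rfl fun i _ => Finset.sum_congr rfl fun j _ => ?_
  simp only [Matrix.smul_apply, smul_eq_mul, ← Finset.mul_sum]
  rcases (hF i j).eq_or_lt with h | h
  · simp [← h]
  · rw [Real.log_mul hc.ne' h.ne', Real.log_mul hc.ne' (h.trans_le (le_row_sum hF i j)).ne']
    ring

lemma gibbs_term {a s q : ℝ} (ha : 0 ≤ a) (has : a ≤ s) (hq : 0 ≤ q) (haq : 0 < a → 0 < q) :
    a * (Real.log q - (Real.log a - Real.log s)) ≤ s * q - a ∧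
      (a ≠ s * q → a * (Real.log q - (Real.log a - Real.log s)) < s * q - a) := by
  rcases ha.eq_or_lt with h | h
  · subst h
    have : 0 ≤ s * q := mul_nonneg has hq
    refine ⟨by simpa using this, fun hne => ?_⟩
    simpa using this.lt_of_ne hne
  · have hs : 0 < s := h.trans_le has
    have hq' := haq h
    have hlog : Real.log q - (Real.log a - Real.log s) = Real.log (s * q / a) := by
      rw [Real.log_div (by positivity) h.ne', Real.log_mul hs.ne' hq'.ne']
      ring
    have hval : s * q - a = a * (s * q / a - 1) := by
      field_simp
    rw [hlog, hval]
    have hpos : 0 < s * q / a := by positivity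
    refine ⟨mul_le_mul_of_nonneg_left (Real.log_le_sub_one_of_pos hpos) h.le, fun hne => ?_⟩
    refine mul_lt_mul_of_pos_left (Real.log_lt_sub_one_of_pos hpos fun h1 => hne ?_) h
    exact ((div_eq_one_iff_eq h.ne').1 h1).symm

/-- **Gibbs' inequality**, with its equality case. -/
lemma gibbs (Q : Matrix ι ι ℝ) {F A : Matrix ι ι ℝ} (hF : ∀ i j, 0 ≤ F i j)
    (hA : ∀ i j, 0 ≤ A i j) (hrow : ∀ i, ∑ j, A i j ≤ 1) (hsupp : ∀ i j, 0 < F i j → 0 < A i j) :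
    ∑ i, ∑ j, F i j * (Real.log (A i j) - Real.log (Q i j)) ≤ flowEntropy Q F ∧
      (flowEntropy Q F ≤ ∑ i, ∑ j, F i j * (Real.log (A i j) - Real.log (Q i j)) →
        ∀ i j, F i j = (∑ k, F i k) * A i j) := by
  have hterm := fun i j => gibbs_term (hF i j) (le_row_sum hF i j) (hA i j) (hsupp i j)
  have hdiff : ∑ i, ∑ j, F i j * (Real.log (A i j) - Real.log (Q i j)) - flowEntropy Q F =
      ∑ i, ∑ j, F i j * (Real.log (A i j) - (Real.log (F i j) - Real.log (∑ k, F i k))) := by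
    unfold flowEntropy
    simp only [← Finset.sum_sub_distrib]
    exact Finset.sum_congr rfl fun i _ => Finset.sum_congr rfl fun j _ => by ring
  have hnonpos : ∑ i, ∑ j, ((∑ k, F i k) * A i j - F i j) ≤ 0 := by
    refine Finset.sum_nonpos fun i _ => ?_
    rw [Finset.sum_sub_distrib, ← Finset.mul_sum]
    have : 0 ≤ ∑ k, F i k := Finset.sum_nonneg fun k _ => hF i k
    nlinarith [hrow i]
  constructor
  · have := Finset.sum_le_sum fun i (_ : i ∈ Finset.univ) =>
      Finset.sum_le_sum fun j (_ : j ∈ Finset.univ) => (hterm i j).1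
    linarith
  · intro hle
    by_contra! hcon
    obtain ⟨i, j, hij⟩ := hcon
    have := Finset.sum_lt_sum (fun i (_ : i ∈ Finset.univ) =>
      Finset.sum_le_sum fun j (_ : j ∈ Finset.univ) => (hterm i j).1) ⟨i, Finset.mem_univ i,
        Finset.sum_lt_sum (fun j _ => (hterm i j).1) ⟨j, Finset.mem_univ j, (hterm i j).2 hij⟩⟩
    linarith

lemma flowEntropy_eq_rowNorm (Q : Matrix ι ι ℝ) {F : Matrix ι ι ℝ} (hF : ∀ i j, 0 ≤ F i j) :
    flowEntropy Q F =
      ∑ i, ∑ j, F i j * (Real.log (rowNorm F i j) - Real.log (Q i j)) := by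
  refine Finset.sum_congr rfl fun i _ => Finset.sum_congr rfl fun j _ => ?_
  rcases (hF i j).eq_or_lt with h | h
  · simp [← h]
  · rw [rowNorm_apply, Real.log_div h.ne' (h.trans_le (le_row_sum hF i j)).ne']

lemma flowEntropy_nonneg {Q F : Matrix ι ι ℝ} (hQ : ∀ i j, 0 ≤ Q i j) (hrow : ∀ i, ∑ j, Q i j = 1)
    (hF : ∀ i j, 0 ≤ F i j) (hsupp : ∀ i j, 0 < F i j → 0 < Q i j) : 0 ≤ flowEntropy Q F := by
  have := (gibbs Q hF hQ (fun i => (hrow i).le) hsupp).1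
  simpa using this

/-- Convexity of the entropy: it is a supremum of linear functionals, attained at the rows of the
mixture. -/
lemma flowEntropy_mix_le {Q F G : Matrix ι ι ℝ} (hF : IsFlow Q F) (hG : IsFlow Q G) {s : ℝ}
    (h0 : 0 < s) (h1 : s < 1) : flowEntropy Q ((1 - s) • F + s • G) ≤
      (1 - s) * flowEntropy Q F + s * flowEntropy Q G := by
  set H := (1 - s) • F + s • G with hH
  have hHapp : ∀ i j, H i j = (1 - s) * F i j + s * G i j := fun i j => by
    simp [hH]
  have hH0 : ∀ i j, 0 ≤ H i j := (hF.mix hG h0.le h1.le).nonneg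
  have h1' : 0 < 1 - s := by linarith
  have hF' := (gibbs Q hF.nonneg (rowNorm_nonneg hH0) sum_rowNorm_le_one fun i j h =>
    (rowNorm_pos_iff hH0 i j).2 (by
      rw [hHapp]
      have := hG.nonneg i j
      positivity)).1
  have hG' := (gibbs Q hG.nonneg (rowNorm_nonneg hH0) sum_rowNorm_le_one fun i j h =>
    (rowNorm_pos_iff hH0 i j).2 (by
      rw [hHapp]
      have := hF.nonneg i j
      positivity)).1
  rw [flowEntropy_eq_rowNorm Q hH0]
  have hlin : ∑ i, ∑ j, H i j * (Real.log (rowNorm H i j) - Real.log (Q i j)) =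
      (1 - s) * ∑ i, ∑ j, F i j * (Real.log (rowNorm H i j) - Real.log (Q i j)) +
        s * ∑ i, ∑ j, G i j * (Real.log (rowNorm H i j) - Real.log (Q i j)) := by
    simp only [Finset.mul_sum, ← Finset.sum_add_distrib]
    refine Finset.sum_congr rfl fun i _ => Finset.sum_congr rfl fun j _ => ?_
    rw [hHapp]
    ring
  rw [hlin]
  exact add_le_add (mul_le_mul_of_nonneg_left hF' h1'.le) (mul_le_mul_of_nonneg_left hG' h0.le)

lemma isCompact_setOf_edgeLaw (Q : Matrix ι ι ℝ) :
    IsCompact {F : Matrix ι ι ℝ | (∀ i j, 0 ≤ F i j) ∧ (∀ i j, 0 < F i j → 0 < Q i j) ∧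
      ∑ i, ∑ j, F i j = 1} := by
  have hij : ∀ i j, Continuous fun F : Matrix ι ι ℝ => F i j := fun i j =>
    continuous_id.matrix_elem i j
  have hK : IsCompact (Set.pi Set.univ fun _ : ι => Set.pi Set.univ fun _ : ι =>
      Set.Icc (0 : ℝ) 1) :=
    isCompact_univ_pi fun _ => isCompact_univ_pi fun _ => isCompact_Icc
  have heq : {F : Matrix ι ι ℝ | (∀ i j, 0 ≤ F i j) ∧ (∀ i j, 0 < F i j → 0 < Q i j) ∧
      ∑ i, ∑ j, F i j = 1} =
      (⋂ i, ⋂ j, {F | 0 ≤ F i j}) ∩ ((⋂ i, ⋂ j, ⋂ _ : ¬ 0 < Q i j, {F | F i j ≤ 0}) ∩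
        {F | ∑ i, ∑ j, F i j = 1}) := by
    ext F
    simp only [Set.mem_ofPred_eq, Set.mem_inter_iff, Set.mem_iInter]
    refine and_congr_right fun _ => and_congr_left fun _ => ?_
    exact ⟨fun h i j hn => not_lt.1 fun hlt => hn (h i j hlt),
      fun h i j hlt => by_contra fun hn => (h i j hn).not_gt hlt⟩
  have hclosed : IsClosed {F : Matrix ι ι ℝ | (∀ i j, 0 ≤ F i j) ∧
      (∀ i j, 0 < F i j → 0 < Q i j) ∧ ∑ i, ∑ j, F i j = 1} := by
    rw [heq]
    refine IsClosed.inter (isClosed_iInter fun i => isClosed_iInter fun j =>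
      isClosed_le continuous_const (hij i j)) (IsClosed.inter (isClosed_iInter fun i =>
      isClosed_iInter fun j => isClosed_iInter fun _ => isClosed_le (hij i j) continuous_const) ?_)
    exact isClosed_eq (continuous_finsetSum _ fun i _ => continuous_finsetSum _ fun j _ => hij i j)
      continuous_const
  refine hK.of_isClosed_subset hclosed fun F hF => ?_
  refine Set.mem_univ_pi.2 fun i => Set.mem_univ_pi.2 fun j => ⟨hF.1 i j, ?_⟩
  rw [← hF.2.2]
  exact (le_row_sum hF.1 i j).trans (Finset.single_le_sum (f := fun i => ∑ j, F i j)
    (fun i _ => Finset.sum_nonneg fun j _ => hF.1 i j) (Finset.mem_univ i))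

lemma isCompact_setOf_isFlow (Q : Matrix ι ι ℝ) : IsCompact {F : Matrix ι ι ℝ | IsFlow Q F} := by
  have heq : {F : Matrix ι ι ℝ | IsFlow Q F} =
      {F | (∀ i j, 0 ≤ F i j) ∧ (∀ i j, 0 < F i j → 0 < Q i j) ∧ ∑ i, ∑ j, F i j = 1} ∩
        ⋂ i, {F | ∑ j, F i j = ∑ j, F j i} := by
    ext F
    simp only [Set.mem_inter_iff, Set.mem_iInter, Set.mem_ofPred_eq]
    exact ⟨fun h => ⟨⟨h.nonneg, h.supp, h.total⟩, h.balanced⟩,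
      fun ⟨⟨h1, h2, h3⟩, h4⟩ => ⟨h1, h2, h3, h4⟩⟩
  rw [heq]
  exact (isCompact_setOf_edgeLaw Q).inter_right (isClosed_iInter fun i =>
    isClosed_eq (continuous_finsetSum _ fun j _ => continuous_id.matrix_elem i j)
      (continuous_finsetSum _ fun j _ => continuous_id.matrix_elem j i))

/-- Only the stationary flow of an irreducible chain has zero entropy, so flows of small entropy
are close to it. -/
lemma exists_flowEntropy_le_mem {Q : Matrix ι ι ℝ} (hQ : ∀ i j, 0 ≤ Q i j)
    (hrow : ∀ i, ∑ j, Q i j = 1) (hirr : ∀ i j, Reach Q i j) {p : ι → ℝ} (hp : ∀ i, 0 ≤ p i)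
    (hp1 : ∑ i, p i = 1) (hstat : ∀ j, ∑ i, p i * Q i j = p j) {U : Set (Matrix ι ι ℝ)}
    (hU : U ∈ 𝓝 (chainFlow p Q)) :
    ∃ c > 0, ∀ F, IsFlow Q F → flowEntropy Q F ≤ c → F ∈ U := by
  have hK : IsCompact ({F : Matrix ι ι ℝ | IsFlow Q F} ∩ (interior U)ᶜ) :=
    (isCompact_setOf_isFlow Q).inter_right isOpen_interior.isClosed_compl
  rcases Set.eq_empty_or_nonempty ({F : Matrix ι ι ℝ | IsFlow Q F} ∩ (interior U)ᶜ) with h | h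
  · refine ⟨1, one_pos, fun F hF _ => interior_subset ?_⟩
    by_contra hcon
    exact Set.eq_empty_iff_forall_notMem.1 h F ⟨hF, hcon⟩
  · obtain ⟨F₀, ⟨hF₀, hF₀U⟩, hmin⟩ := hK.exists_isMinOn h (continuous_flowEntropy Q).continuousOn
    have hF₀' : IsFlow Q F₀ := hF₀
    have hpos : 0 < flowEntropy Q F₀ := by
      by_contra hcon
      have heq := (gibbs Q hF₀'.nonneg hQ (fun i => (hrow i).le) hF₀'.supp).2
        (by simpa using not_lt.1 hcon)
      have : (fun i => ∑ k, F₀ i k) = p := by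
        refine stationary_unique hQ hirr hF₀'.total (fun j => ?_)
          hp hp1 hstat
        rw [hF₀'.balanced j]
        exact Finset.sum_congr rfl fun i _ => (heq i j).symm
      have hF₀eq : F₀ = chainFlow p Q := by
        ext i j
        rw [heq i j, chainFlow_apply, ← this]
      exact hF₀U (hF₀eq ▸ mem_interior_iff_mem_nhds.2 hU)
    refine ⟨flowEntropy Q F₀ / 2, by positivity, fun F hF hle => interior_subset ?_⟩
    by_contra hcon
    have := hmin (⟨hF, hcon⟩ : F ∈ {F : Matrix ι ι ℝ | IsFlow Q F} ∩ (interior U)ᶜ)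
    have h2 : flowEntropy Q F₀ ≤ flowEntropy Q F := this
    linarith

end Rate

/-! ### Perturbing a flow to a full one while keeping its exponent -/

section Upper

variable {M : ℕ}

/-- An irreducible chain `Q` with stationary law `φ` under which `f` has negative mean. -/
structure IsDriftChain (Q : Matrix (Fin M) (Fin M) ℝ) (f φ : Fin M → ℝ) : Prop where
  nonneg : ∀ i j, 0 ≤ Q i j
  row_sum : ∀ i, ∑ j, Q i j = 1
  reach : ∀ i j, Reach Q i j
  law_nonneg : ∀ i, 0 ≤ φ i
  law_sum : ∑ i, φ i = 1
  stationary : ∀ j, ∑ i, φ i * Q i j = φ j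
  drift : ∑ i, φ i * f i < 0

/-- A flow that charges every edge of `Q`. -/
structure IsFullFlow (Q F : Matrix (Fin M) (Fin M) ℝ) : Prop extends IsFlow Q F where
  full : ∀ i j, 0 < Q i j → 0 < F i j

variable {Q : Matrix (Fin M) (Fin M) ℝ} {f φ : Fin M → ℝ}

lemma IsDriftChain.isFullFlow (h : IsDriftChain Q f φ) : IsFullFlow Q (chainFlow φ Q) where
  toIsFlow := isFlow_chainFlow h.nonneg h.row_sum (fun _ _ h => h) h.law_nonneg h.law_sum
    h.stationary
  full i _ hij :=
    mul_pos (stationary_pos h.nonneg h.law_nonneg h.law_sum h.stationary fun k => h.reach k i) hij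

/-- The increments are not bounded below by the increments of a potential. -/
lemma IsDriftChain.not_potential (h : IsDriftChain Q f φ) (m : Fin M → ℝ) :
    ¬ ∀ i j, 0 < Q i j → m i ≤ f j + m j := by
  intro hm
  have h1 : ∑ i, ∑ j, chainFlow φ Q i j * (m i - m j) ≤ ∑ i, ∑ j, chainFlow φ Q i j * f j := by
    refine Finset.sum_le_sum fun i _ => Finset.sum_le_sum fun j _ => ?_
    rcases (h.isFullFlow.nonneg i j).eq_or_lt with h0 | h0
    · simp [← h0]
    · exact mul_le_mul_of_nonneg_left (by linarith [hm i j (h.isFullFlow.supp i j h0)]) h0.le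
  rw [sum_balanced h.isFullFlow.balanced, Finset.sum_comm] at h1
  simp only [← Finset.sum_mul, chainFlow_apply, h.stationary] at h1
  exact h1.not_gt h.drift

lemma sum_tilted_rowNorm (F : Matrix (Fin M) (Fin M) ℝ) (θ : ℝ) (u : Fin M → ℝ) (i : Fin M) :
    ∑ j, tilted (rowNorm F) f θ i j * u j =
      (∑ j, F i j * (Real.exp (θ * f j) * u j)) / ∑ k, F i k := by
  rw [Finset.sum_div]
  refine Finset.sum_congr rfl fun j _ => ?_
  rw [tilted_entry, rowNorm_apply]
  ring

lemma subInv_rowNorm {F : Matrix (Fin M) (Fin M) ℝ} (hF : ∀ i j, 0 ≤ F i j) {θ : ℝ}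
    {u : Fin M → ℝ} (hu : ∀ i, 0 < u i)
    (h : ∀ i, ∑ j, F i j * (Real.exp (θ * f j) * u j) ≤ (∑ j, F i j) * u i) :
    SubInv (tilted (rowNorm F) f θ) 1 u := by
  refine ⟨hu, fun i => ?_⟩
  rw [sum_tilted_rowNorm, one_mul]
  rcases (Finset.sum_nonneg fun k (_ : k ∈ Finset.univ) => hF i k).eq_or_lt with h0 | h0
  · rw [← h0, div_zero]
    exact (hu i).le
  · rw [div_le_iff₀ h0, mul_comm (u i)]
    exact h i

lemma IsFlow.row_pos {F : Matrix (Fin M) (Fin M) ℝ} (hF : IsFlow Q F) {i j : Fin M}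
    (h : 0 < F i j) : 0 < ∑ k, F i k ∧ 0 < ∑ k, F j k := by
  refine ⟨h.trans_le (le_row_sum hF.nonneg i j), ?_⟩
  rw [hF.balanced j]
  exact h.trans_le (Finset.single_le_sum (f := fun k => F k j) (fun k _ => hF.nonneg k j)
    (Finset.mem_univ i))

lemma IsFlow.eq_zero_of_row {F : Matrix (Fin M) (Fin M) ℝ} (hF : IsFlow Q F) {i : Fin M}
    (h : ¬ 0 < ∑ k, F i k) (j : Fin M) : F i j = 0 :=
  le_antisymm ((le_row_sum hF.nonneg i j).trans (not_lt.1 h)) (hF.nonneg i j)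

lemma IsFlow.exists_row_pos {F : Matrix (Fin M) (Fin M) ℝ} (hF : IsFlow Q F) :
    ∃ i, 0 < ∑ k, F i k := by
  by_contra! h
  have := Finset.sum_nonpos fun i (_ : i ∈ Finset.univ) => h i
  rw [hF.total] at this
  linarith

lemma tendsto_mix (F G : Matrix (Fin M) (Fin M) ℝ) :
    Tendsto (fun s : ℝ => (1 - s) • F + s • G) (𝓝[>] 0) (𝓝 F) := by
  have h : Continuous fun s : ℝ => (1 - s) • F + s • G := by fun_prop
  have := (h.tendsto 0).mono_left (nhdsWithin_le_nhds (s := Set.Ioi (0 : ℝ)))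
  simpa using this

lemma eventually_mix_entropy_lt (F G : Matrix (Fin M) (Fin M) ℝ) {η : ℝ} (hη : 0 < η) :
    ∀ᶠ s in 𝓝[>] (0 : ℝ), s ∈ Set.Ioo (0 : ℝ) 1 ∧
      flowEntropy Q ((1 - s) • F + s • G) < flowEntropy Q F + η := by
  refine Filter.Eventually.and (Ioo_mem_nhdsGT one_pos) ?_
  exact (((continuous_flowEntropy Q).tendsto F).comp (tendsto_mix F G)).eventually
    (gt_mem_nhds (by linarith))

/-- A function given on a nonempty set of states extends to all states in such a way that every
other state has an edge along which `f j + H j` is smaller than `H i`. -/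
lemma exists_extension (hQ : ∀ i j, Reach Q i j) {E : Set (Fin M)} (hE : E.Nonempty)
    (g : Fin M → ℝ) :
    ∃ H : Fin M → ℝ, (∀ i ∈ E, H i = g i) ∧ ∀ i ∉ E, ∃ j, 0 < Q i j ∧ f j + H j < H i := by
  classical
  let T : ℕ → Fin M → Prop := fun n =>
    Nat.rec (fun i => i ∈ E) (fun _ T i => ∃ j, 0 < Q i j ∧ T j) n
  obtain ⟨e, he⟩ := hE
  have hT : ∀ i, ∃ n, T n i := by
    intro i
    induction hQ i e using Relation.ReflTransGen.head_induction_on with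
    | refl => exact ⟨0, he⟩
    | head h _ ih =>
      obtain ⟨n, hn⟩ := ih
      exact ⟨n + 1, _, h, hn⟩
  have hmin : ∀ i, ∃ n, T n i ∧ ∀ m, T m i → n ≤ m := fun i => by
    obtain ⟨n, hn, hle⟩ := WellFounded.has_min Nat.lt_wfRel.wf {n | T n i} (hT i)
    exact ⟨n, hn, fun m hm => not_lt.1 (hle m hm)⟩
  choose d hdT hdmin using hmin
  have hd : ∀ i ∉ E, ∃ j, 0 < Q i j ∧ d j + 1 ≤ d i := by
    intro i hi
    have h1 := hdT i
    rcases hn : d i with _ | n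
    · rw [hn] at h1
      exact absurd h1 hi
    · rw [hn] at h1
      obtain ⟨j, hij, hj⟩ := h1
      exact ⟨j, hij, Nat.succ_le_succ (hdmin j n hj)⟩
  let K : ℝ := ∑ i, |f i| + 1
  let L : ℝ := ∑ i, |g i|
  have hf : ∀ i, f i ≤ K - 1 := fun i => by
    have := Finset.single_le_sum (f := fun i => |f i|) (fun i _ => abs_nonneg _)
      (Finset.mem_univ i)
    simp only [K]
    linarith [le_abs_self (f i)]
  have hg : ∀ i, g i ≤ L := fun i =>
    (le_abs_self (g i)).trans (Finset.single_le_sum (f := fun i => |g i|)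
      (fun i _ => abs_nonneg _) (Finset.mem_univ i))
  have hK : 0 < K := by positivity
  refine ⟨fun i => if i ∈ E then g i else L + K * d i, fun i hi => if_pos hi, fun i hi => ?_⟩
  obtain ⟨j, hij, hdj⟩ := hd i hi
  refine ⟨j, hij, ?_⟩
  have h1 : (d j : ℝ) + 1 ≤ d i := by exact_mod_cast hdj
  have h2 : K * ((d j : ℝ) + 1) ≤ K * d i := mul_le_mul_of_nonneg_left h1 hK.le
  have h3 : 0 ≤ K * (d j : ℝ) := by positivity
  simp only [if_neg hi]
  split_ifs
  · linarith [hf j, hg j]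
  · linarith [hf j]

/-- Because of the negative drift, the extension can moreover be chosen such that some state of
the given set has an edge along which it is strict. -/
lemma IsDriftChain.exists_extension_strict (h : IsDriftChain Q f φ) {E : Set (Fin M)}
    (hE : E.Nonempty) (g : Fin M → ℝ) :
    ∃ H : Fin M → ℝ, (∀ i ∈ E, H i = g i) ∧ (∀ i ∉ E, ∃ j, 0 < Q i j ∧ f j + H j < H i) ∧
      ∃ e ∈ E, ∃ j, 0 < Q e j ∧ f j + H j < H e := by
  classical
  let S : Set (Fin M → ℝ) :=
    {H | (∀ i ∈ E, H i = g i) ∧ ∀ i ∉ E, ∃ j, 0 < Q i j ∧ f j + H j < H i}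
  have hSne : S.Nonempty := exists_extension h.reach hE g
  by_contra! hcon
  -- Otherwise the pointwise infimum `m` of the extensions is a potential below the increments.
  have hstrict : ∀ H ∈ S, ∀ e ∈ E, ∀ j, 0 < Q e j → g e ≤ f j + H j := fun H hH e he j hj =>
    hH.1 e he ▸ hcon H hH.1 hH.2 e he j hj
  have hlower : ∀ H ∈ S, ∀ k ∉ E, ∀ v ≤ H k, (∃ j, 0 < Q k j ∧
      f j + Function.update H k v j < v) → Function.update H k v ∈ S := by
    intro H hH k hk v hv hj
    refine ⟨fun i hi => ?_, fun i hi => ?_⟩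
    · have : i ≠ k := fun h => hk (h ▸ hi)
      rw [Function.update_of_ne this, hH.1 i hi]
    · rcases eq_or_ne i k with rfl | hik
      · simpa using hj
      · obtain ⟨j, hij, hj'⟩ := hH.2 i hi
        refine ⟨j, hij, ?_⟩
        rw [Function.update_of_ne hik]
        refine lt_of_le_of_lt ?_ hj'
        rcases eq_or_ne j k with rfl | hjk
        · simpa using hv
        · rw [Function.update_of_ne hjk]
  have hbound : ∀ (c : ℝ) (k i : Fin M), 0 < Q k i → (∀ H ∈ S, c ≤ H k) →
      ∀ H ∈ S, c ≤ f i + H i := by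
    intro c k i hki hc H hH
    by_cases hk : k ∈ E
    · have h1 := hc H hH
      rw [hH.1 k hk] at h1
      exact h1.trans (hstrict H hH k hk i hki)
    · by_contra! hlt
      rcases eq_or_ne i k with rfl | hik
      · -- a loop with `f i < 0` would allow to lower `H i` below the bound `c`
        have hfi : f i < 0 := by linarith [hc H hH]
        have := hc _ (hlower H hH i hk (c - 1) (by linarith [hc H hH])
          ⟨i, hki, by simp; linarith⟩)
        simp at this
        linarith
      · obtain ⟨v, hv1, hv2⟩ := exists_between hlt
        have := hc _ (hlower H hH k hk v (by linarith [hc H hH])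
          ⟨i, hki, by rwa [Function.update_of_ne hik]⟩)
        simp only [Function.update_self] at this
        linarith
  have hbdd : ∀ i, ∃ c, ∀ H ∈ S, c ≤ H i := by
    obtain ⟨e, he⟩ := hE
    intro i
    induction h.reach e i with
    | refl => exact ⟨g e, fun H hH => (hH.1 e he).ge⟩
    | @tail b c _ hbc ih =>
      obtain ⟨a, ha⟩ := ih
      exact ⟨a - f c, fun H hH => by linarith [hbound a b c hbc ha H hH]⟩
  have hbdd' : ∀ i, BddBelow ((fun H : Fin M → ℝ => H i) '' S) := fun i => by
    obtain ⟨c, hc⟩ := hbdd i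
    exact ⟨c, by rintro _ ⟨H, hH, rfl⟩; exact hc H hH⟩
  refine h.not_potential (fun i => sInf ((fun H : Fin M → ℝ => H i) '' S)) fun k i hki => ?_
  have h1 := hbound _ k i hki fun H hH => csInf_le (hbdd' k) ⟨H, hH, rfl⟩
  have h2 : sInf ((fun H : Fin M → ℝ => H k) '' S) - f i ≤
      sInf ((fun H : Fin M → ℝ => H i) '' S) := by
    refine le_csInf (hSne.image _) ?_
    rintro _ ⟨H, hH, rfl⟩
    linarith [h1 H hH]
  linarith

/-- A strict inequality for a probability vector persists for a nearby one with full support. -/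
lemma exists_full_row {q p a : Fin M → ℝ} {b : ℝ} (hq : ∀ j, 0 ≤ q j) (hq1 : ∑ j, q j = 1)
    (hp : ∀ j, 0 ≤ p j) (hp1 : ∑ j, p j = 1) (hpq : ∀ j, 0 < p j → 0 < q j)
    (hlt : ∑ j, p j * a j < b) :
    ∃ r : Fin M → ℝ, (∀ j, 0 ≤ r j) ∧ ∑ j, r j = 1 ∧ (∀ j, 0 < r j ↔ 0 < q j) ∧
      ∑ j, r j * a j < b := by
  have hc : Continuous fun s : ℝ => ∑ j, ((1 - s) * p j + s * q j) * a j := by fun_prop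
  have ht := (hc.tendsto 0).mono_left (nhdsWithin_le_nhds (s := Set.Ioi (0 : ℝ)))
  have hev := ht.eventually_lt_const (u := b) (by simpa using hlt)
  obtain ⟨s, hs, hs0, hs1⟩ := (hev.and (Ioo_mem_nhdsGT one_pos)).exists
  have hs1' : 0 < 1 - s := by linarith
  refine ⟨fun j => (1 - s) * p j + s * q j, fun j => ?_, ?_, fun j => ⟨fun h => ?_, fun h => ?_⟩,
    hs⟩
  · have := hp j
    have := hq j
    positivity
  · rw [Finset.sum_add_distrib, ← Finset.mul_sum, ← Finset.mul_sum, hp1, hq1]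
    ring
  · by_contra hcon
    have h0 : q j = 0 := le_antisymm (not_lt.1 hcon) (hq j)
    have h1 : p j = 0 := le_antisymm (not_lt.1 fun h' => hcon (hpq j h')) (hp j)
    simp [h0, h1] at h
  · have := hp j
    positivity

lemma exists_full_row_of_edge (hQ : ∀ i j, 0 ≤ Q i j) (hrow : ∀ i, ∑ j, Q i j = 1) {i j : Fin M}
    (hij : 0 < Q i j) {a : Fin M → ℝ} {b : ℝ} (hlt : a j < b) :
    ∃ r : Fin M → ℝ, (∀ j, 0 ≤ r j) ∧ ∑ j, r j = 1 ∧ (∀ j, 0 < r j ↔ 0 < Q i j) ∧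
      ∑ j, r j * a j < b := by
  classical
  refine exists_full_row (p := Pi.single j 1) (hQ i) (hrow i) (fun k => ?_) (by simp)
    (fun k hk => ?_) (by simpa [Pi.single_apply] using hlt)
  · rw [Pi.single_apply]
    split_ifs <;> norm_num
  · rcases eq_or_ne k j with rfl | h
    · exact hij
    · simp [h] at hk

lemma sum_rowNorm_eq_one {F : Matrix (Fin M) (Fin M) ℝ} {i : Fin M}
    (hi : 0 < ∑ k, F i k) : ∑ j, rowNorm F i j = 1 := by
  simp only [rowNorm_apply, ← Finset.sum_div]
  exact div_self hi.ne'

lemma sum_rowNorm_mul (F : Matrix (Fin M) (Fin M) ℝ) (c : Fin M → ℝ) (i : Fin M) :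
    ∑ j, rowNorm F i j * c j = (∑ j, F i j * c j) / ∑ k, F i k := by
  rw [Finset.sum_div]
  exact Finset.sum_congr rfl fun j _ => by rw [rowNorm_apply]; ring

lemma mix_entry (F G : Matrix (Fin M) (Fin M) ℝ) (s : ℝ) (i j : Fin M) :
    ((1 - s) • F + s • G) i j = (1 - s) * F i j + s * G i j := by simp

lemma sum_mix_mul (F G : Matrix (Fin M) (Fin M) ℝ) (s : ℝ) (i : Fin M) (c : Fin M → ℝ) :
    ∑ j, ((1 - s) • F + s • G) i j * c j =
      (1 - s) * ∑ j, F i j * c j + s * ∑ j, G i j * c j := by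
  simp only [mix_entry, Finset.mul_sum, ← Finset.sum_add_distrib]
  exact Finset.sum_congr rfl fun j _ => by ring

lemma sum_mix (F G : Matrix (Fin M) (Fin M) ℝ) (s : ℝ) (i : Fin M) :
    ∑ j, ((1 - s) • F + s • G) i j = (1 - s) * ∑ j, F i j + s * ∑ j, G i j := by
  simpa using sum_mix_mul F G s i 1

/-- A flow with a vector that is strictly subinvariant on its support is approximated by full
flows with a subinvariant vector: the states off the support are sent towards it. -/
lemma IsDriftChain.exists_full_of_strict (h : IsDriftChain Q f φ) {ν : Matrix (Fin M) (Fin M) ℝ}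
    (hν : IsFlow Q ν) {θ : ℝ} (hθ : 0 < θ) {u : Fin M → ℝ} (hu : ∀ i, 0 < u i)
    (hstrict : ∀ i, 0 < ∑ k, ν i k →
      ∑ j, ν i j * (Real.exp (θ * f j) * u j) < (∑ k, ν i k) * u i) {η : ℝ} (hη : 0 < η) :
    ∃ F, IsFullFlow Q F ∧ flowEntropy Q F < flowEntropy Q ν + η ∧
      Admissible f (rowNorm F) θ := by
  classical
  obtain ⟨i₀, hi₀⟩ := hν.exists_row_pos
  have : Nonempty (Fin M) := ⟨i₀⟩
  obtain ⟨H, hHE, hHs⟩ := exists_extension (f := f) h.reach (E := {i | 0 < ∑ k, ν i k}) ⟨i₀, hi₀⟩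
    fun i => Real.log (u i) / θ
  set U : Fin M → ℝ := fun i => Real.exp (θ * H i) with hU
  set c : Fin M → ℝ := fun j => Real.exp (θ * f j) * U j with hc
  have hUu : ∀ i, 0 < ∑ k, ν i k → U i = u i := fun i hi => by
    rw [hU]
    simp only
    rw [hHE i hi, mul_div_cancel₀ _ hθ.ne', Real.exp_log (hu i)]
  have hνc : ∀ i, 0 < ∑ k, ν i k → ∑ j, ν i j * c j < (∑ k, ν i k) * U i := fun i hi => by
    rw [hUu i hi]
    refine lt_of_eq_of_lt (Finset.sum_congr rfl fun j _ => ?_) (hstrict i hi)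
    rcases (hν.nonneg i j).eq_or_lt with h0 | h0
    · simp [← h0]
    · rw [hc]
      simp only
      rw [hUu j (hν.row_pos h0).2]
  have hrows : ∀ i, ∃ r : Fin M → ℝ, (∀ j, 0 ≤ r j) ∧ ∑ j, r j = 1 ∧
      (∀ j, 0 < r j ↔ 0 < Q i j) ∧ ∑ j, r j * c j < U i := by
    intro i
    by_cases hi : 0 < ∑ k, ν i k
    · refine exists_full_row (p := rowNorm ν i) (h.nonneg i) (h.row_sum i)
        (rowNorm_nonneg hν.nonneg i) (sum_rowNorm_eq_one hi)
        (fun j hj => hν.supp i j ((rowNorm_pos_iff hν.nonneg i j).1 hj)) ?_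
      rw [sum_rowNorm_mul, div_lt_iff₀ hi, mul_comm (U i)]
      exact hνc i hi
    · obtain ⟨j, hij, hj⟩ := hHs i hi
      refine exists_full_row_of_edge h.nonneg h.row_sum hij ?_
      rw [hc]
      simp only [hU, ← Real.exp_add, ← mul_add]
      exact Real.exp_lt_exp.2 (mul_lt_mul_of_pos_left hj hθ)
  choose A' hA0 hA1 hAQ hAc using hrows
  obtain ⟨A, rfl⟩ : ∃ A : Matrix (Fin M) (Fin M) ℝ, A = A' := ⟨A', rfl⟩
  have hAreach : ∀ i j, Reach A i j := by
    have : Reach A = Reach Q := by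
      unfold Reach
      congr 1
      ext i j
      exact hAQ i j
    rw [this]
    exact h.reach
  obtain ⟨p, hp0, hp1, hps⟩ := exists_stationary (A := A) hA0 hA1
  have hp : ∀ i, 0 < p i := fun i =>
    stationary_pos (A := A) hA0 hp0 hp1 hps fun k => hAreach k i
  have hμ : IsFlow Q (chainFlow p A) :=
    isFlow_chainFlow (A := A) hA0 hA1 (fun i j => (hAQ i j).1) hp0 hp1 hps
  obtain ⟨s, ⟨hs0, hs1⟩, hs⟩ := (eventually_mix_entropy_lt (Q := Q) ν (chainFlow p A) hη).exists
  have hF := hν.mix hμ hs0.le hs1.le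
  have hs1' : 0 < 1 - s := by linarith
  refine ⟨_, ⟨hF, fun i j hij => ?_⟩, hs, Admissible.of_subInv
    (subInv_rowNorm hF.nonneg (u := U) (fun i => Real.exp_pos _) fun i => ?_)⟩
  · rw [mix_entry, chainFlow_apply]
    have := hν.nonneg i j
    have := hp i
    have := (hAQ i j).2 hij
    positivity
  · rw [sum_mix_mul, sum_mix, sum_chainFlow (A := A) hA1, add_mul, mul_assoc, mul_assoc]
    refine add_le_add (mul_le_mul_of_nonneg_left ?_ hs1'.le)
      (mul_le_mul_of_nonneg_left ?_ hs0.le)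
    · by_cases hi : 0 < ∑ k, ν i k
      · exact (hνc i hi).le
      · simp [hν.eq_zero_of_row hi]
    · simp only [chainFlow_apply, mul_assoc, ← Finset.mul_sum]
      exact mul_le_mul_of_nonneg_left (hAc i).le (hp i).le

/-- The same when the subinvariant vector is strict at one state that can be reached from every
other state of the support. -/
lemma IsDriftChain.exists_full_of_strict_at (h : IsDriftChain Q f φ)
    {ν : Matrix (Fin M) (Fin M) ℝ} (hν : IsFlow Q ν) {θ : ℝ} (hθ : 0 < θ) {u : Fin M → ℝ}
    (hu : SubInv (tilted (rowNorm ν) f θ) 1 u) {e : Fin M}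
    (he : ∑ j, tilted (rowNorm ν) f θ e j * u j < 1 * u e)
    (hreach : ∀ i, 0 < ∑ k, ν i k → Reach ν i e) {η : ℝ} (hη : 0 < η) :
    ∃ F, IsFullFlow Q F ∧ flowEntropy Q F < flowEntropy Q ν + η ∧
      Admissible f (rowNorm F) θ := by
  obtain ⟨v, hv, hvs⟩ := hu.exists_strict (tilted_nonneg (rowNorm_nonneg hν.nonneg) θ)
  refine h.exists_full_of_strict hν hθ hv.pos (fun i hi => ?_) hη
  have h1 := hvs i ⟨e, by rw [reach_tilted_iff, reach_rowNorm hν.nonneg]; exact hreach i hi, he⟩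
  rwa [sum_tilted_rowNorm, one_mul, div_lt_iff₀ hi, mul_comm (v i)] at h1

lemma balanced_restrict {ν : Matrix (Fin M) (Fin M) ℝ} (hν0 : ∀ i j, 0 ≤ ν i j)
    (hν : ∀ i, ∑ j, ν i j = ∑ j, ν j i) (B : Fin M → Prop) [DecidablePred B]
    (hB : ∀ i j, 0 < ν i j → (B i ↔ B j)) (i : Fin M) :
    ∑ j, (if B i then ν i j else 0) = ∑ j, if B j then ν j i else 0 := by
  have h1 : ∀ j, (if B j then ν j i else 0) = if B i then ν j i else 0 := by
    intro j
    rcases (hν0 j i).eq_or_lt with h0 | h0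
    · simp [← h0]
    · simp only [hB j i h0]
  simp only [h1]
  split_ifs
  · exact hν i
  · simp

/-- The restriction of a flow to a set of states that no edge of the flow enters or leaves,
normalised to total mass one. -/
lemma IsFlow.restrict {ν : Matrix (Fin M) (Fin M) ℝ} (hν : IsFlow Q ν) (B : Fin M → Prop)
    [DecidablePred B] (hB : ∀ i j, 0 < ν i j → (B i ↔ B j)) {a : ℝ} (ha : 0 < a)
    (hmass : ∑ i, (if B i then ∑ j, ν i j else 0) = a) :
    IsFlow Q (a⁻¹ • Matrix.of fun i j => if B i then ν i j else 0) where
  nonneg i j := by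
    have := hν.nonneg i j
    simp only [Matrix.smul_apply, Matrix.of_apply, smul_eq_mul]
    split_ifs <;> positivity
  supp i j hij := by
    simp only [Matrix.smul_apply, Matrix.of_apply, smul_eq_mul] at hij
    split_ifs at hij
    · exact hν.supp i j (pos_of_mul_pos_right hij (by positivity))
    · simp at hij
  total := by
    simp only [Matrix.smul_apply, Matrix.of_apply, smul_eq_mul, ← Finset.mul_sum]
    have : ∑ i, ∑ j, (if B i then ν i j else 0) = a := by
      rw [← hmass]
      refine Finset.sum_congr rfl fun i _ => ?_
      split_ifs <;> simp
    rw [this, inv_mul_cancel₀ ha.ne']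
  balanced i := by
    simp only [Matrix.smul_apply, Matrix.of_apply, smul_eq_mul, ← Finset.mul_sum]
    rw [balanced_restrict hν.nonneg hν.balanced B hB]

lemma flowEntropy_restrict_add (ν : Matrix (Fin M) (Fin M) ℝ) (B : Fin M → Prop)
    [DecidablePred B] :
    flowEntropy Q (Matrix.of fun i j => if B i then ν i j else 0) +
      flowEntropy Q (Matrix.of fun i j => if ¬ B i then ν i j else 0) = flowEntropy Q ν := by
  unfold flowEntropy
  rw [← Finset.sum_add_distrib]
  refine Finset.sum_congr rfl fun i _ => ?_
  by_cases hi : B i <;> simp [hi]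

lemma rowNorm_restrict_le {ν : Matrix (Fin M) (Fin M) ℝ} (hν : ∀ i j, 0 ≤ ν i j)
    (B : Fin M → Prop) [DecidablePred B] {a : ℝ} (ha : a ≠ 0) (i j : Fin M) :
    rowNorm (a • Matrix.of fun i j => if B i then ν i j else 0) i j ≤ rowNorm ν i j := by
  rw [rowNorm_smul ha, rowNorm_apply]
  by_cases hi : B i
  · simp [hi, rowNorm_apply]
  · simpa [hi] using rowNorm_nonneg hν i j

/-- The entropy is additive over the communicating classes of a flow, so that some class has, per
unit of mass, no more entropy than the whole flow. -/
lemma IsFlow.exists_connected {ν : Matrix (Fin M) (Fin M) ℝ} (hν : IsFlow Q ν) :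
    ∃ ν', IsFlow Q ν' ∧ flowEntropy Q ν' ≤ flowEntropy Q ν ∧
      (∀ i j, rowNorm ν' i j ≤ rowNorm ν i j) ∧
      ∀ i j, 0 < ∑ k, ν' i k → 0 < ∑ k, ν' j k → Reach ν' i j := by
  classical
  induction hn : (Finset.univ.filter fun i => 0 < ∑ k, ν i k).card using
    Nat.strong_induction_on generalizing ν with
  | _ n ih =>
    by_cases hcon : ∀ i j, 0 < ∑ k, ν i k → 0 < ∑ k, ν j k → Reach ν i j
    · exact ⟨ν, hν, le_rfl, fun _ _ => le_rfl, hcon⟩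
    push Not at hcon
    obtain ⟨e, e', he, he', hee'⟩ := hcon
    let B : Fin M → Prop := Reach ν e
    have hB : ∀ i j, 0 < ν i j → (B i ↔ B j) := fun i j hij =>
      ⟨fun hi => hi.tail hij, fun hj => hj.trans (reach_of_balanced hν.nonneg hν.balanced hij)⟩
    -- both parts of the flow are smaller, and one of them has no more entropy per unit of mass
    have hpart : ∀ (C : Fin M → Prop) [DecidablePred C] (x y : Fin M),
        (∀ i j, 0 < ν i j → (C i ↔ C j)) → C x → 0 < ∑ k, ν x k → ¬ C y → 0 < ∑ k, ν y k →
        ∃ a : ℝ, 0 < a ∧ ∑ i, (if C i then ∑ j, ν i j else 0) = a ∧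
        (flowEntropy Q (Matrix.of fun i j => if C i then ν i j else 0) ≤ a * flowEntropy Q ν →
        ∃ ν', IsFlow Q ν' ∧ flowEntropy Q ν' ≤ flowEntropy Q ν ∧
          (∀ i j, rowNorm ν' i j ≤ rowNorm ν i j) ∧
          ∀ i j, 0 < ∑ k, ν' i k → 0 < ∑ k, ν' j k → Reach ν' i j) := by
      intro C _ x y hC hx hxν hy hyν
      have ha : 0 < ∑ i, (if C i then ∑ j, ν i j else 0) := by
        refine Finset.sum_pos' (fun i _ => ?_) ⟨x, Finset.mem_univ _, by simpa [hx] using hxν⟩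
        split_ifs
        · exact Finset.sum_nonneg fun j _ => hν.nonneg i j
        · exact le_rfl
      refine ⟨_, ha, rfl, fun hle => ?_⟩
      have hflow := hν.restrict C hC ha rfl
      set a := ∑ i, (if C i then ∑ j, ν i j else 0) with hadef
      set μ : Matrix (Fin M) (Fin M) ℝ := Matrix.of fun i j => if C i then ν i j else 0 with hμ
      have hμ0 : ∀ i j, 0 ≤ μ i j := fun i j => by
        simp only [hμ, Matrix.of_apply]
        split_ifs
        · exact hν.nonneg i j
        · exact le_rfl
      have hrow : ∀ i, 0 < ∑ k, (a⁻¹ • μ) i k → C i ∧ 0 < ∑ k, ν i k := fun i hi => by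
        simp only [Matrix.smul_apply, smul_eq_mul, ← Finset.mul_sum] at hi
        have hi' := pos_of_mul_pos_right hi (by positivity)
        by_cases hCi : C i
        · exact ⟨hCi, by simpa [hμ, hCi] using hi'⟩
        · simp [hμ, hCi] at hi'
      have hlt : (Finset.univ.filter fun i => 0 < ∑ k, (a⁻¹ • μ) i k).card < n := by
        rw [← hn]
        refine Finset.card_lt_card ⟨fun i hi => ?_, fun hsub => ?_⟩
        · simp only [Finset.mem_filter, Finset.mem_univ, true_and] at hi ⊢
          exact (hrow i hi).2
        · have := hsub (Finset.mem_filter.2 ⟨Finset.mem_univ y, hyν⟩)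
          exact hy (hrow y (Finset.mem_filter.1 this).2).1
      obtain ⟨ν', h1, h2, h3, h4⟩ := ih _ hlt hflow rfl
      refine ⟨ν', h1, h2.trans ?_, fun i j => (h3 i j).trans
        (rowNorm_restrict_le hν.nonneg C (inv_ne_zero ha.ne') i j), h4⟩
      rw [flowEntropy_smul Q hμ0 (inv_pos.2 ha), inv_mul_le_iff₀ ha]
      exact hle
    obtain ⟨a, ha, hae, h1⟩ := hpart B e e' hB Relation.ReflTransGen.refl he hee' he'
    obtain ⟨b, hb, hbe, h2⟩ := hpart (fun i => ¬ B i) e' e (fun i j hij => not_congr (hB i j hij))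
      hee' he' (not_not.2 Relation.ReflTransGen.refl) he
    have hab : a + b = 1 := by
      rw [← hae, ← hbe, ← Finset.sum_add_distrib, ← hν.total]
      refine Finset.sum_congr rfl fun i _ => ?_
      by_cases hi : B i <;> simp [hi]
    have hadd := flowEntropy_restrict_add (Q := Q) ν B
    by_cases hle : flowEntropy Q (Matrix.of fun i j => if B i then ν i j else 0) ≤
        a * flowEntropy Q ν
    · exact h1 hle
    · refine h2 ?_
      have : b * flowEntropy Q ν = flowEntropy Q ν - a * flowEntropy Q ν := by
        rw [show b = 1 - a by linarith]
        ring
      linarith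

lemma Admissible.of_le {A B : Matrix (Fin M) (Fin M) ℝ} (hAB : ∀ i j, A i j ≤ B i j) {θ : ℝ}
    (h : Admissible f B θ) : Admissible f A θ := by
  intro τ hτ
  obtain ⟨u, hu⟩ := h τ hτ
  refine ⟨u, hu.pos, fun i => le_trans (Finset.sum_le_sum fun j _ => ?_) (hu.le i)⟩
  rw [tilted_entry, tilted_entry]
  exact mul_le_mul_of_nonneg_right
    (mul_le_mul_of_nonneg_right (hAB i j) (Real.exp_pos _).le) (hu.pos j).le

/-- On a flow the level `τ = 1` is attained, since all its edges lie on cycles. -/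
lemma IsFlow.exists_subInv {ν : Matrix (Fin M) (Fin M) ℝ} (hν : IsFlow Q ν) {θ : ℝ}
    (h : Admissible f (rowNorm ν) θ) : ∃ u, SubInv (tilted (rowNorm ν) f θ) 1 u := by
  refine exists_subInv_of_forall_gt (tilted_nonneg (rowNorm_nonneg hν.nonneg) θ)
    (fun i j hij => ?_) h
  rw [reach_tilted_iff, reach_rowNorm hν.nonneg]
  refine reach_of_balanced hν.nonneg hν.balanced ?_
  rw [tilted_entry] at hij
  exact (rowNorm_pos_iff hν.nonneg i j).1 (pos_of_mul_pos_left hij (Real.exp_pos _).le)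

/-- The increments along the edges of the connected flow `ν` are those of a potential `g`. Then
`ν` can be perturbed by a chain that runs through `ν` until it reaches a state `e`, from where it
makes an excursion of negative weight. -/
lemma IsDriftChain.exists_full_of_potential (h : IsDriftChain Q f φ)
    {ν : Matrix (Fin M) (Fin M) ℝ} (hν : IsFlow Q ν)
    (hconn : ∀ i j, 0 < ∑ k, ν i k → 0 < ∑ k, ν j k → Reach ν i j) {g : Fin M → ℝ}
    (hg : ∀ i j, 0 < ν i j → f j + g j = g i) {θ : ℝ} (hθ : 0 < θ) {η : ℝ} (hη : 0 < η) :
    ∃ F, IsFullFlow Q F ∧ flowEntropy Q F < flowEntropy Q ν + η ∧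
      Admissible f (rowNorm F) θ := by
  classical
  obtain ⟨i₀, hi₀⟩ := hν.exists_row_pos
  have : Nonempty (Fin M) := ⟨i₀⟩
  obtain ⟨H, hHE, hHs, e, he, k, hek, hk⟩ :=
    h.exists_extension_strict (E := {i | 0 < ∑ k, ν i k}) ⟨i₀, hi₀⟩ g
  set U : Fin M → ℝ := fun i => Real.exp (θ * H i) with hU
  set c : Fin M → ℝ := fun j => Real.exp (θ * f j) * U j with hc
  have hcU : ∀ j, c j = Real.exp (θ * (f j + H j)) := fun j => by
    simp only [hc, hU, ← Real.exp_add, ← mul_add]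
  have hνc : ∀ i, ∑ j, ν i j * c j = (∑ j, ν i j) * U i := fun i => by
    rw [Finset.sum_mul]
    refine Finset.sum_congr rfl fun j _ => ?_
    rcases (hν.nonneg i j).eq_or_lt with h0 | h0
    · simp [← h0]
    · rw [hcU, hHE j (hν.row_pos h0).2, hg i j h0, ← hHE i (hν.row_pos h0).1]
  have hrows : ∀ i, ∃ r : Fin M → ℝ, (∀ j, 0 ≤ r j) ∧ ∑ j, r j = 1 ∧
      (∀ j, 0 < r j → 0 < Q i j) ∧ ∑ j, r j * c j ≤ U i ∧
      (0 < ∑ k, ν i k → i ≠ e → ∀ j, 0 < ν i j → 0 < r j) ∧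
      (¬ 0 < ∑ k, ν i k → ∀ j, 0 < Q i j → 0 < r j) ∧
      (i = e → ∑ j, r j * c j < U i) := by
    intro i
    by_cases hi : 0 < ∑ k, ν i k ∧ i ≠ e
    · refine ⟨rowNorm ν i, rowNorm_nonneg hν.nonneg i, sum_rowNorm_eq_one hi.1,
        fun j hj => hν.supp i j ((rowNorm_pos_iff hν.nonneg i j).1 hj), ?_,
        fun _ _ j hj => (rowNorm_pos_iff hν.nonneg i j).2 hj, fun h' => absurd hi.1 h',
        fun h' => absurd h' hi.2⟩
      rw [sum_rowNorm_mul, hνc, mul_comm, mul_div_assoc, div_self hi.1.ne', mul_one]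
    · obtain ⟨j, hij, hj⟩ : ∃ j, 0 < Q i j ∧ f j + H j < H i := by
        by_cases hie : i = e
        · exact hie ▸ ⟨k, hek, hk⟩
        · exact hHs i fun h' => hi ⟨h', hie⟩
      have hlt : c j < U i := by
        rw [hcU]
        exact Real.exp_lt_exp.2 (mul_lt_mul_of_pos_left hj hθ)
      obtain ⟨r, h1, h2, h3, h4⟩ := exists_full_row_of_edge h.nonneg h.row_sum hij hlt
      exact ⟨r, h1, h2, fun j => (h3 j).1, h4.le, fun h' h'' => absurd ⟨h', h''⟩ hi,
        fun _ j => (h3 j).2, fun _ => h4⟩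
  choose A' hA0 hA1 hAQ hAc hAν hAfull hAe using hrows
  obtain ⟨A, rfl⟩ : ∃ A : Matrix (Fin M) (Fin M) ℝ, A = A' := ⟨A', rfl⟩
  have hνe : ∀ i, 0 < ∑ k, ν i k → Reach A i e := fun i hi => by
    induction hconn i e hi he using Relation.ReflTransGen.head_induction_on with
    | refl => exact Relation.ReflTransGen.refl
    | @head a b hab _ ih =>
      by_cases hae : a = e
      · exact hae ▸ Relation.ReflTransGen.refl
      · exact Relation.ReflTransGen.head (hAν a (hν.row_pos hab).1 hae b hab)
          (ih (hν.row_pos hab).2)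
  have hreach : ∀ i, Reach A i e := fun i => by
    induction h.reach i e using Relation.ReflTransGen.head_induction_on with
    | refl => exact Relation.ReflTransGen.refl
    | @head a b hab _ ih =>
      by_cases ha : 0 < ∑ k, ν a k
      · exact hνe a ha
      · exact Relation.ReflTransGen.head (hAfull a ha b hab) ih
  obtain ⟨p, hp0, hp1, hps⟩ := exists_stationary (A := A) hA0 hA1
  have hpe : 0 < p e := stationary_pos (A := A) hA0 hp0 hp1 hps hreach
  have hμ : IsFlow Q (chainFlow p A) := isFlow_chainFlow (A := A) hA0 hA1 hAQ hp0 hp1 hps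
  obtain ⟨s, ⟨hs0, hs1⟩, hs⟩ :=
    (eventually_mix_entropy_lt (Q := Q) ν (chainFlow p A) (half_pos hη)).exists
  have hF := hν.mix hμ hs0.le hs1.le
  have hs1' : 0 < 1 - s := by linarith
  set F := (1 - s) • ν + s • chainFlow p A with hFdef
  have hFν : ∀ i j, 0 < ν i j → 0 < F i j := fun i j hij => by
    rw [hFdef, mix_entry]
    have := hμ.nonneg i j
    positivity
  have hFμ : ∀ i j, 0 < chainFlow p A i j → 0 < F i j := fun i j hij => by
    rw [hFdef, mix_entry]
    have := hν.nonneg i j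
    positivity
  have hsub : ∀ i, ∑ j, F i j * c j ≤ (∑ j, F i j) * U i ∧
      (i = e → ∑ j, F i j * c j < (∑ j, F i j) * U i) := fun i => by
    have h1 : ∑ j, chainFlow p A i j * c j = p i * ∑ j, A i j * c j := by
      simp only [chainFlow_apply, mul_assoc, ← Finset.mul_sum]
    rw [hFdef, sum_mix_mul, sum_mix, sum_chainFlow (A := A) hA1, hνc, h1, add_mul, mul_assoc,
      mul_assoc]
    refine ⟨add_le_add le_rfl (mul_le_mul_of_nonneg_left
      (mul_le_mul_of_nonneg_left (hAc i) (hp0 i)) hs0.le), fun hie => ?_⟩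
    subst hie
    exact add_lt_add_of_le_of_lt le_rfl (mul_lt_mul_of_pos_left
      (mul_lt_mul_of_pos_left (hAe i rfl) hpe) hs0)
  have hFreach : ∀ i, 0 < ∑ k, F i k → Reach F i e := fun i hi => by
    by_cases hνi : 0 < ∑ k, ν i k
    · exact Relation.ReflTransGen.mono hFν _ _ (hconn i e hνi he)
    · have hpi : 0 < p i := by
        rw [hFdef, sum_mix, sum_chainFlow (A := A) hA1] at hi
        refine (hp0 i).lt_of_ne fun h0 => ?_
        rw [← h0] at hi
        have := mul_nonpos_of_nonneg_of_nonpos hs1'.le (not_lt.1 hνi)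
        linarith
      clear hi hνi
      induction hreach i using Relation.ReflTransGen.head_induction_on with
      | refl => exact Relation.ReflTransGen.refl
      | @head a b hab _ ih =>
        have hab' : 0 < chainFlow p A a b := mul_pos hpi hab
        refine Relation.ReflTransGen.head (hFμ a b hab') (ih ?_)
        have := (hμ.row_pos hab').2
        rwa [sum_chainFlow (A := A) hA1] at this
  have hFe : 0 < ∑ k, F e k := by
    rw [hFdef, sum_mix, sum_chainFlow (A := A) hA1]
    have : 0 < ∑ k, ν e k := he
    positivity
  obtain ⟨G, hG, hGent, hGadm⟩ := h.exists_full_of_strict_at hF hθ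
    (subInv_rowNorm (f := f) (θ := θ) (u := U) hF.nonneg (fun i => Real.exp_pos _)
      fun i => (hsub i).1) (e := e)
    (by rw [sum_tilted_rowNorm, one_mul, div_lt_iff₀ hFe, mul_comm (U e)]; exact (hsub e).2 rfl)
    hFreach (half_pos hη)
  exact ⟨G, hG, by linarith, hGadm⟩

/-- If `θ'` is admissible for a flow, then every smaller `θ` is admissible for some full flow of
nearly the same entropy. -/
lemma IsDriftChain.exists_full_of_admissible (h : IsDriftChain Q f φ)
    {ν : Matrix (Fin M) (Fin M) ℝ} (hν : IsFlow Q ν) {θ θ' : ℝ} (hθ : 0 < θ) (hθ' : θ < θ')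
    (hadm : Admissible f (rowNorm ν) θ') {η : ℝ} (hη : 0 < η) :
    ∃ F, IsFullFlow Q F ∧ flowEntropy Q F < flowEntropy Q ν + η ∧
      Admissible f (rowNorm F) θ := by
  obtain ⟨μ, hμ, hμent, hμle, hconn⟩ := hν.exists_connected
  suffices hs : ∃ F, IsFullFlow Q F ∧ flowEntropy Q F < flowEntropy Q μ + η ∧
      Admissible f (rowNorm F) θ by
    obtain ⟨F, h1, h2, h3⟩ := hs
    exact ⟨F, h1, by linarith, h3⟩
  obtain ⟨u, hu⟩ := hμ.exists_subInv (hadm.of_le hμle)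
  have hθ'0 : 0 < θ' := hθ.trans hθ'
  obtain ⟨hv, hvs⟩ := hu.interpolate (rowNorm_nonneg hμ.nonneg) (fun i => sum_rowNorm_le_one i)
    hθ hθ' le_rfl
  by_cases hstrict : ∃ i j, 0 < μ i j ∧ Real.exp (θ' * f j) * u j ≠ u i
  · obtain ⟨i, j, hij, hne⟩ := hstrict
    exact h.exists_full_of_strict_at hμ hθ hv
      (hvs i j ((rowNorm_pos_iff hμ.nonneg i j).2 hij) hne)
      (fun k hk => hconn k i hk (hμ.row_pos hij).1) hη
  · push Not at hstrict
    refine h.exists_full_of_potential hμ hconn (g := fun i => Real.log (u i) / θ')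
      (fun i j hij => ?_) hθ hη
    have h1 := hstrict i j hij
    rw [← h1, Real.log_mul (Real.exp_pos _).ne' (hu.pos j).ne', Real.log_exp]
    field_simp

end Upper

/-! ### Step counts of a path -/

section StepCount

variable {ι : Type*} [DecidableEq ι]

/-- The number of steps from `i` to `j` among the first `n` steps of the path `x`. -/
noncomputable def stepCount (n : ℕ) (x : ℕ → ι) : Matrix ι ι ℝ :=
  Matrix.of fun i j => ∑ k ∈ Finset.range n, if x k = i ∧ x (k + 1) = j then (1 : ℝ) else 0

lemma stepCount_nonneg (n : ℕ) (x : ℕ → ι) (i j : ι) : 0 ≤ stepCount n x i j := by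
  rw [stepCount, Matrix.of_apply]
  exact Finset.sum_nonneg fun k _ => by split_ifs <;> norm_num

lemma stepCount_pos_iff (n : ℕ) (x : ℕ → ι) (i j : ι) :
    0 < stepCount n x i j ↔ ∃ k < n, x k = i ∧ x (k + 1) = j := by
  constructor
  · intro h
    by_contra! hcon
    have : stepCount n x i j = 0 := Finset.sum_eq_zero fun k hk =>
      if_neg fun hk' => hcon k (Finset.mem_range.1 hk) hk'.1 hk'.2
    exact h.ne' this
  · rintro ⟨k, hk, hki, hkj⟩
    refine Finset.sum_pos' (fun k _ => by split_ifs <;> norm_num) ⟨k, Finset.mem_range.2 hk, ?_⟩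
    rw [if_pos ⟨hki, hkj⟩]
    exact one_pos

variable [Fintype ι]

lemma sum_stepCount_mul (n : ℕ) (x : ℕ → ι) (g : ι → ι → ℝ) :
    ∑ i, ∑ j, stepCount n x i j * g i j = ∑ k ∈ Finset.range n, g (x k) (x (k + 1)) := by
  simp only [stepCount, Matrix.of_apply, Finset.sum_mul, ite_mul, one_mul, zero_mul]
  have h : ∀ i, ∑ j, ∑ k ∈ Finset.range n, (if x k = i ∧ x (k + 1) = j then g i j else 0) =
      ∑ k ∈ Finset.range n, if x k = i then g i (x (k + 1)) else 0 := by
    intro i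
    rw [Finset.sum_comm]
    refine Finset.sum_congr rfl fun k _ => ?_
    by_cases hk : x k = i <;> simp [hk]
  simp only [h]
  rw [Finset.sum_comm]
  exact Finset.sum_congr rfl fun k _ => by simp

lemma sum_stepCount_row (n : ℕ) (x : ℕ → ι) (i : ι) :
    ∑ j, stepCount n x i j = ∑ k ∈ Finset.range n, if x k = i then (1 : ℝ) else 0 := by
  simp only [stepCount, Matrix.of_apply]
  rw [Finset.sum_comm]
  refine Finset.sum_congr rfl fun k _ => ?_
  by_cases hk : x k = i <;> simp [hk]

lemma sum_stepCount_col (n : ℕ) (x : ℕ → ι) (j : ι) :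
    ∑ i, stepCount n x i j = ∑ k ∈ Finset.range n, if x (k + 1) = j then (1 : ℝ) else 0 := by
  simp only [stepCount, Matrix.of_apply]
  rw [Finset.sum_comm]
  refine Finset.sum_congr rfl fun k _ => ?_
  by_cases hk : x (k + 1) = j <;> simp [hk]

/-- A path leaves every state as often as it enters it, up to its two end points. -/
lemma sum_stepCount_col_sub_row (n : ℕ) (x : ℕ → ι) (i : ι) :
    ∑ j, stepCount n x j i - ∑ j, stepCount n x i j =
      (if x n = i then (1 : ℝ) else 0) - if x 0 = i then (1 : ℝ) else 0 := by
  rw [sum_stepCount_row, sum_stepCount_col, ← Finset.sum_sub_distrib]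
  exact Finset.sum_range_sub (fun k => if x k = i then (1 : ℝ) else 0) n

lemma sum_stepCount (n : ℕ) (x : ℕ → ι) : ∑ i, ∑ j, stepCount n x i j = n := by
  have := sum_stepCount_mul n x fun _ _ => 1
  simpa using this

end StepCount

/-! ### Semicontinuity of the exponent -/

section Lower

variable {M : ℕ} {Q : Matrix (Fin M) (Fin M) ℝ} {f φ : Fin M → ℝ}

lemma continuous_rowSum_mul (c : Fin M → ℝ) (i : Fin M) :
    Continuous fun F : Matrix (Fin M) (Fin M) ℝ => ∑ j, F i j * c j :=
  continuous_finsetSum _ fun j _ => (continuous_id.matrix_elem i j).mul continuous_const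

lemma continuous_rowSum (i : Fin M) :
    Continuous fun F : Matrix (Fin M) (Fin M) ℝ => ∑ j, F i j :=
  continuous_finsetSum _ fun j _ => continuous_id.matrix_elem i j

/-- Where a row of `F` vanishes, `rowNorm F` is `0`, so that no lower bound on nearby rows is
needed. -/
lemma eventually_rowNorm_le {F : Matrix (Fin M) (Fin M) ℝ} (hF : ∀ i j, 0 ≤ F i j) {σ : ℝ}
    (hσ : 1 < σ) :
    ∀ᶠ F' in 𝓝 F, (∀ i j, 0 ≤ F' i j) → ∀ i j, rowNorm F i j ≤ σ * rowNorm F' i j := by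
  have h : ∀ i j, ∀ᶠ F' in 𝓝 F, (∀ i j, 0 ≤ F' i j) → rowNorm F i j ≤ σ * rowNorm F' i j := by
    intro i j
    rcases (hF i j).eq_or_lt with h0 | h0
    · refine Eventually.of_forall fun F' hF' => ?_
      rw [rowNorm_apply, ← h0, zero_div]
      exact mul_nonneg (by linarith) (rowNorm_nonneg hF' i j)
    · have hS := h0.trans_le (le_row_sum hF i j)
      have hc : ContinuousAt (fun F' : Matrix (Fin M) (Fin M) ℝ => σ * rowNorm F' i j) F := by
        refine continuousAt_const.mul (ContinuousAt.div ?_ ?_ hS.ne')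
        · exact (continuous_id.matrix_elem i j).continuousAt
        · exact (continuous_rowSum i).continuousAt
      have hpos : 0 < rowNorm F i j := (rowNorm_pos_iff hF i j).2 h0
      filter_upwards [hc.eventually (lt_mem_nhds (show rowNorm F i j < σ * rowNorm F i j by
        nlinarith))] with F' hF' _
      exact hF'.le
  filter_upwards [eventually_all.2 fun i => eventually_all.2 fun j => h i j] with F' hF' h0 i j
  exact hF' i j h0

/-- Admissibility of `θ` is a closed condition on flows, also where rows vanish. -/
lemma admissible_of_frequently {F : Matrix (Fin M) (Fin M) ℝ} (hF : ∀ i j, 0 ≤ F i j) {θ : ℝ}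
    (h : ∃ᶠ F' in 𝓝 F, (∀ i j, 0 ≤ F' i j) ∧ Admissible f (rowNorm F') θ) :
    Admissible f (rowNorm F) θ := by
  intro τ hτ
  have hτ0 : 0 < τ := by linarith
  have hσ : 1 < √τ := Real.lt_sqrt_of_sq_lt (by simpa using hτ)
  obtain ⟨F', ⟨hF'0, hadm⟩, hle⟩ := (h.and_eventually (eventually_rowNorm_le hF hσ)).exists
  obtain ⟨u, hu⟩ := hadm _ hσ
  refine ⟨u, hu.pos, fun i => ?_⟩
  calc ∑ j, tilted (rowNorm F) f θ i j * u j
      ≤ ∑ j, √τ * (tilted (rowNorm F') f θ i j * u j) := by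
        refine Finset.sum_le_sum fun j _ => ?_
        rw [tilted_entry, tilted_entry, ← mul_assoc, ← mul_assoc]
        exact mul_le_mul_of_nonneg_right (mul_le_mul_of_nonneg_right (hle hF'0 i j)
          (Real.exp_pos _).le) (hu.pos j).le
    _ ≤ √τ * (√τ * u i) := by
        rw [← Finset.mul_sum]
        exact mul_le_mul_of_nonneg_left (hu.le i) (Real.sqrt_nonneg _)
    _ = τ * u i := by rw [← mul_assoc, Real.mul_self_sqrt hτ0.le]

lemma exists_pos_of_sum_eq_one {ι : Type*} [Fintype ι] {p : ι → ℝ} (h : ∑ i, p i = 1) :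
    ∃ i, 0 < p i := by
  by_contra! hcon
  have := Finset.sum_nonpos fun i (_ : i ∈ Finset.univ) => hcon i
  rw [h] at this
  exact this.not_gt one_pos

lemma IsDriftChain.row_pos (h : IsDriftChain Q f φ) {F : Matrix (Fin M) (Fin M) ℝ}
    (hF : IsFullFlow Q F) (i : Fin M) : 0 < ∑ k, F i k := by
  obtain ⟨j, hj⟩ := exists_pos_of_sum_eq_one (h.row_sum i)
  exact (hF.full i j hj).trans_le (le_row_sum hF.nonneg i j)

/-- At a full flow, admissibility of `θ'` persists, for slightly smaller values, nearby. -/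
lemma IsDriftChain.eventually_admissible (h : IsDriftChain Q f φ)
    {F : Matrix (Fin M) (Fin M) ℝ} (hF : IsFullFlow Q F) {θ θ' : ℝ} (hθ : 0 < θ) (hθ' : θ < θ')
    (hadm : Admissible f (rowNorm F) θ') :
    ∀ᶠ F' in 𝓝 F, (∀ i j, 0 ≤ F' i j) → Admissible f (rowNorm F') θ := by
  have hθ'0 : 0 < θ' := hθ.trans hθ'
  obtain ⟨u, hu⟩ := hF.exists_subInv hadm
  obtain ⟨hv, hvs⟩ := hu.interpolate (rowNorm_nonneg hF.nonneg) (fun i => sum_rowNorm_le_one i)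
    hθ hθ' le_rfl
  obtain ⟨i₀, j₀, hij, hne⟩ : ∃ i j, 0 < F i j ∧ Real.exp (θ' * f j) * u j ≠ u i := by
    by_contra! hcon
    refine h.not_potential (fun i => Real.log (u i) / θ') fun i j hij => le_of_eq ?_
    rw [← hcon i j (hF.full i j hij), Real.log_mul (Real.exp_pos _).ne' (hu.pos j).ne',
      Real.log_exp]
    field_simp
  obtain ⟨w, hw, hws⟩ := hv.exists_strict (tilted_nonneg (rowNorm_nonneg hF.nonneg) θ)
  have hrow : ∀ i, ∀ᶠ F' in 𝓝 F,
      ∑ j, F' i j * (Real.exp (θ * f j) * w j) < (∑ j, F' i j) * w i := by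
    intro i
    have h1 := hws i ⟨i₀, by
      rw [reach_tilted_iff, reach_rowNorm hF.nonneg]
      exact Relation.ReflTransGen.mono hF.full _ _ (h.reach i i₀),
      hvs i₀ j₀ ((rowNorm_pos_iff hF.nonneg i₀ j₀).2 hij) hne⟩
    rw [sum_tilted_rowNorm, one_mul, div_lt_iff₀ (h.row_pos hF i), mul_comm (w i)] at h1
    exact ((continuous_rowSum_mul _ i).tendsto F).eventually_lt
      (((continuous_rowSum i).mul continuous_const).tendsto F) h1
  filter_upwards [eventually_all.2 hrow] with F' hF' h0
  exact Admissible.of_subInv (subInv_rowNorm h0 hw.pos fun i => (hF' i).le)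

/-- The exponent is continuous, among nonnegative matrices, at every full flow. -/
lemma IsDriftChain.tendsto_exponent (h : IsDriftChain Q f φ) {F : Matrix (Fin M) (Fin M) ℝ}
    (hF : IsFullFlow Q F) :
    Tendsto (fun F' => exponent f (rowNorm F')) (𝓝[{F' | ∀ i j, 0 ≤ F' i j}] F)
      (𝓝 (exponent f (rowNorm F))) := by
  refine tendsto_order.2 ⟨fun a ha => ?_, fun b hb => ?_⟩
  · obtain ⟨r, har, hr⟩ := ENNReal.lt_iff_exists_nnreal_btwn.1 ha
    obtain ⟨r', hrr', hr'⟩ := ENNReal.lt_iff_exists_nnreal_btwn.1 hr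
    have hlt : (r : ℝ) < r' := by exact_mod_cast hrr'
    have hr0 : (0 : ℝ) < r := by
      have : (0 : ℝ≥0∞) < r := bot_le.trans_lt har
      exact_mod_cast this
    have hadm := Admissible.of_lt_exponent (rowNorm_nonneg hF.nonneg)
      (fun i => sum_rowNorm_le_one i) r'.coe_nonneg (by rwa [ENNReal.ofReal_coe_nnreal])
    rw [eventually_nhdsWithin_iff]
    filter_upwards [h.eventually_admissible hF hr0 hlt hadm] with F' hF' h0
    have := (hF' h0).le_exponent (rowNorm_nonneg h0)
    rw [ENNReal.ofReal_coe_nnreal] at this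
    exact har.trans_le this
  · obtain ⟨r, hr, hrb⟩ := ENNReal.lt_iff_exists_nnreal_btwn.1 hb
    rw [eventually_nhdsWithin_iff]
    by_contra hcon
    have hfreq : ∃ᶠ F' in 𝓝 F, (∀ i j, 0 ≤ F' i j) ∧ Admissible f (rowNorm F') r := by
      refine (not_eventually.1 hcon).mono fun F' hF' => ?_
      push Not at hF'
      refine ⟨hF'.1, Admissible.of_lt_exponent (rowNorm_nonneg hF'.1)
        (fun i => sum_rowNorm_le_one i) r.coe_nonneg ?_⟩
      rw [ENNReal.ofReal_coe_nnreal]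
      exact hrb.trans_le hF'.2
    have := (admissible_of_frequently hF.nonneg hfreq).le_exponent (rowNorm_nonneg hF.nonneg)
    rw [ENNReal.ofReal_coe_nnreal] at this
    exact this.not_gt hr

/-- Longest walks, by the Bellman–Ford recursion: on a finite graph with weights `f j` on the
edges `(i, j)`, either there is a potential that dominates the weights, or a closed walk of
positive weight. The latter is recorded as a balanced flow. -/
lemma exists_potential_or_cycle (R : Fin M → Fin M → Prop) (f : Fin M → ℝ) :
    (∃ G : Fin M → ℝ, ∀ i j, R i j → f j + G j ≤ G i) ∨
      ∃ γ : Matrix (Fin M) (Fin M) ℝ, (∀ i j, 0 ≤ γ i j) ∧ (∀ i, ∑ j, γ i j = ∑ j, γ j i) ∧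
        (∀ i j, 0 < γ i j → R i j) ∧ 0 < ∑ i, ∑ j, γ i j * f j := by
  classical
  -- `V n i` is the largest weight of a walk of length at most `n` from `i`
  let V : ℕ → Fin M → ℝ := fun n => Nat.rec (fun _ => 0) (fun _ W i =>
    Finset.univ.sup' ⟨i, Finset.mem_univ i⟩ fun j => if R i j then max (W i) (f j + W j) else W i) n
  have hV : ∀ n i, V (n + 1) i = Finset.univ.sup' ⟨i, Finset.mem_univ i⟩
      fun j => if R i j then max (V n i) (f j + V n j) else V n i := fun n i => rfl
  have hmono : ∀ n i, V n i ≤ V (n + 1) i := fun n i => by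
    rw [hV]
    refine le_trans ?_ (Finset.le_sup' _ (Finset.mem_univ i))
    split_ifs
    · exact le_max_left _ _
    · exact le_rfl
  have hedge : ∀ n i j, R i j → f j + V n j ≤ V (n + 1) i := fun n i j hij => by
    rw [hV]
    refine le_trans ?_ (Finset.le_sup' _ (Finset.mem_univ j))
    rw [if_pos hij]
    exact le_max_right _ _
  have hstep : ∀ n i, V n i < V (n + 1) i → ∃ j, R i j ∧ V (n + 1) i = f j + V n j := by
    intro n i hlt
    obtain ⟨j, -, hj⟩ := Finset.exists_mem_eq_sup' ⟨i, Finset.mem_univ i⟩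
      fun j => if R i j then max (V n i) (f j + V n j) else V n i
    rw [← hV] at hj
    split_ifs at hj with hR
    · rcases max_choice (V n i) (f j + V n j) with hm | hm
      · rw [hm] at hj
        exact absurd hj hlt.ne'
      · exact ⟨j, hR, hj.trans hm⟩
    · exact absurd hj hlt.ne'
  rcases Classical.em (∃ n, ∀ i, V (n + 1) i ≤ V n i) with ⟨n, hn⟩ | hgrow
  · exact Or.inl ⟨V n, fun i j hij => (hedge n i j hij).trans (hn i)⟩
  push Not at hgrow
  right
  -- While the recursion keeps improving, the improvements can be traced back along a walk.
  have hwalk : ∀ n i, V n i < V (n + 1) i → ∃ y : ℕ → Fin M, y n = i ∧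
      (∀ m ≤ n, V m (y m) < V (m + 1) (y m)) ∧
      ∀ m < n, R (y (m + 1)) (y m) ∧ V (m + 2) (y (m + 1)) = f (y m) + V (m + 1) (y m) := by
    intro n
    induction n with
    | zero => exact fun i hi => ⟨fun _ => i, rfl, fun m hm => by simpa [Nat.le_zero.1 hm] using hi,
        fun m hm => absurd hm (Nat.not_lt_zero m)⟩
    | succ n ih =>
      intro i hi
      obtain ⟨j, hij, hj⟩ := hstep (n + 1) i hi
      have hj' : V n j < V (n + 1) j := by linarith [hedge n i j hij]
      obtain ⟨y, hyn, hy1, hy2⟩ := ih j hj'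
      refine ⟨fun m => if m ≤ n then y m else i, by simp, fun m hm => ?_, fun m hm => ?_⟩
      · by_cases hmn : m ≤ n
        · simpa [hmn] using hy1 m hmn
        · obtain rfl : m = n + 1 := by omega
          simpa [hmn] using hi
      · have hmn : m ≤ n := by omega
        by_cases hmn' : m + 1 ≤ n
        · simpa [hmn, hmn'] using hy2 m hmn'
        · obtain rfl : m = n := by omega
          simp only [hmn', hmn, if_true, if_false, hyn]
          exact ⟨hij, hj⟩
  obtain ⟨i, hi⟩ := hgrow M
  obtain ⟨y, -, hy1, hy2⟩ := hwalk M i hi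
  obtain ⟨a, b, hab, hbM, hyab⟩ : ∃ a b, a < b ∧ b ≤ M ∧ y a = y b := by
    obtain ⟨a, b, hne, heq⟩ := Fintype.exists_ne_map_eq_of_card_lt
      (fun k : Fin (M + 1) => y k) (by simp)
    rcases lt_or_gt_of_ne hne with hlt | hlt
    · exact ⟨a, b, hlt, Nat.lt_succ_iff.1 b.2, heq⟩
    · exact ⟨b, a, hlt, Nat.lt_succ_iff.1 a.2, heq.symm⟩
  obtain ⟨n, rfl⟩ := Nat.exists_eq_add_of_lt hab
  set z : ℕ → Fin M := fun k => y (a + k) with hz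
  refine ⟨(stepCount (n + 1) z)ᵀ, fun i j => stepCount_nonneg _ _ _ _, fun i => ?_,
    fun i j hij => ?_, ?_⟩
  · have h1 := sum_stepCount_col_sub_row (n + 1) z i
    have h2 : z (n + 1) = z 0 := hyab.symm
    rw [h2, sub_self] at h1
    simp only [Matrix.transpose_apply]
    linarith
  · obtain ⟨k, hk, rfl, rfl⟩ := (stepCount_pos_iff (n + 1) z j i).1 hij
    exact (hy2 (a + k) (by omega)).1
  · have h1 : ∑ i, ∑ j, (stepCount (n + 1) z)ᵀ i j * f j =
        ∑ k ∈ Finset.range (n + 1), f (z k) := by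
      rw [Finset.sum_comm]
      simpa using sum_stepCount_mul (n + 1) z fun i _ => f i
    have h2 : ∑ k ∈ Finset.range (n + 1), f (z k) =
        ∑ k ∈ Finset.range (n + 1),
          (V (a + (k + 1) + 1) (z (k + 1)) - V (a + k + 1) (z k)) := by
      refine Finset.sum_congr rfl fun k hk => ?_
      have hk' := Finset.mem_range.1 hk
      have h3 := (hy2 (a + k) (by omega)).2
      have h4 : V (a + (k + 1) + 1) (z (k + 1)) = f (z k) + V (a + k + 1) (z k) := h3
      rw [h4]
      ring
    rw [h1, h2, Finset.sum_range_sub fun k => V (a + k + 1) (z k)]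
    have h5 : V (a + n + 1) (y (a + n + 1)) < V (a + n + 1 + 1) (y (a + n + 1)) :=
      hy1 (a + n + 1) hbM
    have h6 : V (a + 1) (y (a + n + 1)) ≤ V (a + n + 1) (y (a + n + 1)) :=
      monotone_nat_of_le_succ (f := fun m => V m (y (a + n + 1))) (fun m => hmono m _)
        (show a + 1 ≤ a + n + 1 by omega)
    have h7 : z 0 = y (a + n + 1) := hyab
    have h8 : z (n + 1) = y (a + n + 1) := rfl
    rw [h7, h8]
    change 0 < V (a + n + 1 + 1) _ - V (a + 1) _
    linarith

/-- If `θ'` is admissible for all full flows whose entropy is close to that of `ν`, then every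
smaller `θ` is admissible for all nonnegative matrices near `ν` that charge only edges of `Q`,
whatever their vanishing or unbalanced rows. -/
lemma IsDriftChain.eventually_admissible_of_forall_full (h : IsDriftChain Q f φ)
    {ν : Matrix (Fin M) (Fin M) ℝ} (hν : IsFlow Q ν) {θ θ' : ℝ} (hθ : 0 < θ) (hθ' : θ < θ')
    {η : ℝ} (hη : 0 < η)
    (hall : ∀ F, IsFullFlow Q F → flowEntropy Q F < flowEntropy Q ν + η →
      Admissible f (rowNorm F) θ') :
    ∀ᶠ N in 𝓝 ν, (∀ i j, 0 ≤ N i j) → (∀ i j, 0 < N i j → 0 < Q i j) →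
      Admissible f (rowNorm N) θ := by
  classical
  have hθ'0 : 0 < θ' := hθ.trans hθ'
  have hclosure : ∀ μ, IsFlow Q μ → flowEntropy Q μ < flowEntropy Q ν + η →
      Admissible f (rowNorm μ) θ' := by
    intro μ hμ hlt
    refine admissible_of_frequently hμ.nonneg ((tendsto_mix μ (chainFlow φ Q)).frequently
      (Eventually.frequently ?_))
    filter_upwards [eventually_mix_entropy_lt (Q := Q) μ (chainFlow φ Q) (sub_pos.2 hlt)]
      with s ⟨⟨hs0, hs1⟩, hs⟩
    have hF := hμ.mix h.isFullFlow.toIsFlow hs0.le hs1.le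
    refine ⟨hF.nonneg, hall _ ⟨hF, fun i j hij => ?_⟩ (by linarith)⟩
    rw [mix_entry]
    have h1 := hμ.nonneg i j
    have h2 := h.isFullFlow.full i j hij
    have h3 : 0 < 1 - s := by linarith
    positivity
  obtain ⟨u, hu⟩ := hν.exists_subInv (hclosure ν hν (by linarith))
  obtain ⟨hv, hvs⟩ := hu.interpolate (rowNorm_nonneg hν.nonneg) (fun i => sum_rowNorm_le_one i)
    hθ hθ' le_rfl
  obtain ⟨w, hw, hws⟩ := hv.exists_strict (tilted_nonneg (rowNorm_nonneg hν.nonneg) θ)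
  -- `W` is the union of the classes of `ν` on which `θ' f` is not given by the potential `log u`
  let W : Fin M → Prop := fun i =>
    ∃ j k, Reach ν i j ∧ 0 < ν j k ∧ Real.exp (θ' * f k) * u k ≠ u j
  have hWiff : ∀ i j, 0 < ν i j → (W i ↔ W j) := by
    refine fun i j hij => ⟨?_, ?_⟩
    · rintro ⟨k, l, hik, hkl⟩
      exact ⟨k, l, (reach_of_balanced hν.nonneg hν.balanced hij).trans hik, hkl⟩
    · rintro ⟨k, l, hjk, hkl⟩
      exact ⟨k, l, Relation.ReflTransGen.head hij hjk, hkl⟩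
  have hWrow : ∀ i, W i → 0 < ∑ k, ν i k := by
    rintro i ⟨j, k, hij, hjk, -⟩
    rcases Relation.ReflTransGen.cases_head hij with rfl | ⟨l, hil, -⟩
    · exact (hν.row_pos hjk).1
    · exact (hν.row_pos hil).1
  have hWstrict : ∀ i, W i →
      ∑ j, ν i j * (Real.exp (θ * f j) * w j) < (∑ j, ν i j) * w i := by
    rintro i hi
    obtain ⟨j, k, hij, hjk, hne⟩ := id hi
    have h1 := hws i ⟨j, by rwa [reach_tilted_iff, reach_rowNorm hν.nonneg],
      hvs j k ((rowNorm_pos_iff hν.nonneg j k).2 hjk) hne⟩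
    rwa [sum_tilted_rowNorm, one_mul, div_lt_iff₀ (hWrow i hi), mul_comm (w i)] at h1
  have hflat : ∀ i j, ¬ W i → 0 < ν i j → θ' * f j = Real.log (u i) - Real.log (u j) := by
    intro i j hi hij
    have h1 : Real.exp (θ' * f j) * u j = u i := by
      by_contra hne
      exact hi ⟨i, j, Relation.ReflTransGen.refl, hij, hne⟩
    rw [← h1, Real.log_mul (Real.exp_pos _).ne' (hu.pos j).ne', Real.log_exp]
    ring
  rcases exists_potential_or_cycle (fun i j => ¬ W i ∧ ¬ W j ∧ 0 < Q i j) f with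
    ⟨G, hG⟩ | ⟨γ, hγ0, hγbal, hγR, hγf⟩
  · -- On the complement of `W` all edges of `Q` respect the potential `G`; `W` is put far below.
    obtain ⟨κ, hκ, hκle⟩ : ∃ κ : ℝ, 0 < κ ∧ ∀ i j,
        Real.exp (θ * f j) * (κ * w j) ≤ Real.exp (θ * G i) := by
      have hx : ∀ p : Fin M × Fin M, ∃ κ : ℝ, 0 < κ ∧
          Real.exp (θ * f p.2) * (κ * w p.2) ≤ Real.exp (θ * G p.1) := fun p => by
        have hwp := hw.pos p.2
        refine ⟨Real.exp (θ * G p.1) / (Real.exp (θ * f p.2) * w p.2), by positivity,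
          le_of_eq ?_⟩
        field_simp
      choose K hK hKle using hx
      rcases isEmpty_or_nonempty (Fin M × Fin M) with hemp | hne
      · exact ⟨1, one_pos, fun i j => (hemp.false (i, j)).elim⟩
      · obtain ⟨p, hp⟩ := Finite.exists_min K
        refine ⟨K p, hK p, fun i j => le_trans ?_ (hKle (i, j))⟩
        exact mul_le_mul_of_nonneg_left (mul_le_mul_of_nonneg_right (hp (i, j)) (hw.pos j).le)
          (Real.exp_pos _).le
    let U : Fin M → ℝ := fun i => if W i then κ * w i else Real.exp (θ * G i)
    have hU : ∀ i, 0 < U i := fun i => by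
      simp only [U]
      split_ifs
      · exact mul_pos hκ (hw.pos i)
      · exact Real.exp_pos _
    have hWev : ∀ i, ∀ᶠ N in 𝓝 ν, W i →
        ∑ j, N i j * (Real.exp (θ * f j) * U j) < (∑ j, N i j) * U i := by
      intro i
      by_cases hi : W i
      · have h1 : ∑ j, ν i j * (Real.exp (θ * f j) * U j) < (∑ j, ν i j) * U i := by
          have h2 : ∑ j, ν i j * (Real.exp (θ * f j) * U j) =
              κ * ∑ j, ν i j * (Real.exp (θ * f j) * w j) := by
            rw [Finset.mul_sum]
            refine Finset.sum_congr rfl fun j _ => ?_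
            rcases (hν.nonneg i j).eq_or_lt with h0 | h0
            · simp [← h0]
            · simp only [U, if_pos ((hWiff i j h0).1 hi)]
              ring
          have h3 : (∑ j, ν i j) * U i = κ * ((∑ j, ν i j) * w i) := by
            simp only [U, if_pos hi]
            ring
          rw [h2, h3]
          exact mul_lt_mul_of_pos_left (hWstrict i hi) hκ
        filter_upwards [((continuous_rowSum_mul _ i).tendsto ν).eventually_lt
          (((continuous_rowSum i).mul continuous_const).tendsto ν) h1] with N hN _
        exact hN
      · exact Eventually.of_forall fun N hi' => absurd hi' hi
    filter_upwards [eventually_all.2 hWev] with N hN hN0 hNQ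
    refine Admissible.of_subInv (subInv_rowNorm hN0 hU fun i => ?_)
    by_cases hi : W i
    · exact (hN i hi).le
    · rw [Finset.sum_mul]
      refine Finset.sum_le_sum fun j _ => ?_
      rcases (hN0 i j).eq_or_lt with h0 | h0
      · simp [← h0]
      · refine mul_le_mul_of_nonneg_left ?_ h0.le
        by_cases hj : W j
        · simp only [U, if_pos hj, if_neg hi]
          exact hκle i j
        · simp only [U, if_neg hj, if_neg hi]
          rw [← Real.exp_add, ← mul_add]
          exact Real.exp_le_exp.2 (mul_le_mul_of_nonneg_left (hG i j ⟨hi, hj, hNQ i j h0⟩) hθ.le)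
  · -- Adding the cycle `γ` to `ν` would produce a positive drift outside `W`.
    exfalso
    have hmass : 0 < ∑ i, ∑ j, γ i j := by
      refine (Finset.sum_nonneg fun i _ => Finset.sum_nonneg fun j _ => hγ0 i j).lt_of_ne
        fun h0 => ?_
      have hz : ∀ i j, γ i j = 0 := fun i j => by
        have h1 := (Finset.sum_eq_zero_iff_of_nonneg fun i _ =>
          Finset.sum_nonneg fun j _ => hγ0 i j).1 h0.symm i (Finset.mem_univ i)
        exact (Finset.sum_eq_zero_iff_of_nonneg fun j _ => hγ0 i j).1 h1 j (Finset.mem_univ j)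
      simp [hz] at hγf
    set g := ∑ i, ∑ j, γ i j with hgdef
    have hγflow : IsFlow Q (g⁻¹ • γ) := by
      refine ⟨fun i j => ?_, fun i j hij => ?_, ?_, fun i => ?_⟩
      · have := hγ0 i j
        simp only [Matrix.smul_apply, smul_eq_mul]
        positivity
      · simp only [Matrix.smul_apply, smul_eq_mul] at hij
        exact (hγR i j (pos_of_mul_pos_right hij (by positivity))).2.2
      · simp only [Matrix.smul_apply, smul_eq_mul, ← Finset.mul_sum, ← hgdef]
        exact inv_mul_cancel₀ hmass.ne'
      · simp only [Matrix.smul_apply, smul_eq_mul, ← Finset.mul_sum, hγbal i]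
    obtain ⟨s, ⟨hs0, hs1⟩, hs⟩ := (eventually_mix_entropy_lt (Q := Q) ν (g⁻¹ • γ) hη).exists
    have hF := hν.mix hγflow hs0.le hs1.le
    have hs1' : 0 < 1 - s := by linarith
    obtain ⟨r, hr⟩ := hF.exists_subInv (hclosure _ hF hs)
    set F := (1 - s) • ν + s • g⁻¹ • γ with hFdef
    have hFW : ∀ i j, 0 < F i j → (¬ W i ↔ ¬ W j) := by
      intro i j hij
      rw [hFdef, mix_entry] at hij
      rcases (hν.nonneg i j).eq_or_lt with h0 | h0
      · rw [← h0, mul_zero, zero_add, Matrix.smul_apply, smul_eq_mul] at hij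
        have h1 := hγR i j (pos_of_mul_pos_right (pos_of_mul_pos_right hij hs0.le) (by positivity))
        exact ⟨fun _ => h1.2.1, fun _ => h1.1⟩
      · exact not_congr (hWiff i j h0)
    -- the logarithm of the subinvariance inequality
    have hlog : ∀ i, ∑ j, F i j * (θ' * f j - (Real.log (r i) - Real.log (r j))) ≤ 0 := by
      intro i
      by_cases hi : 0 < ∑ k, F i k
      · have h1 := hr.le i
        rw [sum_tilted_rowNorm, one_mul, div_le_iff₀ hi] at h1
        have h2 : ∀ j, F i j * (θ' * f j - (Real.log (r i) - Real.log (r j))) ≤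
            F i j * (Real.exp (θ' * f j) * r j / r i - 1) := fun j => by
          refine mul_le_mul_of_nonneg_left ?_ (hF.nonneg i j)
          have hy : 0 < Real.exp (θ' * f j) * r j / r i :=
            div_pos (mul_pos (Real.exp_pos _) (hr.pos j)) (hr.pos i)
          refine le_trans (le_of_eq ?_) (Real.log_le_sub_one_of_pos hy)
          rw [Real.log_div (mul_pos (Real.exp_pos _) (hr.pos j)).ne' (hr.pos i).ne',
            Real.log_mul (Real.exp_pos _).ne' (hr.pos j).ne', Real.log_exp]
          ring
        refine (Finset.sum_le_sum fun j _ => h2 j).trans ?_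
        have h3 : ∑ j, F i j * (Real.exp (θ' * f j) * r j / r i - 1) =
            (∑ j, F i j * (Real.exp (θ' * f j) * r j)) / r i - ∑ j, F i j := by
          rw [Finset.sum_div, ← Finset.sum_sub_distrib]
          exact Finset.sum_congr rfl fun j _ => by ring
        rw [h3, sub_nonpos, div_le_iff₀ (hr.pos i), mul_comm]
        exact h1
      · simp [hF.eq_zero_of_row hi]
    have hbalF := sum_balanced (F := fun i j => if ¬ W i then F i j else 0)
      (balanced_restrict hF.nonneg hF.balanced (fun i => ¬ W i) hFW) fun i => Real.log (r i)
    have hbalν := sum_balanced (F := fun i j => if ¬ W i then ν i j else 0)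
      (balanced_restrict hν.nonneg hν.balanced (fun i => ¬ W i)
        fun i j hij => not_congr (hWiff i j hij)) fun i => Real.log (u i)
    have hdrift : ∑ i, ∑ j, (if ¬ W i then F i j else 0) * (θ' * f j) ≤ 0 := by
      have h1 : ∑ i, ∑ j, (if ¬ W i then F i j else 0) *
          (θ' * f j - (Real.log (r i) - Real.log (r j))) ≤ 0 := by
        refine Finset.sum_nonpos fun i _ => ?_
        by_cases hi : W i
        · simp [hi]
        · simpa [hi] using hlog i
      simp only [mul_sub _ (θ' * f _), Finset.sum_sub_distrib] at h1 hbalF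
      linarith
    have hνdrift : ∑ i, ∑ j, (if ¬ W i then ν i j else 0) * (θ' * f j) = 0 := by
      refine Eq.trans ?_ hbalν
      refine Finset.sum_congr rfl fun i _ => Finset.sum_congr rfl fun j _ => ?_
      by_cases hi : W i
      · simp [hi]
      · rcases (hν.nonneg i j).eq_or_lt with h0 | h0
        · simp [← h0]
        · rw [hflat i j hi h0]
    have hsplit : ∑ i, ∑ j, (if ¬ W i then F i j else 0) * (θ' * f j) =
        (1 - s) * ∑ i, ∑ j, (if ¬ W i then ν i j else 0) * (θ' * f j) +
          s * (g⁻¹ * (θ' * ∑ i, ∑ j, γ i j * f j)) := by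
      simp only [Finset.mul_sum, ← Finset.sum_add_distrib]
      refine Finset.sum_congr rfl fun i _ => Finset.sum_congr rfl fun j _ => ?_
      rw [hFdef, mix_entry, Matrix.smul_apply, smul_eq_mul]
      by_cases hi : W i
      · have h0 : γ i j = 0 :=
          le_antisymm (not_lt.1 fun h' => (hγR i j h').1 hi) (hγ0 i j)
        simp [hi, h0]
      · simp only [hi, not_false_eq_true, if_true]
        ring
    rw [hsplit, hνdrift, mul_zero, zero_add] at hdrift
    have : 0 < s * (g⁻¹ * (θ' * ∑ i, ∑ j, γ i j * f j)) := by positivity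
    linarith

end Lower

/-! ### Large deviations of the empirical flow -/

section Paths

variable {ι : Type*}

/-- A finite path, prolonged to all times; only the times up to `n` matter. -/
def extendPath {n : ℕ} (y : Fin (n + 1) → ι) : ℕ → ι := fun k => y (Fin.ofNat (n + 1) k)

lemma extendPath_of_le {n : ℕ} (y : Fin (n + 1) → ι) {k : ℕ} (hk : k ≤ n) :
    extendPath y k = y ⟨k, Nat.lt_succ_of_le hk⟩ :=
  congrArg y (Fin.ext (Nat.mod_eq_of_lt (Nat.lt_succ_of_le hk)))

/-- The probability of the path `x 0, …, x n` for the chain with initial law `p` and transition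
matrix `A`. -/
def pathWeight (p : ι → ℝ) (A : Matrix ι ι ℝ) (n : ℕ) (x : ℕ → ι) : ℝ :=
  p (x 0) * ∏ k ∈ Finset.range n, A (x k) (x (k + 1))

lemma pathWeight_nonneg {p : ι → ℝ} {A : Matrix ι ι ℝ} (hp : ∀ i, 0 ≤ p i)
    (hA : ∀ i j, 0 ≤ A i j) (n : ℕ) (x : ℕ → ι) : 0 ≤ pathWeight p A n x :=
  mul_nonneg (hp _) (Finset.prod_nonneg fun _ _ => hA _ _)

lemma pathWeight_extendPath (p : ι → ℝ) (A : Matrix ι ι ℝ) {n : ℕ} (y : Fin (n + 1) → ι) :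
    pathWeight p A n (extendPath y) = p (y 0) * ∏ k : Fin n, A (y k.castSucc) (y k.succ) := by
  rw [pathWeight, Finset.prod_range]
  congr 1
  refine Finset.prod_congr rfl fun k _ => ?_
  rw [extendPath_of_le y k.2.le, extendPath_of_le y k.2]
  rfl

lemma pos_of_pathWeight_ne_zero {p : ι → ℝ} {A : Matrix ι ι ℝ} (hA : ∀ i j, 0 ≤ A i j) {n : ℕ}
    {x : ℕ → ι} (h : pathWeight p A n x ≠ 0) {k : ℕ} (hk : k < n) : 0 < A (x k) (x (k + 1)) := by
  refine (hA _ _).lt_of_ne fun h0 => h ?_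
  rw [pathWeight, Finset.prod_eq_zero (Finset.mem_range.2 hk) h0.symm, mul_zero]

lemma supp_of_pathWeight_ne_zero [DecidableEq ι] {p : ι → ℝ} {A : Matrix ι ι ℝ}
    (hA : ∀ i j, 0 ≤ A i j) {n : ℕ} {x : ℕ → ι}
    (h : pathWeight p A n x ≠ 0) (i j : ι) (hij : 0 < stepCount n x i j) :
    0 < A i j := by
  obtain ⟨k, hk, rfl, rfl⟩ := (stepCount_pos_iff n x i j).1 hij
  exact pos_of_pathWeight_ne_zero hA h hk

lemma stepCount_congr [DecidableEq ι] {n : ℕ} {x y : ℕ → ι} (h : ∀ k ≤ n, x k = y k) :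
    stepCount n x = stepCount n y := by
  ext i j
  simp only [stepCount, Matrix.of_apply]
  refine Finset.sum_congr rfl fun k hk => ?_
  have hk' := Finset.mem_range.1 hk
  rw [h k hk'.le, h (k + 1) hk']

variable [Fintype ι]

/-- Summing over the paths amounts to taking matrix powers. -/
lemma sum_pathWeight_mul [DecidableEq ι] (p : ι → ℝ) (A : Matrix ι ι ℝ) (n : ℕ) (g : ι → ℝ) :
    ∑ y : Fin (n + 1) → ι, pathWeight p A n (extendPath y) * g (y (Fin.last n)) =
      p ⬝ᵥ ((A ^ n) *ᵥ g) := by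
  simp only [pathWeight_extendPath]
  induction n generalizing p with
  | zero =>
    rw [← (Equiv.funUnique (Fin 1) ι).symm.sum_comp]
    simp [dotProduct]
  | succ n ih =>
    rw [← (Fin.consEquiv (fun _ => ι)).sum_comp, Fintype.sum_prod_type, Finset.sum_comm, pow_succ',
      ← Matrix.mulVec_mulVec, Matrix.dotProduct_mulVec, ← ih]
    refine Finset.sum_congr rfl fun y _ => ?_
    simp only [Fin.prod_univ_succ, Fin.consEquiv_apply, Matrix.vecMul, dotProduct, Finset.sum_mul]
    refine Finset.sum_congr rfl fun i _ => ?_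
    rw [← Fin.succ_last]
    simp only [Fin.castSucc_zero, Fin.cons_zero, Fin.cons_succ, ← Fin.succ_castSucc]
    ring

lemma pow_mulVec_of_eigen [DecidableEq ι] {A : Matrix ι ι ℝ} {ρ : ℝ} {g : ι → ℝ}
    (h : A *ᵥ g = ρ • g) (n : ℕ) : (A ^ n) *ᵥ g = ρ ^ n • g := by
  induction n with
  | zero => simp
  | succ n ih => rw [pow_succ, ← Matrix.mulVec_mulVec, h, Matrix.mulVec_smul, ih, smul_smul,
      pow_succ']

lemma sum_pathWeight [DecidableEq ι] {p : ι → ℝ} {A : Matrix ι ι ℝ} (hp1 : ∑ i, p i = 1)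
    (hrow : ∀ i, ∑ j, A i j = 1) (n : ℕ) :
    ∑ y : Fin (n + 1) → ι, pathWeight p A n (extendPath y) = 1 := by
  have h := sum_pathWeight_mul p A n 1
  rw [pow_mulVec_of_eigen (ρ := 1) (by ext i; simp [Matrix.mulVec, dotProduct, hrow])] at h
  simpa [dotProduct, hp1] using h

lemma sum_pathWeight_le [DecidableEq ι] {p : ι → ℝ} {A : Matrix ι ι ℝ} (hp : ∀ i, 0 ≤ p i)
    (hp1 : ∑ i, p i = 1) (hA : ∀ i j, 0 ≤ A i j) (hrow : ∀ i, ∑ j, A i j ≤ 1) (n : ℕ) :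
    ∑ y : Fin (n + 1) → ι, pathWeight p A n (extendPath y) ≤ 1 := by
  have h := sum_pathWeight_mul p A n 1
  have hle : ∀ i, ((A ^ n) *ᵥ (1 : ι → ℝ)) i ≤ 1 := by
    induction n with
    | zero => simp
    | succ n ih =>
      intro i
      rw [pow_succ', ← Matrix.mulVec_mulVec]
      refine le_trans ?_ (hrow i)
      exact Finset.sum_le_sum fun j _ => mul_le_of_le_one_right (hA i j)
        (ih (sum_pathWeight_mul p A n 1) j)
  simp only [Pi.one_apply, mul_one] at h
  rw [h, ← hp1]
  exact Finset.sum_le_sum fun i _ => mul_le_of_le_one_right (hp i) (hle i)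

variable [DecidableEq ι]

/-- Change of measure: the likelihood ratio of two chains is a function of the step counts. -/
lemma pathWeight_mul_exp (p : ι → ℝ) {A B : Matrix ι ι ℝ} {n : ℕ} {x : ℕ → ι}
    (hA : ∀ k < n, 0 < A (x k) (x (k + 1))) (hB : ∀ k < n, 0 < B (x k) (x (k + 1))) :
    pathWeight p A n x = pathWeight p B n x *
      Real.exp (-∑ i, ∑ j, stepCount n x i j * (Real.log (B i j) - Real.log (A i j))) := by
  rw [sum_stepCount_mul, ← Finset.sum_neg_distrib, Real.exp_sum, pathWeight, pathWeight, mul_assoc,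
    ← Finset.prod_mul_distrib]
  congr 1
  refine Finset.prod_congr rfl fun k hk => ?_
  have ha := hA k (Finset.mem_range.1 hk)
  have hb := hB k (Finset.mem_range.1 hk)
  rw [neg_sub, Real.exp_sub, Real.exp_log ha, Real.exp_log hb, mul_div_cancel₀ _ hb.ne']

/-- A path is most likely for the chain whose transition matrix is the empirical one. -/
lemma pathWeight_eq_rowNorm {p : ι → ℝ} {A : Matrix ι ι ℝ} (hA : ∀ i j, 0 ≤ A i j) {n : ℕ}
    {x : ℕ → ι} (h : pathWeight p A n x ≠ 0) :
    pathWeight p A n x = pathWeight p (rowNorm (stepCount n x)) n x *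
      Real.exp (-flowEntropy A (stepCount n x)) := by
  rw [flowEntropy_eq_rowNorm A (stepCount_nonneg n x)]
  refine pathWeight_mul_exp p (fun k hk => pos_of_pathWeight_ne_zero hA h hk) fun k hk => ?_
  rw [rowNorm_pos_iff (stepCount_nonneg n x), stepCount_pos_iff]
  exact ⟨k, hk, rfl, rfl⟩

/-- There are only polynomially many step counts. -/
lemma sum_pathWeight_rowNorm_le {p : ι → ℝ} (hp : ∀ i, 0 ≤ p i) (hp1 : ∑ i, p i = 1) (n : ℕ) :
    ∑ y : Fin (n + 1) → ι, pathWeight p (rowNorm (stepCount n (extendPath y))) n (extendPath y) ≤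
      ((n : ℝ) + 1) ^ (Fintype.card ι * Fintype.card ι) := by
  let C : (ι → ι → Fin (n + 1)) → Matrix ι ι ℝ := fun a => Matrix.of fun i j => ((a i j : ℕ) : ℝ)
  have hC : ∀ a i j, 0 ≤ C a i j := fun a i j => Nat.cast_nonneg _
  have hcount : ∀ x : ℕ → ι, ∃ a, C a = stepCount n x := by
    intro x
    refine ⟨fun i j => ⟨∑ k ∈ Finset.range n, if x k = i ∧ x (k + 1) = j then 1 else 0, ?_⟩, ?_⟩
    · rw [Nat.lt_succ_iff, ← Finset.card_filter]
      simpa using Finset.card_filter_le (Finset.range n) fun k => x k = i ∧ x (k + 1) = j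
    · ext i j
      simp [C, stepCount]
  calc ∑ y : Fin (n + 1) → ι, pathWeight p (rowNorm (stepCount n (extendPath y))) n (extendPath y)
      ≤ ∑ y : Fin (n + 1) → ι, ∑ a, pathWeight p (rowNorm (C a)) n (extendPath y) := by
        refine Finset.sum_le_sum fun y _ => ?_
        obtain ⟨a, ha⟩ := hcount (extendPath y)
        rw [← ha]
        exact Finset.single_le_sum
          (f := fun a => pathWeight p (rowNorm (C a)) n (extendPath y))
          (fun a _ => pathWeight_nonneg hp (rowNorm_nonneg (hC a)) n _) (Finset.mem_univ a)
    _ ≤ ∑ _a : ι → ι → Fin (n + 1), (1 : ℝ) := by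
        rw [Finset.sum_comm]
        exact Finset.sum_le_sum fun a _ => sum_pathWeight_le hp hp1 (rowNorm_nonneg (hC a))
          (fun i => sum_rowNorm_le_one i) n
    _ = ((n : ℝ) + 1) ^ (Fintype.card ι * Fintype.card ι) := by
        simp [pow_mul]

/-- If every flow of entropy at most `c` has a neighbourhood free of `S`, then long paths whose
empirical flow lies in `S` have entropy above `c`: limits of empirical flows are balanced. -/
lemma eventually_lt_flowEntropy_stepCount (Q : Matrix ι ι ℝ) {S : Set (Matrix ι ι ℝ)} {c : ℝ}
    (hS : ∀ ν, IsFlow Q ν → flowEntropy Q ν ≤ c →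
      ∀ᶠ N in 𝓝 ν, (∀ i j, 0 ≤ N i j) → (∀ i j, 0 < N i j → 0 < Q i j) → N ∉ S) :
    ∀ᶠ n : ℕ in atTop, ∀ x : ℕ → ι, (∀ i j, 0 < stepCount n x i j → 0 < Q i j) →
      (n : ℝ)⁻¹ • stepCount n x ∈ S → c < flowEntropy Q ((n : ℝ)⁻¹ • stepCount n x) := by
  by_contra hcon
  have hfreq := (not_eventually.1 hcon).and_eventually (eventually_gt_atTop 0)
  obtain ⟨a, ha, hax⟩ := extraction_of_frequently_atTop hfreq
  have hx : ∀ n, ∃ x : ℕ → ι, (∀ i j, 0 < stepCount (a n) x i j → 0 < Q i j) ∧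
      ((a n : ℕ) : ℝ)⁻¹ • stepCount (a n) x ∈ S ∧
      flowEntropy Q (((a n : ℕ) : ℝ)⁻¹ • stepCount (a n) x) ≤ c := fun n => by
    have h := (hax n).1
    push Not at h
    exact h
  choose x hxQ hxS hxc using hx
  have hapos : ∀ n, (0 : ℝ) < a n := fun n => Nat.cast_pos.2 (hax n).2
  let N : ℕ → Matrix ι ι ℝ := fun n => ((a n : ℕ) : ℝ)⁻¹ • stepCount (a n) (x n)
  have hNapp : ∀ n i j, N n i j = ((a n : ℕ) : ℝ)⁻¹ * stepCount (a n) (x n) i j :=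
    fun n i j => rfl
  have hN0 : ∀ n i j, 0 ≤ N n i j := fun n i j =>
    mul_nonneg (inv_nonneg.2 (hapos n).le) (stepCount_nonneg _ _ _ _)
  have hNQ : ∀ n i j, 0 < N n i j → 0 < Q i j := fun n i j h =>
    hxQ n i j (pos_of_mul_pos_right h (inv_nonneg.2 (hapos n).le))
  have hNK : ∀ n, N n ∈ {F : Matrix ι ι ℝ | (∀ i j, 0 ≤ F i j) ∧
      (∀ i j, 0 < F i j → 0 < Q i j) ∧ ∑ i, ∑ j, F i j = 1} := fun n => by
    refine ⟨hN0 n, hNQ n, ?_⟩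
    simp only [hNapp, ← Finset.mul_sum, sum_stepCount]
    exact inv_mul_cancel₀ (hapos n).ne'
  have : FirstCountableTopology (Matrix ι ι ℝ) :=
    inferInstanceAs (FirstCountableTopology (ι → ι → ℝ))
  obtain ⟨ν, hνK, b, hb, hlim⟩ := (isCompact_setOf_edgeLaw Q).tendsto_subseq hNK
  have hbal : ∀ i, ∑ j, ν i j = ∑ j, ν j i := by
    intro i
    have h1 : Tendsto (fun n => ∑ j, N (b n) j i - ∑ j, N (b n) i j) atTop
        (𝓝 (∑ j, ν j i - ∑ j, ν i j)) := by
      have hc : Continuous fun F : Matrix ι ι ℝ => ∑ j, F j i - ∑ j, F i j :=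
        (continuous_finsetSum _ fun j _ => continuous_id.matrix_elem j i).sub
          (continuous_finsetSum _ fun j _ => continuous_id.matrix_elem i j)
      exact (hc.tendsto ν).comp hlim
    have h2 : Tendsto (fun n => ∑ j, N (b n) j i - ∑ j, N (b n) i j) atTop (𝓝 0) := by
      have h3 : Tendsto (fun n : ℕ => ((a (b n) : ℕ) : ℝ)⁻¹) atTop (𝓝 0) :=
        (tendsto_inv_atTop_nhds_zero_nat (𝕜 := ℝ)).comp (ha.comp hb).tendsto_atTop
      refine squeeze_zero_norm (fun n => ?_) h3
      simp only [hNapp, ← Finset.mul_sum, ← mul_sub, sum_stepCount_col_sub_row, norm_mul]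
      rw [Real.norm_of_nonneg (inv_nonneg.2 (hapos _).le)]
      refine mul_le_of_le_one_right (inv_nonneg.2 (hapos _).le) ?_
      split_ifs <;> simp
    linarith [tendsto_nhds_unique h1 h2]
  have hνc : flowEntropy Q ν ≤ c :=
    le_of_tendsto (((continuous_flowEntropy Q).tendsto ν).comp hlim)
      (Eventually.of_forall fun n => hxc (b n))
  obtain ⟨n, hn⟩ := (hlim.eventually (hS ν ⟨hνK.1, hνK.2.1, hνK.2.2, hbal⟩ hνc)).exists
  exact hn (hN0 _) (hNQ _) (hxS _)

open Classical in
/-- The probability that the empirical flow of the first `n` steps of the chain with initial law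
`p` and transition matrix `A` lies in `S`. -/
noncomputable def flowMass (p : ι → ℝ) (A : Matrix ι ι ℝ) (n : ℕ) (S : Set (Matrix ι ι ℝ)) : ℝ :=
  ∑ y : Fin (n + 1) → ι with (n : ℝ)⁻¹ • stepCount n (extendPath y) ∈ S,
    pathWeight p A n (extendPath y)

lemma flowMass_mono {p : ι → ℝ} {A : Matrix ι ι ℝ} (hp : ∀ i, 0 ≤ p i) (hA : ∀ i j, 0 ≤ A i j)
    (n : ℕ) {S T : Set (Matrix ι ι ℝ)} (hST : S ⊆ T) : flowMass p A n S ≤ flowMass p A n T := by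
  refine Finset.sum_le_sum_of_subset_of_nonneg (fun y hy => ?_)
    fun y _ _ => pathWeight_nonneg hp hA _ _
  simp only [Finset.mem_filter] at hy ⊢
  exact ⟨hy.1, hST hy.2⟩

lemma flowMass_add_compl {p : ι → ℝ} {A : Matrix ι ι ℝ} (hp1 : ∑ i, p i = 1)
    (hrow : ∀ i, ∑ j, A i j = 1) (n : ℕ) (S : Set (Matrix ι ι ℝ)) :
    flowMass p A n S + flowMass p A n Sᶜ = 1 := by
  classical
  rw [← sum_pathWeight hp1 hrow n, ← Finset.sum_filter_add_sum_filter_not Finset.univ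
    (fun y : Fin (n + 1) → ι => (n : ℝ)⁻¹ • stepCount n (extendPath y) ∈ S)]
  simp only [flowMass, Set.mem_compl_iff]

/-- The large deviation upper bound for empirical flows. -/
lemma eventually_flowMass_le {Q : Matrix ι ι ℝ} (hQ : ∀ i j, 0 ≤ Q i j) {p : ι → ℝ}
    (hp : ∀ i, 0 ≤ p i) (hp1 : ∑ i, p i = 1) {S : Set (Matrix ι ι ℝ)} {c : ℝ}
    (hS : ∀ ν, IsFlow Q ν → flowEntropy Q ν ≤ c →
      ∀ᶠ N in 𝓝 ν, (∀ i j, 0 ≤ N i j) → (∀ i j, 0 < N i j → 0 < Q i j) → N ∉ S) :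
    ∀ᶠ n : ℕ in atTop,
      flowMass p Q n S ≤
      ((n : ℝ) + 1) ^ (Fintype.card ι * Fintype.card ι) * Real.exp (-(c * n)) := by
  classical
  filter_upwards [eventually_lt_flowEntropy_stepCount Q hS, eventually_gt_atTop 0] with n hn hn0
  have hn0' : (0 : ℝ) < n := Nat.cast_pos.2 hn0
  have hR : ∀ y : Fin (n + 1) → ι,
      0 ≤ pathWeight p (rowNorm (stepCount n (extendPath y))) n (extendPath y) := fun y =>
    pathWeight_nonneg hp (rowNorm_nonneg (stepCount_nonneg _ _)) _ _
  calc flowMass p Q n S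
      ≤ ∑ y : Fin (n + 1) → ι with (n : ℝ)⁻¹ • stepCount n (extendPath y) ∈ S,
        pathWeight p (rowNorm (stepCount n (extendPath y))) n (extendPath y) *
          Real.exp (-(c * n)) := by
        refine Finset.sum_le_sum fun y hy => ?_
        simp only [Finset.mem_filter] at hy
        have hyS := hy.2
        by_cases h0 : pathWeight p Q n (extendPath y) = 0
        · rw [h0]
          exact mul_nonneg (hR y) (Real.exp_pos _).le
        · rw [pathWeight_eq_rowNorm hQ h0]
          refine mul_le_mul_of_nonneg_left (Real.exp_le_exp.2 (neg_le_neg ?_)) (hR y)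
          have h1 := hn (extendPath y) (supp_of_pathWeight_ne_zero hQ h0) hyS
          rw [flowEntropy_smul Q (stepCount_nonneg _ _) (inv_pos.2 hn0'), inv_mul_eq_div,
            lt_div_iff₀ hn0'] at h1
          exact h1.le
    _ ≤ (∑ y : Fin (n + 1) → ι,
        pathWeight p (rowNorm (stepCount n (extendPath y))) n (extendPath y)) *
          Real.exp (-(c * n)) := by
        rw [← Finset.sum_mul]
        exact mul_le_mul_of_nonneg_right (Finset.sum_le_sum_of_subset_of_nonneg
          (Finset.filter_subset _ _) fun y _ _ => hR y) (Real.exp_pos _).le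
    _ ≤ _ := mul_le_mul_of_nonneg_right (sum_pathWeight_rowNorm_le hp hp1 n) (Real.exp_pos _).le

lemma tendsto_pow_mul_exp_neg (d : ℕ) {c : ℝ} (hc : 0 < c) :
    Tendsto (fun n : ℕ => ((n : ℝ) + 1) ^ d * Real.exp (-(c * n))) atTop (𝓝 0) := by
  have hr : |Real.exp (-c)| < 1 := by
    rw [abs_of_pos (Real.exp_pos _), Real.exp_lt_one_iff]
    linarith
  have h1 := ((tendsto_pow_const_mul_const_pow_of_abs_lt_one d hr).comp
    (tendsto_add_atTop_nat 1)).const_mul (Real.exp c)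
  rw [mul_zero] at h1
  refine h1.congr fun n => ?_
  have h2 : Real.exp (-(c * n)) = Real.exp c * Real.exp (-c) ^ (n + 1) := by
    rw [← Real.exp_nat_mul, ← Real.exp_add]
    congr 1
    push_cast
    ring
  simp only [Function.comp_apply]
  rw [h2]
  push_cast
  ring

/-- The law of large numbers for the empirical flow of an irreducible chain. -/
lemma eventually_half_le_flowMass {A : Matrix ι ι ℝ} (hA : ∀ i j, 0 ≤ A i j)
    (hrow : ∀ i, ∑ j, A i j = 1) (hirr : ∀ i j, Reach A i j) {q : ι → ℝ} (hq : ∀ i, 0 ≤ q i)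
    (hq1 : ∑ i, q i = 1) (hstat : ∀ j, ∑ i, q i * A i j = q j) {p : ι → ℝ}
    (hp : ∀ i, 0 ≤ p i) (hp1 : ∑ i, p i = 1) {U : Set (Matrix ι ι ℝ)}
    (hU : U ∈ 𝓝 (chainFlow q A)) :
    ∀ᶠ n : ℕ in atTop, 1 / 2 ≤
      flowMass p A n U := by
  obtain ⟨c, hc, hcU⟩ := exists_flowEntropy_le_mem hA hrow hirr hq hq1 hstat
    (interior_mem_nhds.2 hU)
  have hub := eventually_flowMass_le hA hp hp1 (S := Uᶜ) (c := c) fun ν hν hνc => by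
    filter_upwards [isOpen_interior.mem_nhds (hcU ν hν hνc)] with N hN _ _ hN'
    exact hN' (interior_subset hN)
  filter_upwards [hub, (tendsto_pow_mul_exp_neg (Fintype.card ι * Fintype.card ι) hc).eventually
    (gt_mem_nhds (show (0 : ℝ) < 1 / 2 by norm_num))] with n hn hn'
  linarith [flowMass_add_compl hp1 hrow n U]

/-- The large deviation lower bound for empirical flows, by a change of measure to the chain that
has `F` as its stationary flow. -/
lemma eventually_le_flowMass {Q : Matrix ι ι ℝ} (hQ : ∀ i j, 0 ≤ Q i j)
    (hrow : ∀ i, ∃ j, 0 < Q i j) (hirr : ∀ i j, Reach Q i j) {F : Matrix ι ι ℝ}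
    (hF : IsFlow Q F) (hfull : ∀ i j, 0 < Q i j → 0 < F i j) {p : ι → ℝ} (hp : ∀ i, 0 ≤ p i)
    (hp1 : ∑ i, p i = 1) {U : Set (Matrix ι ι ℝ)} (hU : U ∈ 𝓝 F) {η : ℝ} (hη : 0 < η) :
    ∀ᶠ n : ℕ in atTop, Real.exp (-((flowEntropy Q F + η) * n)) ≤
      flowMass p Q n U := by
  set A := rowNorm F with hAdef
  have hA : ∀ i j, 0 ≤ A i j := rowNorm_nonneg hF.nonneg
  have hFrow : ∀ i, 0 < ∑ k, F i k := fun i => by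
    obtain ⟨j, hj⟩ := hrow i
    exact (hfull i j hj).trans_le (le_row_sum hF.nonneg i j)
  have hArow : ∀ i, ∑ j, A i j = 1 := fun i => by
    simp only [hAdef, rowNorm_apply, ← Finset.sum_div]
    exact div_self (hFrow i).ne'
  have hAirr : ∀ i j, Reach A i j := fun i j => by
    rw [hAdef, reach_rowNorm hF.nonneg]
    exact Relation.ReflTransGen.mono hfull _ _ (hirr i j)
  have hAF : ∀ i j, (∑ k, F i k) * A i j = F i j := fun i j => by
    rw [mul_comm]
    exact rowNorm_mul_sum hF.nonneg i j
  have hFchain : chainFlow (fun i => ∑ k, F i k) A = F := by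
    ext i j
    exact hAF i j
  let L : Matrix ι ι ℝ → ℝ := fun N =>
    ∑ i, ∑ j, N i j * (Real.log (A i j) - Real.log (Q i j))
  have hL : Continuous L := continuous_finsetSum _ fun i _ => continuous_finsetSum _ fun j _ =>
    (continuous_id.matrix_elem i j).mul continuous_const
  have hLF : L F < flowEntropy Q F + η / 2 := by
    rw [flowEntropy_eq_rowNorm Q hF.nonneg]
    change L F < L F + η / 2
    linarith
  have hU' : U ∩ {N | L N < flowEntropy Q F + η / 2} ∈
      𝓝 (chainFlow (fun i => ∑ k, F i k) A) := by
    rw [hFchain]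
    exact inter_mem hU (hL.continuousAt.eventually (gt_mem_nhds hLF))
  have hlln := eventually_half_le_flowMass hA hArow hAirr
    (fun i => (hFrow i).le) hF.total (fun j => by simp only [hAF, ← hF.balanced]) hp hp1 hU'
  have hexp : ∀ᶠ n : ℕ in atTop, Real.exp (-(η / 2 * n)) ≤ 1 / 2 := by
    have h1 := (tendsto_pow_mul_exp_neg 0 (half_pos hη)).eventually
      (gt_mem_nhds (show (0 : ℝ) < 1 / 2 by norm_num))
    filter_upwards [h1] with n hn
    simpa using hn.le
  filter_upwards [hlln, hexp, eventually_gt_atTop 0] with n hn hn' hn0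
  have hn0' : (0 : ℝ) < n := Nat.cast_pos.2 hn0
  set I := flowEntropy Q F with hI
  calc Real.exp (-((I + η) * n))
      = Real.exp (-(η / 2 * n)) * Real.exp (-((I + η / 2) * n)) := by
        rw [← Real.exp_add]
        congr 1
        ring
    _ ≤ flowMass p A n (U ∩ {N | L N < I + η / 2}) *
          Real.exp (-((I + η / 2) * n)) :=
        mul_le_mul_of_nonneg_right (hn'.trans hn) (Real.exp_pos _).le
    _ ≤ flowMass p Q n (U ∩ {N | L N < I + η / 2}) := by
        rw [flowMass, Finset.sum_mul]
        refine Finset.sum_le_sum fun y hy => ?_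
        simp only [Finset.mem_filter] at hy
        have hyL : L ((n : ℝ)⁻¹ • stepCount n (extendPath y)) < I + η / 2 := hy.2.2
        by_cases h0 : pathWeight p A n (extendPath y) = 0
        · rw [h0, zero_mul]
          exact pathWeight_nonneg hp hQ _ _
        · have hApos := fun k (hk : k < n) => pos_of_pathWeight_ne_zero hA h0 hk
          have hQpos := fun k (hk : k < n) =>
            hF.supp _ _ ((rowNorm_pos_iff hF.nonneg _ _).1 (hApos k hk))
          rw [pathWeight_mul_exp p hQpos hApos]
          refine mul_le_mul_of_nonneg_left (Real.exp_le_exp.2 (neg_le_neg ?_))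
            (pathWeight_nonneg hp hA _ _)
          have h2 : L ((n : ℝ)⁻¹ • stepCount n (extendPath y)) =
              (n : ℝ)⁻¹ * ∑ i, ∑ j, stepCount n (extendPath y) i j *
                (Real.log (A i j) - Real.log (Q i j)) := by
            simp only [L, Matrix.smul_apply, smul_eq_mul, mul_assoc, Finset.mul_sum]
          rw [h2, inv_mul_eq_div, div_lt_iff₀ hn0'] at hyL
          exact hyL.le
    _ ≤ _ := flowMass_mono hp hQ n Set.inter_subset_left

end Paths

/-! ### The Markov chain and its empirical flow -/

section Chain

variable {M : ℕ} {Ω : Type*} [MeasurableSpace Ω] {P : Measure Ω}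
  {Q : Matrix (Fin M) (Fin M) ℝ} {X : ℕ → Ω → Fin M}

/-- The law of the initial state. -/
noncomputable def initialLaw (P : Measure Ω) (X : ℕ → Ω → Fin M) (i : Fin M) : ℝ :=
  P.real {ω | X 0 ω = i}

lemma initialLaw_nonneg (i : Fin M) : 0 ≤ initialLaw P X i := measureReal_nonneg

lemma IsMarkovChain.measureReal_path (hX : IsMarkovChain P Q X) (n : ℕ) (x : ℕ → Fin M) :
    P.real {ω | ∀ k ≤ n, X k ω = x k} = pathWeight (initialLaw P X) Q n x := by
  induction n with
  | zero => simp [pathWeight, initialLaw]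
  | succ n ih =>
    have hQ : 0 ≤ Q (x n) (x (n + 1)) := Matrix.nonneg_of_mem_rowStochastic hX.stochastic
    rw [measureReal_def, hX.markov, ENNReal.toReal_mul, ENNReal.toReal_ofReal hQ,
      ← measureReal_def, ih, pathWeight, pathWeight, Finset.prod_range_succ, mul_assoc]

lemma IsMarkovChain.integral_path [IsProbabilityMeasure P] (hX : IsMarkovChain P Q X)
    (n : ℕ) (g : (Fin (n + 1) → Fin M) → ℝ) :
    ∫ ω, g (fun k => X k ω) ∂P =
      ∑ y, pathWeight (initialLaw P X) Q n (extendPath y) * g y := by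
  have hY : Measurable fun ω => fun k : Fin (n + 1) => X k ω :=
    measurable_pi_lambda _ fun k => hX.measurable k
  have : IsProbabilityMeasure (P.map fun ω => fun k : Fin (n + 1) => X k ω) :=
    Measure.isProbabilityMeasure_map hY.aemeasurable
  rw [← integral_map (φ := fun ω => fun k : Fin (n + 1) => X k ω) hY.aemeasurable
    (Measurable.of_discrete (f := g)).aestronglyMeasurable, integral_fintype Integrable.of_finite]
  refine Finset.sum_congr rfl fun y _ => ?_
  rw [map_measureReal_apply hY (measurableSet_singleton y), ← hX.measureReal_path, smul_eq_mul]
  congr 2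
  ext ω
  simp only [Set.mem_preimage, Set.mem_singleton_iff, Set.mem_ofPred_eq, funext_iff]
  exact ⟨fun h k hk => by rw [extendPath_of_le y hk]; exact h ⟨k, Nat.lt_succ_of_le hk⟩,
    fun h k => by
      have hk := Nat.le_of_lt_succ k.2
      rw [h k hk, extendPath_of_le y hk]⟩

lemma IsMarkovChain.sum_initialLaw [IsProbabilityMeasure P] (hX : IsMarkovChain P Q X) :
    ∑ i, initialLaw P X i = 1 := by
  have h1 := hX.integral_path 0 fun _ => 1
  have h2 := sum_pathWeight_mul (initialLaw P X) Q 0 1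
  simp only [integral_const, probReal_univ, smul_eq_mul, mul_one] at h1
  simp only [Pi.one_apply, mul_one, pow_zero, Matrix.one_mulVec, dotProduct] at h2
  rw [← h2, ← h1]

/-- The empirical flow of the chain. -/
noncomputable def empiricalFlow {Ω : Type*} (X : ℕ → Ω → Fin M) (n : ℕ) (ω : Ω) :
    Matrix (Fin M) (Fin M) ℝ :=
  (n : ℝ)⁻¹ • stepCount n fun k => X k ω

lemma empiricalFlow_nonneg {Ω : Type*} (X : ℕ → Ω → Fin M) (n : ℕ) (ω : Ω) (i j : Fin M) :
    0 ≤ empiricalFlow X n ω i j :=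
  mul_nonneg (inv_nonneg.2 n.cast_nonneg) (stepCount_nonneg _ _ _ _)

lemma IsMarkovChain.measureReal_empiricalFlow [IsProbabilityMeasure P]
    (hX : IsMarkovChain P Q X) (n : ℕ) (S : Set (Matrix (Fin M) (Fin M) ℝ)) :
    P.real {ω | empiricalFlow X n ω ∈ S} = flowMass (initialLaw P X) Q n S := by
  classical
  have hY : Measurable fun ω => fun k : Fin (n + 1) => X k ω :=
    measurable_pi_lambda _ fun k => hX.measurable k
  let T : Set (Fin (n + 1) → Fin M) := {y | (n : ℝ)⁻¹ • stepCount n (extendPath y) ∈ S}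
  have hT : {ω | empiricalFlow X n ω ∈ S} = (fun ω => fun k : Fin (n + 1) => X k ω) ⁻¹' T := by
    ext ω
    simp only [Set.mem_ofPred_eq, Set.mem_preimage, T, empiricalFlow]
    rw [stepCount_congr fun k hk => (extendPath_of_le (fun k : Fin (n + 1) => X k ω) hk).symm]
  have h := hX.integral_path n (T.indicator 1)
  have h1 : ∫ ω, T.indicator (1 : (Fin (n + 1) → Fin M) → ℝ) (fun k : Fin (n + 1) => X k ω) ∂P =
      P.real {ω | empiricalFlow X n ω ∈ S} := by
    rw [hT, ← integral_indicator_one (hY (MeasurableSet.of_discrete (s := T)))]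
    rfl
  rw [← h1, h, flowMass, Finset.sum_filter]
  refine Finset.sum_congr rfl fun y _ => ?_
  simp only [Set.indicator_apply, T, Set.mem_ofPred_eq, Pi.one_apply, mul_ite, mul_one, mul_zero]

lemma sum_Icc_one_eq (n : ℕ) (g : ℕ → ℝ) :
    ∑ k ∈ Finset.Icc 1 n, g k = ∑ k ∈ Finset.range n, g (k + 1) := by
  have : Finset.Icc 1 n = Finset.Ico 1 (n + 1) := by
    ext k
    simp
  rw [this, Finset.sum_Ico_eq_sum_range]
  simp [add_comm]

lemma empiricalTransition_eq (n : ℕ) (x : ℕ → Fin M) :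
    empiricalTransition n x = rowNorm (stepCount n x) := by
  ext i j
  rw [rowNorm_apply, sum_stepCount_row]
  simp only [empiricalTransition, stepCount, Matrix.of_apply, sum_Icc_one_eq, Nat.add_sub_cancel]

lemma loynesEstimate_eq (f : Fin M → ℝ) (n : ℕ) (x : ℕ → Fin M) :
    loynesEstimate f n x = exponent f (rowNorm (stepCount n x)) := by
  rw [loynesEstimate, empiricalTransition_eq]
  rfl

lemma loynesEstimate_eq_empiricalFlow {Ω : Type*} {X : ℕ → Ω → Fin M} (f : Fin M → ℝ) {n : ℕ}
    (hn : 0 < n) (ω : Ω) :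
    loynesEstimate f n (fun k => X k ω) = exponent f (rowNorm (empiricalFlow X n ω)) := by
  rw [loynesEstimate_eq, empiricalFlow, rowNorm_smul (by positivity)]

lemma IsMarkovChain.measurable_loynesEstimate (hX : IsMarkovChain P Q X) (f : Fin M → ℝ) (n : ℕ) :
    Measurable fun ω => loynesEstimate f n fun k => X k ω := by
  have hY : Measurable fun ω => fun k : Fin (n + 1) => X k ω :=
    measurable_pi_lambda _ fun k => hX.measurable k
  have h : (fun ω => loynesEstimate f n fun k => X k ω) =
      (fun y : Fin (n + 1) → Fin M => loynesEstimate f n (extendPath y)) ∘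
        fun ω => fun k : Fin (n + 1) => X k ω := by
    ext ω
    simp only [Function.comp_apply, loynesEstimate_eq]
    rw [stepCount_congr fun k hk => (extendPath_of_le (fun k : Fin (n + 1) => X k ω) hk).symm]
  rw [h]
  exact Measurable.of_discrete.comp hY

/-- The moment generating function of the partial sums is a product of tilted matrices. -/
lemma IsMarkovChain.integral_exp [IsProbabilityMeasure P] (hX : IsMarkovChain P Q X)
    (f : Fin M → ℝ) (θ : ℝ) (n : ℕ) :
    ∫ ω, Real.exp (θ * ∑ k ∈ Finset.Icc 1 n, f (X k ω)) ∂P =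
      ∑ y : Fin (n + 1) → Fin M,
        pathWeight (initialLaw P X) (tilted Q f θ) n (extendPath y) := by
  have h := hX.integral_path n fun y =>
    Real.exp (θ * ∑ k ∈ Finset.range n, f (extendPath y (k + 1)))
  have h1 : ∀ ω, ∑ k ∈ Finset.Icc 1 n, f (X k ω) =
      ∑ k ∈ Finset.range n, f (extendPath (fun k : Fin (n + 1) => X k ω) (k + 1)) := fun ω => by
    rw [sum_Icc_one_eq]
    exact Finset.sum_congr rfl fun k hk => by
      rw [extendPath_of_le _ (Finset.mem_range.1 hk)]
  simp only [h1]
  rw [h]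
  refine Finset.sum_congr rfl fun y _ => ?_
  rw [Finset.mul_sum, Real.exp_sum, pathWeight, pathWeight, mul_assoc, ← Finset.prod_mul_distrib]
  simp only [tilted_entry]

/-- The exponential growth rate of a positive sequence that is comparable to `ρ ^ n`. -/
lemma tendsto_inv_mul_log {ρ a b : ℝ} (hρ : 0 < ρ) (ha : 0 < a) {s : ℕ → ℝ}
    (hs : ∀ n, a * ρ ^ n ≤ s n ∧ s n ≤ b * ρ ^ n) :
    Tendsto (fun n : ℕ => (n : ℝ)⁻¹ * Real.log (s n)) atTop (𝓝 (Real.log ρ)) := by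
  have hb : 0 < b := by
    have := (hs 0).1.trans (hs 0).2
    simp only [pow_zero, mul_one] at this
    exact ha.trans_le this
  have hlim : ∀ c : ℝ, Tendsto (fun n : ℕ => (n : ℝ)⁻¹ * Real.log c + Real.log ρ) atTop
      (𝓝 (Real.log ρ)) := fun c => by
    simpa using ((tendsto_inv_atTop_nhds_zero_nat (𝕜 := ℝ)).mul_const (Real.log c)).add_const
      (Real.log ρ)
  have hlog : ∀ c : ℝ, 0 < c → ∀ n : ℕ, 0 < n →
      (n : ℝ)⁻¹ * Real.log (c * ρ ^ n) = (n : ℝ)⁻¹ * Real.log c + Real.log ρ := by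
    intro c hc n hn
    have hn' : (n : ℝ) ≠ 0 := by positivity
    rw [Real.log_mul hc.ne' (pow_pos hρ n).ne', Real.log_pow]
    field_simp
  refine tendsto_of_tendsto_of_tendsto_of_le_of_le' (hlim a) (hlim b) ?_ ?_
  · filter_upwards [eventually_gt_atTop 0] with n hn
    rw [← hlog a ha n hn]
    exact mul_le_mul_of_nonneg_left (Real.log_le_log (by positivity) (hs n).1) (by positivity)
  · filter_upwards [eventually_gt_atTop 0] with n hn
    rw [← hlog b hb n hn]
    exact mul_le_mul_of_nonneg_left (Real.log_le_log
      ((mul_pos ha (pow_pos hρ n)).trans_le (hs n).1) (hs n).2) (by positivity)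

/-- The scaled cumulant generating function is the logarithm of the Perron root of `Q D_θ`. -/
lemma IsMarkovChain.exists_scaledCGF [IsProbabilityMeasure P] (hX : IsMarkovChain P Q X)
    (hirr : ∀ i j, Reach Q i j) (f : Fin M → ℝ) :
    ∃ lam, IsScaledCGF P (fun n ω => f (X n ω)) lam ∧ loynesExponent lam = exponent f Q := by
  obtain ⟨hQ, hrow⟩ := Matrix.mem_rowStochastic_iff_sum.1 hX.stochastic
  have hp : ∀ i, 0 ≤ initialLaw P X i := initialLaw_nonneg
  have hp1 := hX.sum_initialLaw
  have hne : Nonempty (Fin M) := (exists_pos_of_sum_eq_one hp1).nonempty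
  have hedge := fun i => exists_pos_of_sum_eq_one (hrow i)
  have hperron := fun θ => exists_perron (tilted_nonneg (f := f) hQ θ)
    (fun i j => by rw [reach_tilted_iff]; exact hirr i j) fun i => by
      obtain ⟨j, hj⟩ := hedge i
      exact ⟨j, by rw [tilted_entry]; exact mul_pos hj (Real.exp_pos _)⟩
  choose ρ r hρ hr heq using hperron
  refine ⟨fun θ => Real.log (ρ θ), fun θ => ?_, ?_⟩
  · simp only [hX.integral_exp]
    obtain ⟨i₀, hmin⟩ := Finite.exists_min (r θ)
    obtain ⟨i₁, hmax⟩ := Finite.exists_max (r θ)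
    set m := ∑ i, initialLaw P X i * r θ i with hm
    have hm0 : 0 < m := by
      have : r θ i₀ ≤ m := by
        calc r θ i₀ = ∑ i, initialLaw P X i * r θ i₀ := by rw [← Finset.sum_mul, hp1, one_mul]
          _ ≤ m := Finset.sum_le_sum fun i _ => mul_le_mul_of_nonneg_left (hmin i) (hp i)
      exact (hr θ i₀).trans_le this
    have hsum : ∀ n : ℕ, ∑ y : Fin (n + 1) → Fin M,
        pathWeight (initialLaw P X) (tilted Q f θ) n (extendPath y) * r θ (y (Fin.last n)) =
          ρ θ ^ n * m := fun n => by
      rw [sum_pathWeight_mul, pow_mulVec_of_eigen (ρ := ρ θ)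
        (by ext i; simpa [Matrix.mulVec, dotProduct] using heq θ i)]
      simp only [dotProduct, hm, Pi.smul_apply, smul_eq_mul, Finset.mul_sum]
      exact Finset.sum_congr rfl fun i _ => by ring
    have hw := fun (n : ℕ) (y : Fin (n + 1) → Fin M) =>
      pathWeight_nonneg hp (tilted_nonneg (f := f) hQ θ) n (extendPath y)
    refine tendsto_inv_mul_log (a := m / r θ i₁) (b := m / r θ i₀) (hρ θ)
      (div_pos hm0 (hr θ i₁)) fun n => ⟨?_, ?_⟩
    · rw [div_mul_eq_mul_div, div_le_iff₀ (hr θ i₁), mul_comm m, ← hsum n, Finset.sum_mul]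
      exact Finset.sum_le_sum fun y _ => mul_le_mul_of_nonneg_left (hmax _) (hw n y)
    · rw [div_mul_eq_mul_div, le_div_iff₀ (hr θ i₀), mul_comm m, ← hsum n, Finset.sum_mul]
      exact Finset.sum_le_sum fun y _ => mul_le_mul_of_nonneg_left (hmin _) (hw n y)
  · rw [loynesExponent, exponent]
    congr 1
    ext θ
    simp only [Set.mem_ofPred_eq]
    rw [logSpectralRadius_le_zero_iff (tilted_nonneg hQ θ), Real.log_nonpos_iff (hρ θ).le]
    constructor
    · exact fun h τ hτ => ⟨r θ, hr θ, fun i => by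
        rw [heq θ i]
        exact mul_le_mul_of_nonneg_right (h.trans hτ.le) (hr θ i).le⟩
    · intro h
      refine le_of_forall_gt_imp_ge_of_dense fun τ hτ => ?_
      obtain ⟨u, hu⟩ := h τ hτ
      exact perron_le_of_subInv (tilted_nonneg hQ θ) (hr θ) (heq θ) hu

lemma reach_of_isIrreducible (hQ : Q.IsIrreducible) (i j : Fin M) : Reach Q i j := by
  let : Quiver (Fin M) := Q.toQuiver
  obtain ⟨p, -⟩ := hQ.connected i j
  induction p with
  | nil => exact Relation.ReflTransGen.refl
  | cons _ e ih => exact ih.tail e.down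

lemma isDriftChain_of_isMarkovChain (hQ : Q.IsIrreducible) (hX : IsMarkovChain P Q X)
    {f φ : Fin M → ℝ} (hφ : φ ∈ stdSimplex ℝ (Fin M)) (hφQ : φ ᵥ* Q = φ)
    (hdrift : ∑ i, φ i * f i < 0) : IsDriftChain Q f φ where
  nonneg := hQ.nonneg
  row_sum := (Matrix.mem_rowStochastic_iff_sum.1 hX.stochastic).2
  reach := reach_of_isIrreducible hQ
  law_nonneg := hφ.1
  law_sum := hφ.2
  stationary := congrFun hφQ
  drift := hdrift

end Chain

/-! ### The rate function and the large deviation principle -/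

section RateFunction

variable {M : ℕ} {Q : Matrix (Fin M) (Fin M) ℝ} {f φ : Fin M → ℝ}

/-- The rate function of the estimator: the lower semicontinuous envelope of the least entropy of
a full flow with a given exponent. -/
noncomputable def rateFunction (Q : Matrix (Fin M) (Fin M) ℝ) (f : Fin M → ℝ) (x : ℝ≥0∞) : ℝ≥0∞ :=
  ⨆ U ∈ 𝓝 x, ⨅ F : {F // IsFullFlow Q F ∧ exponent f (rowNorm F) ∈ U},
    ENNReal.ofReal (flowEntropy Q F.1)

lemma lt_rateFunction_iff {x c : ℝ≥0∞} : c < rateFunction Q f x ↔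
    ∃ U ∈ 𝓝 x, c < ⨅ F : {F // IsFullFlow Q F ∧ exponent f (rowNorm F) ∈ U},
      ENNReal.ofReal (flowEntropy Q F.1) := by
  simp only [rateFunction, lt_iSup_iff, exists_prop]

lemma isGoodRateFunction_rateFunction (Q : Matrix (Fin M) (Fin M) ℝ) (f : Fin M → ℝ) :
    IsGoodRateFunction (rateFunction Q f) := by
  have hlsc : LowerSemicontinuous (rateFunction Q f) := by
    intro x c hc
    obtain ⟨U, hU, hcU⟩ := lt_rateFunction_iff.1 hc
    filter_upwards [eventually_mem_nhds_iff.2 hU] with y hy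
    exact lt_rateFunction_iff.2 ⟨U, hy, hcU⟩
  exact ⟨hlsc, fun c _ => (hlsc.isClosed_preimage c).isCompact⟩

lemma exists_full_of_rateFunction_lt {x c : ℝ≥0∞} (h : rateFunction Q f x < c) {U : Set ℝ≥0∞}
    (hU : U ∈ 𝓝 x) : ∃ F, IsFullFlow Q F ∧ exponent f (rowNorm F) ∈ U ∧
      ENNReal.ofReal (flowEntropy Q F) < c := by
  have h1 : (⨅ F : {F // IsFullFlow Q F ∧ exponent f (rowNorm F) ∈ U},
      ENNReal.ofReal (flowEntropy Q F.1)) < c :=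
    (le_iSup₂ (f := fun U (_ : U ∈ 𝓝 x) =>
      ⨅ F : {F // IsFullFlow Q F ∧ exponent f (rowNorm F) ∈ U},
        ENNReal.ofReal (flowEntropy Q F.1)) U hU).trans_lt h
  obtain ⟨F, hF⟩ := iInf_lt_iff.1 h1
  exact ⟨F.1, F.2.1, F.2.2, hF⟩

lemma IsDriftChain.rowNorm_chainFlow (h : IsDriftChain Q f φ) : rowNorm (chainFlow φ Q) = Q := by
  ext i j
  have hpos : 0 < φ i :=
    stationary_pos h.nonneg h.law_nonneg h.law_sum h.stationary fun k => h.reach k i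
  rw [rowNorm_apply, sum_chainFlow h.row_sum, chainFlow_apply, mul_div_cancel_left₀ _ hpos.ne']

lemma IsDriftChain.flowEntropy_chainFlow (h : IsDriftChain Q f φ) :
    flowEntropy Q (chainFlow φ Q) = 0 := by
  rw [flowEntropy_eq_rowNorm Q h.isFullFlow.nonneg, h.rowNorm_chainFlow]
  simp

lemma IsDriftChain.eventually_exponent_mem (h : IsDriftChain Q f φ)
    {F : Matrix (Fin M) (Fin M) ℝ} (hF : IsFullFlow Q F) {U : Set ℝ≥0∞}
    (hU : U ∈ 𝓝 (exponent f (rowNorm F))) :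
    ∀ᶠ N in 𝓝 F, (∀ i j, 0 ≤ N i j) → exponent f (rowNorm N) ∈ U :=
  eventually_nhdsWithin_iff.1 (h.tendsto_exponent hF hU)

lemma IsDriftChain.rateFunction_eq_zero_iff (h : IsDriftChain Q f φ) (x : ℝ≥0∞) :
    rateFunction Q f x = 0 ↔ x = exponent f Q := by
  constructor
  · intro hx
    by_contra hne
    obtain ⟨U, V, hU, hV, hxU, hV', hdisj⟩ := t2_separation hne
    have hV'' : V ∈ 𝓝 (exponent f (rowNorm (chainFlow φ Q))) := by
      rw [h.rowNorm_chainFlow]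
      exact hV.mem_nhds hV'
    obtain ⟨c, hc, hcV⟩ := exists_flowEntropy_le_mem h.nonneg h.row_sum h.reach h.law_nonneg
      h.law_sum h.stationary (h.eventually_exponent_mem h.isFullFlow hV'')
    obtain ⟨F, hF, hFU, hFc⟩ := exists_full_of_rateFunction_lt (c := ENNReal.ofReal c)
      (by rw [hx]; exact ENNReal.ofReal_pos.2 hc) (hU.mem_nhds hxU)
    exact Set.disjoint_left.1 hdisj hFU
      (hcV F hF.toIsFlow ((ENNReal.ofReal_lt_ofReal_iff hc).1 hFc).le hF.nonneg)
  · rintro rfl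
    refine le_antisymm (iSup₂_le fun U hU => ?_) bot_le
    have := iInf_le (fun F : {F // IsFullFlow Q F ∧ exponent f (rowNorm F) ∈ U} =>
      ENNReal.ofReal (flowEntropy Q F.1)) ⟨chainFlow φ Q, h.isFullFlow, by
        rw [h.rowNorm_chainFlow]
        exact mem_of_mem_nhds hU⟩
    simpa [h.flowEntropy_chainFlow] using this

/-- Moving a full flow towards the stationary one does not increase the entropy, and the exponent takes
all values between. -/
lemma IsDriftChain.exists_full_of_mem_uIcc (h : IsDriftChain Q f φ)
    {F : Matrix (Fin M) (Fin M) ℝ} (hF : IsFullFlow Q F) {t : ℝ≥0∞}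
    (ht : t ∈ Set.uIcc (exponent f (rowNorm F)) (exponent f Q)) :
    ∃ F', IsFullFlow Q F' ∧ flowEntropy Q F' ≤ flowEntropy Q F ∧ exponent f (rowNorm F') = t := by
  let G : ℝ → Matrix (Fin M) (Fin M) ℝ := fun s => (1 - s) • F + s • chainFlow φ Q
  have hG : ∀ s ∈ Set.uIcc (0 : ℝ) 1, IsFullFlow Q (G s) := by
    intro s hs
    rw [Set.uIcc_of_le zero_le_one] at hs
    refine ⟨hF.toIsFlow.mix h.isFullFlow.toIsFlow hs.1 hs.2, fun i j hij => ?_⟩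
    have h1 := hF.full i j hij
    have h2 := h.isFullFlow.full i j hij
    change 0 < ((1 - s) • F + s • chainFlow φ Q) i j
    rw [mix_entry]
    rcases hs.1.eq_or_lt with rfl | hs0
    · simpa using h1
    · have h3 : 0 ≤ 1 - s := by linarith [hs.2]
      positivity
  have hGc : Continuous G := by fun_prop
  have hcont : ContinuousOn (fun s => exponent f (rowNorm (G s))) (Set.uIcc (0 : ℝ) 1) := by
    intro s hs
    refine (h.tendsto_exponent (hG s hs)).comp (tendsto_nhdsWithin_iff.2
      ⟨hGc.continuousWithinAt, ?_⟩)
    filter_upwards [self_mem_nhdsWithin] with s' hs'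
    exact (hG s' hs').nonneg
  have hG0 : G 0 = F := by simp [G]
  have hG1 : G 1 = chainFlow φ Q := by simp [G]
  obtain ⟨s, hs, rfl⟩ := intermediate_value_uIcc hcont
    (by simpa only [hG0, hG1, h.rowNorm_chainFlow] using ht)
  refine ⟨G s, hG s hs, ?_, rfl⟩
  have hI : 0 ≤ flowEntropy Q F := flowEntropy_nonneg h.nonneg h.row_sum hF.nonneg hF.supp
  rw [Set.uIcc_of_le zero_le_one] at hs
  rcases hs.1.eq_or_lt with rfl | hs0
  · rw [hG0]
  rcases hs.2.eq_or_lt with rfl | hs1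
  · rwa [hG1, h.flowEntropy_chainFlow]
  · have := flowEntropy_mix_le hF.toIsFlow h.isFullFlow.toIsFlow hs0 hs1
    rw [h.flowEntropy_chainFlow, mul_zero, add_zero] at this
    exact this.trans (mul_le_of_le_one_left hI (by linarith))

/-- A flow whose entropy is below the rate function on the closed set `K` has a neighbourhood in
which no exponent lies in `K`, although the exponent is not continuous there. -/
lemma IsDriftChain.eventually_exponent_notMem (h : IsDriftChain Q f φ) {K : Set ℝ≥0∞}
    (hK : IsClosed K) {c : ℝ} (hc : 0 ≤ c) (hKc : ∀ x ∈ K, ENNReal.ofReal c < rateFunction Q f x)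
    {ν : Matrix (Fin M) (Fin M) ℝ} (hν : IsFlow Q ν) (hνc : flowEntropy Q ν < c) :
    ∀ᶠ N in 𝓝 ν, (∀ i j, 0 ≤ N i j) → (∀ i j, 0 < N i j → 0 < Q i j) →
      exponent f (rowNorm N) ∉ K := by
  -- full flows of entropy at most `c` have exponents in a closed interval disjoint from `K`
  have hnear : ∀ x ∈ K, ∀ᶠ t in 𝓝 x, ∀ F, IsFullFlow Q F → flowEntropy Q F ≤ c →
      exponent f (rowNorm F) ≠ t := by
    intro x hx
    obtain ⟨U, hU, hcU⟩ := lt_rateFunction_iff.1 (hKc x hx)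
    filter_upwards [hU] with t ht F hF hFc hFt
    have h1 := hcU.trans_le (iInf_le (fun F : {F // IsFullFlow Q F ∧ exponent f (rowNorm F) ∈ U} =>
      ENNReal.ofReal (flowEntropy Q F.1)) ⟨F, hF, hFt ▸ ht⟩)
    exact (ENNReal.ofReal_le_ofReal hFc).not_gt h1
  have havoid : ∀ {t : ℝ≥0∞}, (∀ F, IsFullFlow Q F → flowEntropy Q F ≤ c →
      exponent f (rowNorm F) ≠ t) → ∀ F, IsFullFlow Q F → flowEntropy Q F ≤ c →
        t ∉ Set.uIcc (exponent f (rowNorm F)) (exponent f Q) := by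
    intro t ht F hF hFc htF
    obtain ⟨F', hF', hle, heq⟩ := h.exists_full_of_mem_uIcc hF htF
    exact ht F' hF' (hle.trans hFc) heq
  have hstar : exponent f Q ∉ K := fun hmem => (hnear _ hmem).self_of_nhds (chainFlow φ Q)
    h.isFullFlow (by rw [h.flowEntropy_chainFlow]; exact hc) (by rw [h.rowNorm_chainFlow])
  have hup : ∀ᶠ N in 𝓝 ν, (∀ i j, 0 ≤ N i j) → exponent f (rowNorm N) ∈ K →
      ¬ exponent f Q ≤ exponent f (rowNorm N) := by
    by_contra hcon
    rw [not_eventually] at hcon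
    push Not at hcon
    obtain ⟨N₀, -, hN₀K, hN₀⟩ := hcon.exists
    obtain ⟨k, ⟨hkK, hk⟩, hkmin⟩ := (hK.inter isClosed_Ici).isCompact.exists_isLeast
      ⟨exponent f (rowNorm N₀), hN₀K, hN₀⟩
    have hk' : exponent f Q < k := lt_of_le_of_ne hk fun heq => hstar (heq ▸ hkK)
    obtain ⟨a, ⟨hQa, hak⟩, ha⟩ := exists_Ioc_subset_of_mem_nhds' (hnear k hkK) hk'
    obtain ⟨θ, haθ, hθk⟩ := ENNReal.lt_iff_exists_nnreal_btwn.1 hak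
    obtain ⟨θ', hθθ', hθ'k⟩ := ENNReal.lt_iff_exists_nnreal_btwn.1 hθk
    have hθ0 : (0 : ℝ) < θ := by
      have : (0 : ℝ≥0∞) < θ := bot_le.trans_lt haθ
      exact_mod_cast this
    have hlt : (θ : ℝ) < θ' := by exact_mod_cast hθθ'
    have hadm : Admissible f (rowNorm ν) θ' := by
      refine admissible_of_frequently hν.nonneg (hcon.mono fun N hN => ⟨hN.1, ?_⟩)
      refine Admissible.of_lt_exponent (rowNorm_nonneg hN.1) (fun i => sum_rowNorm_le_one i)
        θ'.coe_nonneg ?_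
      rw [ENNReal.ofReal_coe_nnreal]
      exact hθ'k.trans_le (hkmin hN.2)
    obtain ⟨F, hF, hFc, hFθ⟩ := h.exists_full_of_admissible hν hθ0 hlt hadm (sub_pos.2 hνc)
    have hθF := hFθ.le_exponent (rowNorm_nonneg hF.nonneg)
    rw [ENNReal.ofReal_coe_nnreal] at hθF
    refine havoid (ha ⟨haθ, hθk.le⟩) F hF (by linarith) ?_
    rw [Set.uIcc_of_ge ((hQa.trans haθ.le).trans hθF)]
    exact ⟨hQa.trans haθ.le, hθF⟩
  have hdown : ∀ᶠ N in 𝓝 ν, (∀ i j, 0 ≤ N i j) → (∀ i j, 0 < N i j → 0 < Q i j) →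
      exponent f (rowNorm N) ∈ K → ¬ exponent f (rowNorm N) ≤ exponent f Q := by
    rcases Set.eq_empty_or_nonempty (K ∩ Set.Iic (exponent f Q)) with hemp | hne
    · refine Eventually.of_forall fun N _ _ hNK hN => ?_
      exact (hemp.subset ⟨hNK, hN⟩ : _ ∈ (∅ : Set ℝ≥0∞))
    obtain ⟨k, ⟨hkK, hk⟩, hkmax⟩ := (hK.inter isClosed_Iic).isCompact.exists_isGreatest hne
    have hk' : k < exponent f Q := lt_of_le_of_ne hk fun heq => hstar (heq ▸ hkK)
    obtain ⟨b, ⟨hkb, hb⟩, hbsub⟩ := exists_Ico_subset_of_mem_nhds' (hnear k hkK) hk'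
    obtain ⟨θ', hkθ', hθ'b⟩ := ENNReal.lt_iff_exists_nnreal_btwn.1 hkb
    obtain ⟨θ, hkθ, hθθ'⟩ := ENNReal.lt_iff_exists_nnreal_btwn.1 hkθ'
    have hθ0 : (0 : ℝ) < θ := by
      have : (0 : ℝ≥0∞) < θ := bot_le.trans_lt hkθ
      exact_mod_cast this
    have hlt : (θ : ℝ) < θ' := by exact_mod_cast hθθ'
    have hall : ∀ F, IsFullFlow Q F → flowEntropy Q F < flowEntropy Q ν + (c - flowEntropy Q ν) →
        Admissible f (rowNorm F) θ' := by
      intro F hF hFc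
      refine Admissible.of_lt_exponent (rowNorm_nonneg hF.nonneg) (fun i => sum_rowNorm_le_one i)
        θ'.coe_nonneg ?_
      rw [ENNReal.ofReal_coe_nnreal]
      by_contra hle
      refine havoid (hbsub ⟨hkθ'.le, hθ'b⟩) F hF (by linarith) ?_
      rw [Set.uIcc_of_le ((not_lt.1 hle).trans (hθ'b.le.trans hb))]
      exact ⟨not_lt.1 hle, hθ'b.le.trans hb⟩
    filter_upwards [h.eventually_admissible_of_forall_full hν hθ0 hlt (sub_pos.2 hνc) hall]
      with N hN hN0 hNQ hNK hNle
    have h1 := (hN hN0 hNQ).le_exponent (rowNorm_nonneg hN0)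
    rw [ENNReal.ofReal_coe_nnreal] at h1
    exact (hkθ.trans_le h1).not_ge (hkmax ⟨hNK, hNle⟩)
  filter_upwards [hup, hdown] with N h1 h2 hN0 hNQ hNK
  rcases le_total (exponent f Q) (exponent f (rowNorm N)) with hle | hle
  · exact h1 hN0 hNK hle
  · exact h2 hN0 hNQ hNK hle

lemma le_liminf_logProbRate {Ω E : Type*} [MeasurableSpace Ω] {P : Measure Ω} {Z : ℕ → Ω → E}
    {B : Set E} {a : ℝ}
    (h : ∀ᶠ n : ℕ in atTop, ENNReal.ofReal (Real.exp (-(a * n))) ≤ P {ω | Z n ω ∈ B}) :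
    ((-a : ℝ) : EReal) ≤ liminf (logProbRate P Z B) atTop := by
  refine le_liminf_of_le (by isBoundedDefault) ?_
  filter_upwards [h, eventually_gt_atTop 0] with n hn hn0
  have h1 := ENNReal.log_le_log hn
  rw [ENNReal.log_ofReal_of_pos (Real.exp_pos _), Real.log_exp] at h1
  have hn' : (n : ℝ) ≠ 0 := by positivity
  calc ((-a : ℝ) : EReal) = (((n : ℝ)⁻¹ : ℝ) : EReal) * ((-(a * n) : ℝ) : EReal) := by
        rw [← EReal.coe_mul]
        congr 1
        field_simp
    _ ≤ _ := mul_le_mul_of_nonneg_left h1 (by exact_mod_cast inv_nonneg.2 n.cast_nonneg)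

lemma limsup_logProbRate_le {Ω E : Type*} [MeasurableSpace Ω] {P : Measure Ω} {Z : ℕ → Ω → E}
    {B : Set E} {a : ℝ} {d : ℕ}
    (h : ∀ᶠ n : ℕ in atTop,
      P {ω | Z n ω ∈ B} ≤ ENNReal.ofReal (((n : ℝ) + 1) ^ d * Real.exp (-(a * n)))) :
    limsup (logProbRate P Z B) atTop ≤ ((-a : ℝ) : EReal) := by
  have hlim : Tendsto (fun n : ℕ => (n : ℝ)⁻¹ * (d * Real.log (n + 1)) + -a) atTop (𝓝 (-a)) := by
    have h1 : Tendsto (fun n : ℕ => Real.log ((n : ℝ) + 1) / (n : ℝ)) atTop (𝓝 0) := by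
      refine ((Real.tendsto_pow_log_div_mul_add_atTop 1 (-1) 1 one_ne_zero).comp
        (tendsto_natCast_atTop_atTop.comp (tendsto_add_atTop_nat 1))).congr fun n => ?_
      simp
    have h2 := (h1.const_mul (d : ℝ)).add_const (-a)
    rw [mul_zero, zero_add] at h2
    refine h2.congr fun n => ?_
    ring
  rw [← ((continuous_coe_real_ereal.tendsto _).comp hlim).limsup_eq]
  refine limsup_le_limsup ?_
  filter_upwards [h, eventually_gt_atTop 0] with n hn hn0
  have hpos : (0 : ℝ) < (n : ℝ) + 1 := by positivity
  have h1 := ENNReal.log_le_log hn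
  rw [ENNReal.log_ofReal_of_pos (mul_pos (pow_pos hpos d) (Real.exp_pos _)),
    Real.log_mul (pow_pos hpos d).ne' (Real.exp_pos _).ne', Real.log_exp, Real.log_pow] at h1
  have hn' : (n : ℝ) ≠ 0 := by positivity
  calc logProbRate P Z B n
      ≤ (((n : ℝ)⁻¹ : ℝ) : EReal) * ((d * Real.log (n + 1) + -(a * n) : ℝ) : EReal) :=
        mul_le_mul_of_nonneg_left h1 (by exact_mod_cast inv_nonneg.2 n.cast_nonneg)
    _ = (((n : ℝ)⁻¹ * (d * Real.log (n + 1)) + -a : ℝ) : EReal) := by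
        rw [← EReal.coe_mul]
        congr 1
        field_simp

variable {Ω : Type*} [MeasurableSpace Ω] {P : Measure Ω} [IsProbabilityMeasure P]
  {X : ℕ → Ω → Fin M}

/-- The large deviation lower bound: the exponent is continuous at full flows. -/
lemma IsMarkovChain.le_liminf (hX : IsMarkovChain P Q X) (h : IsDriftChain Q f φ) (B : Set ℝ≥0∞) :
    -((⨅ x ∈ interior B, rateFunction Q f x : ℝ≥0∞) : EReal) ≤
      liminf (logProbRate P (fun n ω => loynesEstimate f n fun k => X k ω) B) atTop := by
  by_contra! hcon
  obtain ⟨q, hq1, hq2⟩ := EReal.lt_iff_exists_real_btwn.1 (EReal.lt_neg_comm.1 hcon)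
  have hq1' : (⨅ x ∈ interior B, rateFunction Q f x) < ENNReal.ofReal q := by
    rw [← EReal.coe_ennreal_lt_coe_ennreal_iff, EReal.coe_ennreal_ofReal]
    exact hq1.trans_le (by exact_mod_cast le_max_left q 0)
  obtain ⟨x, hx⟩ := iInf_lt_iff.1 hq1'
  obtain ⟨hxB, hxq⟩ := iInf_lt_iff.1 hx
  obtain ⟨F, hF, hFB, hFq⟩ := exists_full_of_rateFunction_lt hxq (isOpen_interior.mem_nhds hxB)
  have hq0 : 0 < q := by
    by_contra hq0
    rw [ENNReal.ofReal_of_nonpos (not_lt.1 hq0)] at hFq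
    exact not_lt_bot hFq
  have hFq' : flowEntropy Q F < q := (ENNReal.ofReal_lt_ofReal_iff hq0).1 hFq
  have hlb := eventually_le_flowMass h.nonneg
    (fun i => exists_pos_of_sum_eq_one (h.row_sum i)) h.reach hF.toIsFlow hF.full
    (p := initialLaw P X) initialLaw_nonneg hX.sum_initialLaw
    (h.eventually_exponent_mem hF (isOpen_interior.mem_nhds hFB)) (sub_pos.2 hFq')
  have h1 : ((-q : ℝ) : EReal) ≤
      liminf (logProbRate P (fun n ω => loynesEstimate f n fun k => X k ω) B) atTop := by
    refine le_liminf_logProbRate ?_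
    filter_upwards [hlb, eventually_gt_atTop 0] with n hn hn0
    rw [← hX.measureReal_empiricalFlow, add_sub_cancel] at hn
    refine ENNReal.ofReal_le_of_le_toReal (hn.trans ?_)
    refine measureReal_mono fun ω hω => ?_
    simp only [Set.mem_ofPred_eq] at hω ⊢
    rw [loynesEstimate_eq_empiricalFlow f hn0]
    exact interior_subset (hω (empiricalFlow_nonneg X n ω))
  rw [EReal.coe_neg] at h1
  exact (h1.trans_lt (EReal.lt_neg_comm.1 hq2)).false

/-- The large deviation upper bound. Two levels `q' < q` leave a margin of entropy, in which flows
are perturbed to full flows. -/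
lemma IsMarkovChain.limsup_le (hX : IsMarkovChain P Q X) (h : IsDriftChain Q f φ) (B : Set ℝ≥0∞) :
    limsup (logProbRate P (fun n ω => loynesEstimate f n fun k => X k ω) B) atTop ≤
      -((⨅ x ∈ closure B, rateFunction Q f x : ℝ≥0∞) : EReal) := by
  by_contra! hcon
  obtain ⟨q, hq1, hq2⟩ := EReal.lt_iff_exists_real_btwn.1 hcon
  obtain ⟨q', hq1', hq2'⟩ := EReal.lt_iff_exists_real_btwn.1 hq1
  have hqq' : q' < q := by exact_mod_cast hq2'
  have hub := eventually_flowMass_le (S := {N | exponent f (rowNorm N) ∈ closure B}) (c := -q)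
    h.nonneg (p := initialLaw P X) initialLaw_nonneg hX.sum_initialLaw fun ν hν hνq => by
      have hν0 := flowEntropy_nonneg h.nonneg h.row_sum hν.nonneg hν.supp
      refine h.eventually_exponent_notMem isClosed_closure (c := -q') (by linarith)
        (fun x hx => ?_) hν (by linarith)
      refine lt_of_lt_of_le (b := ⨅ x ∈ closure B, rateFunction Q f x) ?_ (iInf₂_le x hx)
      rw [← EReal.coe_ennreal_lt_coe_ennreal_iff, EReal.coe_ennreal_ofReal,
        max_eq_left (by linarith), EReal.coe_neg]
      exact EReal.neg_lt_comm.1 hq1'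
  have h1 := limsup_logProbRate_le (P := P)
    (Z := fun n ω => loynesEstimate f n fun k => X k ω) (B := B) (a := -q)
    (d := Fintype.card (Fin M) * Fintype.card (Fin M)) (by
      filter_upwards [hub, eventually_gt_atTop 0] with n hn hn0
      rw [← hX.measureReal_empiricalFlow] at hn
      refine le_trans (measure_mono fun ω hω => ?_)
        ((ENNReal.le_ofReal_iff_toReal_le (measure_ne_top P _) (by positivity)).2 hn)
      simp only [Set.mem_ofPred_eq] at hω ⊢
      rw [← loynesEstimate_eq_empiricalFlow f hn0]
      exact subset_closure hω)
  rw [neg_neg] at h1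
  exact (h1.trans_lt hq2).false

end RateFunction

theorem theorem4 {M : ℕ} {Ω : Type*} [MeasurableSpace Ω] (P : Measure Ω) [IsProbabilityMeasure P]
    (Q : Matrix (Fin M) (Fin M) ℝ) (hQ : Q.IsIrreducible)
    (X : ℕ → Ω → Fin M) (hX : IsMarkovChain P Q X)
    (f : Fin M → ℝ) (hf : ∀ i, f i ≠ 0)
    -- negative mean of the increments under the stationary distribution `φ` of `Q`
    (φ : Fin M → ℝ) (hφ : φ ∈ stdSimplex ℝ (Fin M)) (hφQ : φ ᵥ* Q = φ)
    (hdrift : ∑ i, φ i * f i < 0) :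
    ∃ (lam : ℝ → ℝ) (J : ℝ≥0∞ → ℝ≥0∞),
      IsScaledCGF P (fun n ω => f (X n ω)) lam ∧
      (∀ n, Measurable fun ω => loynesEstimate f n fun k => X k ω) ∧
      IsGoodRateFunction J ∧
      SatisfiesLDP P (fun n ω => loynesEstimate f n fun k => X k ω) J ∧
      ∀ x : ℝ≥0∞, J x = 0 ↔ x = loynesExponent lam := by
  have h := isDriftChain_of_isMarkovChain hQ hX hφ hφQ hdrift
  obtain ⟨lam, hlam, hexp⟩ := hX.exists_scaledCGF h.reach f
  refine ⟨lam, rateFunction Q f, hlam, hX.measurable_loynesEstimate f,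
    isGoodRateFunction_rateFunction Q f, fun B _ => ⟨hX.le_liminf h B, hX.limsup_le h B⟩,
    fun x => ?_⟩
  rw [hexp]
  exact h.rateFunction_eq_zero_iff x
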